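/- Let $n\ge 1$ and let $p,q,t\in\mathbb{C}$ with $|p|<1$, $|q|<1$, $0<|t|<1$. Put $$(u;p)_\infty=\prod_{\mu\ge 0}(1-p^\mu u),\qquad \theta(u;p)=(u;p)_\infty(p/u;p)_\infty,$$ $$(u;p,q)_\infty=\prod_{\mu,\nu\ge 0}(1-p^\mu q^\nu u),\qquad \Gamma(u;p,q)=\frac{(pq/u;p,q)_\infty}{(u;p,q)_\infty}$$ for $u\in\mathbb{C}^*$, and for $a_1,\ldots,a_6\in\mathbb{C}^*$ let $$I(a_1,\ldots,a_6)=\frac{1}{(2\pi\sqrt{-1})^n}\int_{\mathbb{T}^n}\prod_{i=1}^{n}\frac{\prod_{m=1}^{6}\Gamma(a_mz_i^{\pm1};p,q)}{\Gamma(z_i^{\pm2};p,q)}\prod_{1\le j<k\le n}\frac{\Gamma(tz_j^{\pm1}z_k^{\pm1};p,q)}{\Gamma(z_j^{\pm1}z_k^{\pm1};p,q)}\,\frac{dz_1\cdots dz_n}{z_1\cdots z_n},$$ where $\mathbb{T}^n=\{|z_1|=\cdots=|z_n|=1\}$ and double signs indicate the product over all choices of signs. Suppose that $|p|<|t|^{2n-2}$,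 that $a_1,\ldots,a_6\in\mathbb{C}^*$ satisfy the balancing condition $a_1\cdots a_6\,t^{2n-2}=pq$, and that $|a_1|,\ldots,|a_5|<1$ and $|a_6|<|q|$. Then for every $k=1,\ldots,5$ $$I(a_1,\ldots,a_6)=I(a_1,\ldots,qa_k,\ldots,a_5,q^{-1}a_6)\prod_{i=1}^{n}\ \prod_{\substack{1\le m\le 5\\ m\ne k}}\frac{\theta(q^{-1}a_ma_6t^{i-1};p)}{\theta(a_ma_kt^{i-1};p)},$$ where the integrals on both sides converge absolutely and all the theta functions in the denominators are nonzero. -/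

import Mathlib

open scoped Real

noncomputable section

namespace EllipticSelberg

/-- The one-base shifted factorial `(u; p)_∞ = ∏_{μ ≥ 0} (1 - p^μ u)`, for `|p| < 1`. -/
def qPoch (u p : ℂ) : ℂ :=
  ∏' μ : ℕ, (1 - p ^ μ * u)

/-- The two-base shifted factorial `(u; p, q)_∞ = ∏_{μ, ν ≥ 0} (1 - p^μ q^ν u)`,
for `|p| < 1` and `|q| < 1`. -/
def qqPoch (u p q : ℂ) : ℂ :=
  ∏' μν : ℕ × ℕ, (1 - p ^ μν.1 * q ^ μν.2 * u)

/-- The infinite product that defines `(u; p)_∞` converges. -/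
theorem multipliable_qPoch (u : ℂ) {p : ℂ} (hp : ‖p‖ < 1) :
    Multipliable fun μ : ℕ => 1 - p ^ μ * u := by
  have h : Summable fun μ : ℕ => ‖-(p ^ μ * u)‖ := by
    simp only [norm_neg, norm_mul, norm_pow]
    exact (summable_geometric_of_lt_one (norm_nonneg p) hp).mul_right _
  simpa only [sub_eq_add_neg] using multipliable_one_add_of_summable h

/-- The infinite product that defines `(u; p, q)_∞` converges. -/
theorem multipliable_qqPoch (u : ℂ) {p q : ℂ} (hp : ‖p‖ < 1) (hq : ‖q‖ < 1) :
    Multipliable fun μν : ℕ × ℕ => 1 - p ^ μν.1 * q ^ μν.2 * u := by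
  have h : Summable fun μν : ℕ × ℕ => ‖-(p ^ μν.1 * q ^ μν.2 * u)‖ := by
    simp only [norm_neg, norm_mul, norm_pow]
    exact ((summable_geometric_of_lt_one (norm_nonneg p) hp).mul_of_nonneg
      (summable_geometric_of_lt_one (norm_nonneg q) hq)
      (fun _ => by positivity) (fun _ => by positivity)).mul_right _
  simpa only [sub_eq_add_neg] using multipliable_one_add_of_summable h

/-- The multiplicative theta function `θ(u; p) = (u; p)_∞ (p / u; p)_∞`, for `u ≠ 0`. -/
def theta (u p : ℂ) : ℂ :=
  qPoch u p * qPoch (p / u) p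

/-- The Ruijsenaars elliptic gamma function
`Γ(u; p, q) = (p q / u; p, q)_∞ / (u; p, q)_∞`, for `u ≠ 0`. -/
def ellGamma (u p q : ℂ) : ℂ :=
  qqPoch (p * q / u) p q / qqPoch u p q

/-- `Γ(c u^{±1}; p, q) = Γ(c u; p, q) Γ(c u⁻¹; p, q)`. -/
def ellGammaPM (c u p q : ℂ) : ℂ :=
  ellGamma (c * u) p q * ellGamma (c * u⁻¹) p q

/-- `Γ(c u^{±1} v^{±1}; p, q)`, the product over all four choices of signs. -/
def ellGammaPMPM (c u v p q : ℂ) : ℂ :=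
  ellGamma (c * u * v) p q * ellGamma (c * u * v⁻¹) p q *
    ellGamma (c * u⁻¹ * v) p q * ellGamma (c * u⁻¹ * v⁻¹) p q

/-- The function `Ψ(a_1, …, a_6; z)`. On the torus `|z_i| = 1` the factors
`Γ(z_i^{±2})` and `Γ(z_j^{±1} z_k^{±1})` have no zeros; where they have a pole, the convention
`x / 0 = 0` gives their reciprocals the correct value `0`. -/
def Psi {n : ℕ} (p q t : ℂ) (a : Fin 6 → ℂ) (z : Fin n → ℂ) : ℂ :=
  (∏ i, (∏ m, ellGammaPM (a m) (z i) p q) / ellGammaPM 1 (z i ^ 2) p q) *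
    ∏ j, ∏ k ∈ Finset.Ioi j, ellGammaPMPM t (z j) (z k) p q / ellGammaPMPM 1 (z j) (z k) p q

/-- The coefficient of `dz_1 ⋯ dz_n` in `Ψ(z) dz_1 ⋯ dz_n / (z_1 ⋯ z_n)`. -/
def integrand {n : ℕ} (p q t : ℂ) (a : Fin 6 → ℂ) (z : Fin n → ℂ) : ℂ :=
  Psi p q t a z / ∏ i, z i

/-- The `BC_n` elliptic Selberg integral
`I(a_1, …, a_6) = (2π√-1)^{-n} ∫_{𝕋^n} Ψ(a_1, …, a_6; z) dz_1 ⋯ dz_n / (z_1 ⋯ z_n)`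
over the torus `|z_1| = ⋯ = |z_n| = 1`. -/
def selbergI (n : ℕ) (p q t : ℂ) (a : Fin 6 → ℂ) : ℂ :=
  ((2 * π * Complex.I) ^ n)⁻¹ *
    torusIntegral (n := n) (integrand p q t a) (fun _ => 0) (fun _ => 1)

/-- The parameters `(a_1, …, q a_k, …, a_5, q⁻¹ a_6)`, for `k` among the first five indices. -/
def shift (q : ℂ) (k : Fin 5) (a : Fin 6 → ℂ) : Fin 6 → ℂ :=
  Function.update (Function.update a k.castSucc (q * a k.castSucc))
    (Fin.last 5) (q⁻¹ * a (Fin.last 5))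

end EllipticSelberg

end

open scoped Real

noncomputable section

namespace EllipticSelberg

/-! ### The infinite products -/

/-! Put β = (a_1, …, a_5, q⁻¹a_6). Then ∏ β_m · t^{2n-2} = p and all |β_m| < 1, and the two
integrals come from one weight Ψ(β): replacing β_m by qβ_m multiplies Ψ by ∏_i θ(β_m z_i^{±1}; p)
(`Psi_update`). With a = β_k and b = β_6, the claim is therefore the ratio of the integrals of Ψ(β)
∏ θ(a z_i^{±1}) and Ψ(β) ∏ θ(b z_i^{±1}). It suffices to write some A ∏ θ(a z_i^{±1}) + B ∏ θ(b
z_i^{±1}) as a combination of functions whose integral against Ψ(β) is zero, and to know A : B.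

Analysis. The null functions are the `stokes` sums. Multiplied by Ψ(β), the coefficient `fPlus`
becomes a function of one variable w (`gKernel`) that is holomorphic on 1 ≤ |w| ≤ |q|⁻¹ and changes
sign under w ↦ 1/(qw). This map exchanges the two boundary circles, so Cauchy's theorem makes the
integral equal to its own negative (`integral_circle_eq_zero_of_reflection`). The parameter c in
`stokes` is free, which gives enough null functions.

Algebra. In each variable separately, after poles are cleared, the balancing condition puts all the
functions involved into one space of theta functions (`Quasi`), where vanishing at enough points
forces vanishing (`Quasi.eq_zero`). Exchanging points one at a time reduces the wanted identity to
the sets {a, at, …, at^{s-1}, b, bt, …, bt^{r-1}} (`combo_eq_zero`). There at most two terms of each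
`stokes` sum survive, so the conditions form a two-term recursion; the choice c = at^j turns its
solution into a triangular linear system, and A : B is a product of values of `fPlus`
(`exists_combo`). Telescoping and a reflection evaluate that product (`fPlus_grid`,
`prod_fPlus_grid`, `prod_reflection`).

The algebra needs certain theta values to be nonzero. A deformation of β that preserves the
balancing condition makes them nonzero for all but countably many deformation parameters, and
continuity gives the general case (`torusAvg_relation`). In the lemmas about the full identity there
are n + 1 variables, so that the exponent of t is 2n. -/

theorem differentiable_tprod_one_sub {ι : Type*} {b : ι → ℂ} (hb : Summable fun i => ‖b i‖) :
    Differentiable ℂ fun u : ℂ => ∏' i, (1 - b i * u) := by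
  intro u
  have hu : u ∈ Metric.ball (0 : ℂ) (‖u‖ + 1) := by simp
  have h := Summable.hasProdLocallyUniformlyOn_one_add (K := Metric.ball (0 : ℂ) (‖u‖ + 1))
    (f := fun i u => -(b i * u)) (u := fun i => ‖b i‖ * (‖u‖ + 1)) Metric.isOpen_ball
    (hb.mul_right _) (.of_forall fun i x hx => by
      rw [norm_neg, norm_mul]
      have : ‖x‖ < ‖u‖ + 1 := by simpa using hx
      gcongr) (fun i => by fun_prop)
  have h2 := h.differentiableOn
    (.of_forall fun _ => by simpa [Finset.prod_fn] using
      DifferentiableOn.finsetProd (fun _ _ => by fun_prop)) Metric.isOpen_ball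
  simpa only [sub_eq_add_neg] using (h2.differentiableAt (Metric.isOpen_ball.mem_nhds hu))

theorem summable_norm_pow {p : ℂ} (hp : ‖p‖ < 1) : Summable fun μ : ℕ => ‖p ^ μ‖ := by
  simpa only [norm_pow] using summable_geometric_of_lt_one (norm_nonneg p) hp

theorem summable_norm_pow_mul_pow {p q : ℂ} (hp : ‖p‖ < 1) (hq : ‖q‖ < 1) :
    Summable fun μν : ℕ × ℕ => ‖p ^ μν.1 * q ^ μν.2‖ := by
  simp only [norm_mul]
  exact (summable_norm_pow hp).mul_of_nonneg (summable_norm_pow hq)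
    (fun _ => norm_nonneg _) (fun _ => norm_nonneg _)

theorem differentiable_qPoch {p : ℂ} (hp : ‖p‖ < 1) : Differentiable ℂ fun u => qPoch u p :=
  differentiable_tprod_one_sub (summable_norm_pow hp)

theorem differentiable_qqPoch {p q : ℂ} (hp : ‖p‖ < 1) (hq : ‖q‖ < 1) :
    Differentiable ℂ fun u => qqPoch u p q :=
  differentiable_tprod_one_sub (summable_norm_pow_mul_pow hp hq)

/-- An absolutely convergent product can vanish only through one of its factors. This locates the
zeros of both shifted factorials. -/
theorem exists_eq_one_of_tprod_eq_zero {ι : Type*} {b : ι → ℂ} (hb : Summable fun i => ‖b i‖)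
    {u : ℂ} (h : ∏' i, (1 - b i * u) = 0) : ∃ i, b i * u = 1 := by
  by_contra! hne
  refine tprod_one_add_ne_zero_of_summable (f := fun i => -(b i * u)) (fun i => ?_) ?_
    (by simpa only [sub_eq_add_neg] using h)
  · rw [← sub_eq_add_neg]
    exact sub_ne_zero.mpr (hne i).symm
  · simpa only [norm_neg, norm_mul] using hb.mul_right ‖u‖

theorem exists_of_qPoch_eq_zero {p u : ℂ} (hp : ‖p‖ < 1) (h : qPoch u p = 0) :
    ∃ k : ℕ, p ^ k * u = 1 :=
  exists_eq_one_of_tprod_eq_zero (summable_norm_pow hp) h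

theorem qPoch_ne_zero {p u : ℂ} (hp : ‖p‖ < 1) (hu : ‖u‖ < 1) : qPoch u p ≠ 0 := by
  intro h
  obtain ⟨k, hk⟩ := exists_of_qPoch_eq_zero hp h
  have := congrArg norm hk
  rw [norm_mul, norm_pow, norm_one] at this
  have h1 : ‖p‖ ^ k ≤ 1 := pow_le_one₀ (norm_nonneg _) hp.le
  nlinarith [norm_nonneg u]

theorem qqPoch_ne_zero {p q u : ℂ} (hp : ‖p‖ < 1) (hq : ‖q‖ < 1) (hu : ‖u‖ < 1) :
    qqPoch u p q ≠ 0 := by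
  intro h
  obtain ⟨⟨k, l⟩, hk⟩ := exists_eq_one_of_tprod_eq_zero (summable_norm_pow_mul_pow hp hq) h
  have := congrArg norm hk
  rw [norm_mul, norm_mul, norm_pow, norm_pow, norm_one] at this
  have h1 : ‖p‖ ^ k * ‖q‖ ^ l ≤ 1 :=
    mul_le_one₀ (pow_le_one₀ (norm_nonneg _) hp.le) (by positivity)
      (pow_le_one₀ (norm_nonneg _) hq.le)
  have h2 : 0 ≤ ‖p‖ ^ k * ‖q‖ ^ l := by positivity
  nlinarith [norm_nonneg u]

theorem qPoch_eq_mul {p : ℂ} (hp : ‖p‖ < 1) (u : ℂ) :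
    qPoch u p = (1 - u) * qPoch (p * u) p := by
  have h0 : (fun μ : ℕ => 1 - p ^ (μ + 1) * u) = fun μ : ℕ => 1 - p ^ μ * (p * u) :=
    funext fun μ => by rw [pow_succ, mul_assoc]
  have h : Multipliable fun μ : ℕ => 1 - p ^ (μ + 1) * u := by
    rw [h0]; exact multipliable_qPoch (p * u) hp
  have h1 := tprod_eq_zero_mul' (f := fun μ : ℕ => 1 - p ^ μ * u) h
  rw [h0, pow_zero, one_mul] at h1
  exact h1

theorem qqPoch_comm (u p q : ℂ) : qqPoch u p q = qqPoch u q p := by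
  rw [qqPoch, qqPoch, ← (Equiv.prodComm ℕ ℕ).tprod_eq]
  simp [mul_comm]

/-- The factors with ν = 0 form the one-base product; lowering ν by one in the others amounts to u ↦
qu. -/
theorem qqPoch_eq_mul {p q : ℂ} (hp : ‖p‖ < 1) (hq : ‖q‖ < 1) (u : ℂ) :
    qqPoch u p q = qPoch u p * qqPoch (q * u) p q := by
  have key : ∀ v, HasProd (fun ν : ℕ => qPoch (q ^ ν * v) p) (qqPoch v p q) := by
    intro v
    have h1 := (multipliable_qqPoch v hq hp).hasProd
    have h2 := h1.prod_fiberwise (g := fun ν : ℕ => qPoch (q ^ ν * v) p) (fun ν => by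
      have h3 := (multipliable_qPoch (q ^ ν * v) hp).hasProd
      have h4 : (fun μ : ℕ => 1 - p ^ μ * (q ^ ν * v)) = fun μ : ℕ => 1 - q ^ ν * p ^ μ * v :=
        funext fun μ => by ring
      rw [← h4]
      exact h3)
    rwa [show (∏' μν : ℕ × ℕ, (1 - q ^ μν.1 * p ^ μν.2 * v)) = qqPoch v q p from rfl,
      qqPoch_comm] at h2
  rw [← (key u).tprod_eq, tprod_eq_zero_mul', pow_zero, one_mul, ← (key (q * u)).tprod_eq]
  · simp only [pow_succ, mul_assoc]
  · have := (key (q * u)).multipliable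
    simpa only [pow_succ, mul_assoc] using this

/-! ### The theta function -/

theorem theta_one {p : ℂ} (hp : ‖p‖ < 1) : theta 1 p = 0 := by
  rw [theta, qPoch_eq_mul hp]; simp

theorem theta_eq_one_sub_mul {p : ℂ} (hp : ‖p‖ < 1) (u : ℂ) :
    theta u p = (1 - u) * (qPoch (p * u) p * qPoch (p / u) p) := by
  rw [theta, qPoch_eq_mul hp, mul_assoc]

theorem theta_inv {p u : ℂ} (hp : ‖p‖ < 1) (hu : u ≠ 0) :
    theta u⁻¹ p = -u⁻¹ * theta u p := by
  rw [theta_eq_one_sub_mul hp, theta_eq_one_sub_mul hp, div_inv_eq_mul, div_eq_mul_inv]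
  field_simp
  ring

theorem theta_mul_base {p u : ℂ} (hp : ‖p‖ < 1) (hp0 : p ≠ 0) (hu : u ≠ 0) :
    theta (p * u) p = -u⁻¹ * theta u p := by
  rw [← theta_inv hp hu, theta, theta, mul_comm]
  congr 2 <;> field_simp

theorem theta_div_base {p u : ℂ} (hp : ‖p‖ < 1) (hp0 : p ≠ 0) (hu : u ≠ 0) :
    theta (u / p) p = -(u / p) * theta u p := by
  have h := theta_mul_base hp hp0 (div_ne_zero hu hp0)
  rw [mul_div_cancel₀ _ hp0] at h
  rw [h]
  field_simp

theorem theta_swap {p : ℂ} (hp : ‖p‖ < 1) {u v : ℂ} (hu : u ≠ 0) (hv : v ≠ 0) :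
    theta (u / v) p = -(u / v) * theta (v / u) p := by
  have := theta_inv hp (div_ne_zero hv hu)
  rw [inv_div] at this
  exact this

theorem theta_zpow_mul_eq_zero_iff {p u : ℂ} (hp : ‖p‖ < 1) (hp0 : p ≠ 0) (hu : u ≠ 0) (k : ℤ) :
    theta (p ^ k * u) p = 0 ↔ theta u p = 0 := by
  induction k using Int.induction_on with
  | zero => simp
  | succ i ih =>
    rw [zpow_add_one₀ hp0, mul_comm _ p, mul_assoc, theta_mul_base hp hp0 (by positivity), ← ih]
    simp [hu, hp0]
  | pred i ih =>
    rw [← ih, ← mul_div_cancel₀ (p ^ (-(i : ℤ)) * u) hp0,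
      theta_mul_base hp hp0 (by positivity), zpow_sub_one₀ hp0]
    simp only [mul_eq_zero, neg_eq_zero, inv_eq_zero]
    rw [show p ^ (-(i : ℤ)) * p⁻¹ * u = p ^ (-(i : ℤ)) * u / p by field_simp]
    simp [hu, hp0]

theorem theta_eq_zero_iff {p u : ℂ} (hp : ‖p‖ < 1) (hp0 : p ≠ 0) (hu : u ≠ 0) :
    theta u p = 0 ↔ ∃ k : ℤ, u = p ^ k := by
  constructor
  · intro h
    rcases mul_eq_zero.mp h with h | h
    · obtain ⟨k, hk⟩ := exists_of_qPoch_eq_zero hp h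
      refine ⟨-k, ?_⟩
      rw [zpow_neg, zpow_natCast]
      exact eq_inv_of_mul_eq_one_right hk
    · obtain ⟨k, hk⟩ := exists_of_qPoch_eq_zero hp h
      refine ⟨k + 1, ?_⟩
      rw [zpow_add_one₀ hp0, zpow_natCast]
      field_simp at hk
      exact hk.symm
  · rintro ⟨k, rfl⟩
    rw [← mul_one (p ^ k), theta_zpow_mul_eq_zero_iff hp hp0 one_ne_zero, theta_one hp]

theorem theta_ne_zero {p u : ℂ} (hp : ‖p‖ < 1) (hp0 : p ≠ 0) (h1 : ‖p‖ < ‖u‖) (h2 : ‖u‖ < 1) :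
    theta u p ≠ 0 := by
  have hu : u ≠ 0 := norm_pos_iff.mp ((norm_nonneg _).trans_lt h1)
  rw [Ne, theta_eq_zero_iff hp hp0 hu]
  rintro ⟨k, rfl⟩
  rw [norm_zpow] at h1 h2
  have hpos := norm_pos_iff.mpr hp0
  have h3 : ‖p‖ ^ (1 : ℤ) < ‖p‖ ^ k := by simpa using h1
  have h4 : ‖p‖ ^ k < ‖p‖ ^ (0 : ℤ) := by simpa using h2
  rw [zpow_lt_zpow_iff_right_of_lt_one₀ hpos hp] at h3 h4
  omega

theorem differentiableAt_theta {p u : ℂ} (hp : ‖p‖ < 1) (hu : u ≠ 0) :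
    DifferentiableAt ℂ (fun u => theta u p) u :=
  ((differentiable_qPoch hp) u).mul (((differentiable_qPoch hp) _).comp u
    ((differentiableAt_const p).div differentiableAt_id hu))

/-- Differentiate the quasi-periodicity relation at a zero, where the term with the differentiated
prefactor drops out. -/
theorem deriv_theta_mul_base {p u : ℂ} (hp : ‖p‖ < 1) (hp0 : p ≠ 0) (hu : u ≠ 0)
    (h0 : theta u p = 0) :
    p * deriv (fun u => theta u p) (p * u) = -u⁻¹ * deriv (fun u => theta u p) u := by
  have h1 : HasDerivAt (fun w => theta (p * w) p) (deriv (fun u => theta u p) (p * u) * (p * 1)) u :=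
    HasDerivAt.comp u (h₂ := fun u => theta u p)
      (differentiableAt_theta hp (mul_ne_zero hp0 hu)).hasDerivAt
      ((hasDerivAt_id u).const_mul p)
  have h2 := ((hasDerivAt_inv hu).neg).mul (differentiableAt_theta hp hu).hasDerivAt
  have h3 : (fun w => theta (p * w) p) =ᶠ[nhds u] fun w => -w⁻¹ * theta w p := by
    filter_upwards [isOpen_ne.mem_nhds hu] with w hw using theta_mul_base hp hp0 hw
  have := (h1.congr_of_eventuallyEq h3.symm).unique h2
  rw [h0] at this
  simp only [Pi.neg_apply] at this
  linear_combination this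

theorem deriv_theta_one {p : ℂ} (hp : ‖p‖ < 1) : deriv (fun u => theta u p) 1 ≠ 0 := by
  have h1 : DifferentiableAt ℂ (fun u => qPoch (p * u) p * qPoch (p / u) p) 1 :=
    (((differentiable_qPoch hp) _).comp _ (differentiableAt_id.const_mul p)).mul
      (((differentiable_qPoch hp) _).comp _
        ((differentiableAt_const p).div differentiableAt_id one_ne_zero))
  have h2 := ((hasDerivAt_id (1 : ℂ)).const_sub 1).mul h1.hasDerivAt
  have h3 : (fun u => theta u p) = fun u => (1 - u) * (qPoch (p * u) p * qPoch (p / u) p) :=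
    funext fun u => theta_eq_one_sub_mul hp u
  rw [h3]
  have h4 := h2.deriv
  simp only [id] at h4
  erw [h4]
  have := qPoch_ne_zero hp hp
  simp [this]

/-- The zero at 1 is simple because of the explicit factor 1 - u, and quasi-periodicity carries this
to every zero p^k. -/
theorem deriv_theta_ne_zero {p u : ℂ} (hp : ‖p‖ < 1) (hp0 : p ≠ 0) (hu : u ≠ 0)
    (h0 : theta u p = 0) : deriv (fun u => theta u p) u ≠ 0 := by
  obtain ⟨k, rfl⟩ := (theta_eq_zero_iff hp hp0 hu).mp h0
  clear h0 hu
  have key : ∀ k : ℤ, deriv (fun u => theta u p) (p ^ (k + 1)) ≠ 0 ↔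
      deriv (fun u => theta u p) (p ^ k) ≠ 0 := by
    intro k
    have hk : p ^ k ≠ 0 := zpow_ne_zero _ hp0
    have := deriv_theta_mul_base hp hp0 hk ((theta_eq_zero_iff hp hp0 hk).mpr ⟨k, rfl⟩)
    rw [zpow_add_one₀ hp0, mul_comm]
    rw [not_iff_not]
    constructor
    · intro h; rw [h] at this; simpa [hk, hp0] using this.symm
    · intro h; rw [h] at this; simpa [hk, hp0] using this
  induction k using Int.induction_on with
  | zero => simpa using deriv_theta_one hp
  | succ i ih => exact (key _).mpr ih
  | pred i ih => exact (key _).mp (by simpa using ih)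

/-! ### The elliptic gamma function -/

/-- For |u| < 1 the cancelled factors are nonzero, so the convention `x / 0 = 0` plays no role. -/
theorem ellGamma_mul_base {p q u : ℂ} (hp : ‖p‖ < 1) (hq : ‖q‖ < 1) (hq0 : q ≠ 0)
    (hu : u ≠ 0) (hu1 : ‖u‖ < 1) :
    ellGamma (q * u) p q = theta u p * ellGamma u p q := by
  rw [ellGamma, ellGamma, theta, qqPoch_eq_mul hp hq u]
  have h1 := qPoch_ne_zero hp hu1
  have h2 : p * q / (q * u) = p / u := by field_simp
  rw [h2, qqPoch_eq_mul hp hq (p / u)]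
  have h3 : q * (p / u) = p * q / u := by ring
  rw [h3]
  have h4 : ‖q * u‖ < 1 := by
    rw [norm_mul]; nlinarith [norm_nonneg q, norm_nonneg u]
  have h5 := qqPoch_ne_zero hp hq h4
  field_simp

/-- The double products cancel down to single ones. At u = 1 the convention `x / 0 = 0` makes the
left side 0, in agreement with θ(1) = 0; so the reciprocal weight is a holomorphic expression on the
whole circle. -/
theorem inv_ellGamma_mul_ellGamma_inv {p q u : ℂ} (hp : ‖p‖ < 1) (hq : ‖q‖ < 1)
    (hu : ‖u‖ = 1) :
    (ellGamma u p q * ellGamma u⁻¹ p q)⁻¹ = theta u p * theta u⁻¹ q := by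
  have hu0 : u ≠ 0 := norm_pos_iff.mp (by rw [hu]; exact one_pos)
  have hpq : ‖p * q‖ < 1 := by
    rw [norm_mul]; nlinarith [norm_nonneg q, norm_nonneg p]
  have h1 : qqPoch (p * q * u) p q ≠ 0 := qqPoch_ne_zero hp hq (by rw [norm_mul, hu, mul_one]; exact hpq)
  have h2 : qqPoch (p * q * u⁻¹) p q ≠ 0 :=
    qqPoch_ne_zero hp hq (by rw [norm_mul, norm_inv, hu, inv_one, mul_one]; exact hpq)
  have e1 : qqPoch u p q = qPoch u p * (qPoch (q * u) q * qqPoch (p * q * u) p q) := by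
    rw [qqPoch_eq_mul hp hq, qqPoch_comm, qqPoch_eq_mul hq hp (q * u), qqPoch_comm, mul_assoc]
  have e2 : qqPoch u⁻¹ p q = qPoch u⁻¹ q * (qPoch (p * u⁻¹) p * qqPoch (p * q * u⁻¹) p q) := by
    rw [qqPoch_comm, qqPoch_eq_mul hq hp, qqPoch_comm, qqPoch_eq_mul hp hq (p * u⁻¹)]
    ring_nf
  rw [ellGamma, ellGamma, theta, theta, div_inv_eq_mul, div_inv_eq_mul, e1, e2, div_eq_mul_inv (p * q),
    div_eq_mul_inv p u, mul_inv, inv_div, inv_div]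
  generalize qqPoch (p * q * u) p q = X at h1 ⊢
  generalize qqPoch (p * q * u⁻¹) p q = Y at h2 ⊢
  field_simp

theorem differentiableAt_ellGamma {p q u : ℂ} (hp : ‖p‖ < 1) (hq : ‖q‖ < 1) (hu : u ≠ 0)
    (hu1 : ‖u‖ < 1) : DifferentiableAt ℂ (fun u => ellGamma u p q) u :=
  (((differentiable_qqPoch hp hq) _).comp u ((differentiableAt_const _).div differentiableAt_id hu)).div
    ((differentiable_qqPoch hp hq) u) (qqPoch_ne_zero hp hq hu1)

/-! ### Quotients of theta functions without poles are constant -/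

/-- The function is bounded on the compact annulus |p| ≤ |w| ≤ 1, hence everywhere by periodicity;
composing with `exp` gives a bounded entire function, to which Liouville's theorem applies. -/
theorem eq_const_of_zpow_periodic {p : ℂ} (hp : ‖p‖ < 1) (hp0 : p ≠ 0) {h : ℂ → ℂ}
    (hd : ∀ w ≠ 0, DifferentiableAt ℂ h w) (hper : ∀ w ≠ 0, h (p * w) = h w) :
    ∀ w ≠ 0, h w = h 1 := by
  have hz : ∀ (k : ℤ) (w : ℂ), w ≠ 0 → h (p ^ k * w) = h w := by
    intro k w hw
    induction k using Int.induction_on with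
    | zero => simp
    | succ i ih =>
      rw [zpow_add_one₀ hp0, mul_comm _ p, mul_assoc, hper _ (by positivity), ih]
    | pred i ih =>
      rw [← ih, ← hper (p ^ (-(i : ℤ) - 1) * w) (by positivity), zpow_sub_one₀ hp0]
      congr 1
      field_simp
  let S : Set ℂ := Metric.closedBall 0 1 \ Metric.ball 0 ‖p‖
  have hS : IsCompact S := (isCompact_closedBall 0 1).diff Metric.isOpen_ball
  have hppos := norm_pos_iff.mpr hp0
  have hcont : ContinuousOn h S := by
    intro w hw
    have hw0 : w ≠ 0 := by
      rintro rfl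
      exact hw.2 (by simpa using hp0)
    exact (hd w hw0).continuousAt.continuousWithinAt
  obtain ⟨M, hM⟩ := hS.exists_bound_of_continuousOn hcont
  have hb : ∀ w ≠ 0, ‖h w‖ ≤ M := by
    intro w hw
    have hwpos := norm_pos_iff.mpr hw
    -- The base 1/|p| > 1 is used so that p^{k+1} w falls into the annulus.
    obtain ⟨k, hk1, hk2⟩ := exists_mem_Ioc_zpow hwpos ((one_lt_inv₀ hppos).mpr hp)
    rw [← hz (k + 1) w hw]
    apply hM
    rw [inv_zpow'] at hk1 hk2
    have hk : 0 < ‖p‖ ^ (k + 1) := by positivity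
    constructor
    · rw [Metric.mem_closedBall, dist_zero_right, norm_mul, norm_zpow]
      calc ‖p‖ ^ (k + 1) * ‖w‖ ≤ ‖p‖ ^ (k + 1) * ‖p‖ ^ (-(k + 1)) := by gcongr
        _ = 1 := by rw [← zpow_add₀ hppos.ne']; simp
    · rw [Metric.mem_ball, dist_zero_right, norm_mul, norm_zpow, not_lt]
      calc ‖p‖ = ‖p‖ ^ (k + 1) * ‖p‖ ^ (-k) := by rw [← zpow_add₀ hppos.ne']; simp
        _ ≤ _ := by gcongr
  intro w hw
  have hD : Differentiable ℂ (fun z => h (Complex.exp z)) := fun z =>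
    (hd _ (Complex.exp_ne_zero z)).comp z Complex.differentiable_exp.differentiableAt
  have hB : Bornology.IsBounded (Set.range fun z => h (Complex.exp z)) := by
    rw [isBounded_iff_forall_norm_le]
    exact ⟨M, by rintro _ ⟨z, rfl⟩; exact hb _ (Complex.exp_ne_zero z)⟩
  have := hD.apply_eq_apply_of_bounded hB (Complex.log w) 0
  simpa [Complex.exp_log hw] using this

/-- The quotient N/D has removable singularities, since N vanishes at the simple zeros of D, and it
is invariant under w ↦ pw because the multipliers agree. Hence it is constant. -/
theorem exists_eq_const_mul_of_simple_zeros {p : ℂ} (hp : ‖p‖ < 1) (hp0 : p ≠ 0)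
    {N D μ : ℂ → ℂ} (hN : ∀ w ≠ 0, DifferentiableAt ℂ N w)
    (hD : ∀ w ≠ 0, DifferentiableAt ℂ D w) (hμ : ∀ w ≠ 0, μ w ≠ 0)
    (hNp : ∀ w ≠ 0, N (p * w) = μ w * N w) (hDp : ∀ w ≠ 0, D (p * w) = μ w * D w)
    (hD' : ∀ w ≠ 0, D w = 0 → deriv D w ≠ 0) (hND : ∀ w ≠ 0, D w = 0 → N w = 0) :
    ∃ C, ∀ w ≠ 0, N w = C * D w := by
  -- At a zero of D the value is the limit of N/D; near that zero h is the quotient of the two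
  -- `dslope` functions.
  let h : ℂ → ℂ := fun w => if D w = 0 then deriv N w / deriv D w else N w / D w
  have hopen : IsOpen ({0}ᶜ : Set ℂ) := isOpen_compl_singleton
  have hds : ∀ {f : ℂ → ℂ}, (∀ w ≠ 0, DifferentiableAt ℂ f w) → ∀ w0 ≠ 0,
      DifferentiableAt ℂ (dslope f w0) w0 := by
    intro f hf w0 hw0
    exact ((Complex.differentiableOn_dslope (hopen.mem_nhds hw0)).mpr
      fun w hw => (hf w hw).differentiableWithinAt).differentiableAt (hopen.mem_nhds hw0)
  have key : ∀ w0 ≠ 0, DifferentiableAt ℂ h w0 ∧ ∀ᶠ w in nhdsWithin w0 {w0}ᶜ, D w ≠ 0 := by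
    intro w0 hw0
    by_cases h0 : D w0 = 0
    · have hne : ∀ᶠ w in nhds w0, dslope D w0 w ≠ 0 :=
        (hds hD w0 hw0).continuousAt.eventually_ne (by rw [dslope_same]; exact hD' w0 hw0 h0)
      constructor
      · refine ((hds hN w0 hw0).div (hds hD w0 hw0)
          (by rw [dslope_same]; exact hD' w0 hw0 h0)).congr_of_eventuallyEq ?_
        filter_upwards [hne] with w hw
        by_cases hww : w = w0
        · subst hww
          simp [h, h0, dslope_same]
        · have hsub := sub_ne_zero.mpr hww
          have hDw : D w ≠ 0 := by
            rintro hDw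
            apply hw
            rw [dslope_of_ne _ hww, slope_def_field, h0, hDw]
            simp
          simp only [h, hDw, if_false, Pi.div_apply, dslope_of_ne _ hww, slope_def_field, h0,
            hND w0 hw0 h0, sub_zero]
          field_simp
      · filter_upwards [hne.filter_mono nhdsWithin_le_nhds, self_mem_nhdsWithin] with w hw hww hDw
        apply hw
        rw [dslope_of_ne _ hww, slope_def_field, h0, hDw]
        simp
    · have hne : ∀ᶠ w in nhds w0, D w ≠ 0 := (hD w0 hw0).continuousAt.eventually_ne h0
      refine ⟨((hN w0 hw0).div (hD w0 hw0) h0).congr_of_eventuallyEq ?_,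
        hne.filter_mono nhdsWithin_le_nhds⟩
      filter_upwards [hne] with w hw
      simp [h, hw]
  have hper : ∀ w ≠ 0, h (p * w) = h w := by
    intro w0 hw0
    have c1 : ContinuousAt (fun w => h (p * w)) w0 :=
      ContinuousAt.comp (f := fun w => p * w) (g := h)
        (key (p * w0) (mul_ne_zero hp0 hw0)).1.continuousAt (by fun_prop)
    have c2 := (key w0 hw0).1.continuousAt
    -- Zeros of D are isolated, so periodicity on a punctured neighbourhood extends to the centre by
    -- continuity.
    refine ((ContinuousAt.eventuallyEq_nhds_iff_eventuallyEq_nhdsNE c1 c2).mp ?_).self_of_nhds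
    filter_upwards [(key w0 hw0).2, (hopen.mem_nhds hw0 |> mem_nhdsWithin_of_mem_nhds)]
      with w hw hw0
    have hmu := hμ w hw0
    simp only [h, hDp w hw0, hNp w hw0, mul_eq_zero, hmu, hw, or_self, if_false]
    field_simp
  have hconst := eq_const_of_zpow_periodic hp hp0 (fun w hw => (key w hw).1) hper
  refine ⟨h 1, fun w hw => ?_⟩
  by_cases h0 : D w = 0
  · rw [h0, hND w hw h0, mul_zero]
  · rw [← hconst w hw]
    simp only [h, h0, if_false]
    field_simp

/-! ### Products of two theta functions -/

/-- `θ(u v^{±1}; p)`. -/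
def pairTheta (u v p : ℂ) : ℂ := theta (u * v) p * theta (u / v) p

section PairTheta

variable {p : ℂ} (hp : ‖p‖ < 1) (hp0 : p ≠ 0) {u v w : ℂ} (hu : u ≠ 0) (hv : v ≠ 0)

theorem pairTheta_inv_right (u v p : ℂ) : pairTheta u v⁻¹ p = pairTheta u v p := by
  rw [pairTheta, pairTheta, div_inv_eq_mul, mul_comm, div_eq_mul_inv]

include hp hu hv

theorem pairTheta_inv_left : pairTheta u⁻¹ v p = (u ^ 2)⁻¹ * pairTheta u v p := by
  have h1 : u⁻¹ * v = (u / v)⁻¹ := by rw [inv_div, div_eq_mul_inv, mul_comm]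
  have h2 : u⁻¹ / v = (u * v)⁻¹ := by rw [mul_inv, div_eq_mul_inv]
  rw [pairTheta, h1, h2, theta_inv hp (div_ne_zero hu hv), theta_inv hp (mul_ne_zero hu hv),
    pairTheta]
  generalize theta (u * v) p = A
  generalize theta (u / v) p = B
  field_simp

theorem pairTheta_swap : pairTheta v u p = -(v / u) * pairTheta u v p := by
  rw [pairTheta, pairTheta, theta_swap hp hv hu, mul_comm v u]
  ring

include hp0

theorem pairTheta_mul_base_left : pairTheta (p * u) v p = (u ^ 2)⁻¹ * pairTheta u v p := by
  rw [pairTheta, mul_assoc, mul_div_assoc, theta_mul_base hp hp0 (mul_ne_zero hu hv),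
    theta_mul_base hp hp0 (div_ne_zero hu hv), pairTheta]
  generalize theta (u * v) p = A
  generalize theta (u / v) p = B
  field_simp

theorem pairTheta_mul_base_right :
    pairTheta u (p * v) p = p⁻¹ * (v ^ 2)⁻¹ * pairTheta u v p := by
  have h1 : u * (p * v) = p * (u * v) := by ring
  have h2 : u / (p * v) = u / v / p := by rw [mul_comm, div_div]
  rw [pairTheta, h1, h2, theta_mul_base hp hp0 (mul_ne_zero hu hv),
    theta_div_base hp hp0 (div_ne_zero hu hv), pairTheta]
  generalize theta (u * v) p = A
  generalize theta (u / v) p = B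
  field_simp

end PairTheta

theorem pairTheta_self {p u : ℂ} (hp : ‖p‖ < 1) (hu : u ≠ 0) : pairTheta u u p = 0 := by
  rw [pairTheta, div_self hu, theta_one hp, mul_zero]

theorem differentiableAt_pairTheta_left {p u v : ℂ} (hp : ‖p‖ < 1) (hu : u ≠ 0) (hv : v ≠ 0) :
    DifferentiableAt ℂ (fun w => pairTheta w v p) u :=
  (DifferentiableAt.comp (f := fun w => w * v) (g := fun x => theta x p) u
      (differentiableAt_theta hp (mul_ne_zero hu hv)) (by fun_prop)).mul
    (DifferentiableAt.comp (f := fun w => w / v) (g := fun x => theta x p) u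
      (differentiableAt_theta hp (div_ne_zero hu hv)) (by fun_prop))

theorem differentiableAt_pairTheta_right {p u v : ℂ} (hp : ‖p‖ < 1) (hu : u ≠ 0) (hv : v ≠ 0) :
    DifferentiableAt ℂ (fun w => pairTheta u w p) v :=
  (DifferentiableAt.comp (f := fun w => u * w) (g := fun x => theta x p) v
      (differentiableAt_theta hp (mul_ne_zero hu hv)) (by fun_prop)).mul
    (DifferentiableAt.comp (f := fun w => u / w) (g := fun x => theta x p) v
      (differentiableAt_theta hp (div_ne_zero hu hv)) (by fun_prop (disch := assumption)))

theorem theta_mul_eq_zero {p u v : ℂ} (hp : ‖p‖ < 1) (hp0 : p ≠ 0) (hu : u ≠ 0) (hv : v ≠ 0)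
    (h1 : theta u p = 0) (h2 : theta v p = 0) : theta (u * v) p = 0 := by
  obtain ⟨k, hk⟩ := (theta_eq_zero_iff hp hp0 hu).mp h1
  obtain ⟨l, hl⟩ := (theta_eq_zero_iff hp hp0 hv).mp h2
  exact (theta_eq_zero_iff hp hp0 (mul_ne_zero hu hv)).mpr
    ⟨k + l, by rw [zpow_add₀ hp0, hk, hl]⟩

theorem theta_inv_eq_zero {p u : ℂ} (hp : ‖p‖ < 1) (hu : u ≠ 0)
    (h1 : theta u p = 0) : theta u⁻¹ p = 0 := by
  rw [theta_inv hp hu, h1, mul_zero]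

theorem theta_div_eq_zero {p u v : ℂ} (hp : ‖p‖ < 1) (hp0 : p ≠ 0) (hu : u ≠ 0) (hv : v ≠ 0)
    (h1 : theta u p = 0) (h2 : theta v p = 0) : theta (u / v) p = 0 := by
  rw [div_eq_mul_inv]
  exact theta_mul_eq_zero hp hp0 hu (inv_ne_zero hv) h1 (theta_inv_eq_zero hp hv h2)

/-- Vanishing of θ(w y^{±1}; p) means that w equals y or y⁻¹ modulo powers of p. If this holds for
both y and z, then y equals z or z⁻¹ modulo powers of p. -/
theorem pairTheta_eq_zero_of_common {p w y z : ℂ} (hp : ‖p‖ < 1) (hp0 : p ≠ 0) (hw : w ≠ 0)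
    (hy : y ≠ 0) (hz : z ≠ 0) (h1 : pairTheta w y p = 0) (h2 : pairTheta w z p = 0) :
    pairTheta y z p = 0 := by
  have a1 := mul_ne_zero hw hy
  have a2 := div_ne_zero hw hy
  have a3 := mul_ne_zero hw hz
  have a4 := div_ne_zero hw hz
  rw [pairTheta, mul_eq_zero]
  rcases mul_eq_zero.mp h1 with h1 | h1 <;> rcases mul_eq_zero.mp h2 with h2 | h2
  · right; convert theta_div_eq_zero hp hp0 a1 a3 h1 h2 using 2; field_simp
  · left; convert theta_div_eq_zero hp hp0 a1 a4 h1 h2 using 2; field_simp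
  · left; convert theta_div_eq_zero hp hp0 a3 a2 h2 h1 using 2; field_simp
  · right; convert theta_div_eq_zero hp hp0 a4 a2 h2 h1 using 2; field_simp

theorem theta_sq_eq_zero_of_common {p w y : ℂ} (hp : ‖p‖ < 1) (hp0 : p ≠ 0) (hw : w ≠ 0)
    (hy : y ≠ 0) (h1 : theta (w ^ 2) p = 0) (h2 : pairTheta w y p = 0) :
    theta (y ^ 2) p = 0 := by
  have a0 := pow_ne_zero 2 hw
  have a1 := mul_ne_zero hw hy
  have a2 := div_ne_zero hw hy
  rcases mul_eq_zero.mp h2 with h2 | h2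
  · convert theta_div_eq_zero hp hp0 (mul_ne_zero a1 a1) a0 (theta_mul_eq_zero hp hp0 a1 a1 h2 h2) h1
      using 2
    field_simp
  · convert theta_div_eq_zero hp hp0 a0 (mul_ne_zero a2 a2) h1 (theta_mul_eq_zero hp hp0 a2 a2 h2 h2)
      using 2
    field_simp

/-! ### Functions with simple zeros on `ℂ \ {0}` -/

/-- All zeros of `f` on `ℂ \ {0}` are simple. -/
def SimpleZeros (f : ℂ → ℂ) : Prop := ∀ w ≠ 0, f w = 0 → deriv f w ≠ 0

theorem SimpleZeros.mul {f g : ℂ → ℂ} (hf : SimpleZeros f) (hg : SimpleZeros g)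
    (df : ∀ w ≠ 0, DifferentiableAt ℂ f w) (dg : ∀ w ≠ 0, DifferentiableAt ℂ g w)
    (hfg : ∀ w ≠ 0, f w = 0 → g w ≠ 0) : SimpleZeros fun w => f w * g w := by
  intro w hw h0
  rw [((df w hw).hasDerivAt.fun_mul (dg w hw).hasDerivAt).deriv]
  rcases mul_eq_zero.mp h0 with h | h
  · rw [h, zero_mul, add_zero]
    exact mul_ne_zero (hf w hw h) (hfg w hw h)
  · rw [h, mul_zero, zero_add]
    exact mul_ne_zero (fun h' => hfg w hw h' h) (hg w hw h)

theorem SimpleZeros.of_ne_zero {f : ℂ → ℂ} (hf : ∀ w ≠ 0, f w ≠ 0) : SimpleZeros f :=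
  fun w hw h => absurd h (hf w hw)

theorem simpleZeros_theta_comp {p : ℂ} (hp : ‖p‖ < 1) (hp0 : p ≠ 0) {f f' : ℂ → ℂ}
    (hf : ∀ w ≠ 0, HasDerivAt f (f' w) w) (hf0 : ∀ w ≠ 0, f w ≠ 0) (hf' : ∀ w ≠ 0, f' w ≠ 0) :
    SimpleZeros fun w => theta (f w) p := by
  intro w hw h0
  have := HasDerivAt.comp (h₂ := fun x => theta x p) w
    (differentiableAt_theta hp (hf0 w hw)).hasDerivAt (hf w hw)
  rw [show (fun w => theta (f w) p) = (fun x => theta x p) ∘ f from rfl, this.deriv]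
  exact mul_ne_zero (deriv_theta_ne_zero hp hp0 (hf0 w hw) h0) (hf' w hw)

theorem simpleZeros_theta_sq {p : ℂ} (hp : ‖p‖ < 1) (hp0 : p ≠ 0) :
    SimpleZeros fun w => theta (w ^ 2) p :=
  simpleZeros_theta_comp hp hp0 (f := fun w => w ^ 2) (f' := fun w => 2 * w)
    (fun w _ => by simpa using hasDerivAt_pow 2 w) (fun w hw => pow_ne_zero 2 hw)
    (fun w hw => mul_ne_zero two_ne_zero hw)

theorem simpleZeros_pairTheta {p y : ℂ} (hp : ‖p‖ < 1) (hp0 : p ≠ 0) (hy : y ≠ 0)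
    (hy2 : theta (y ^ 2) p ≠ 0) : SimpleZeros fun w => pairTheta w y p := by
  refine SimpleZeros.mul
    (simpleZeros_theta_comp hp hp0 (f := fun w => w * y) (f' := fun _ => y)
      (fun w _ => by simpa using (hasDerivAt_id w).mul_const y) (fun w hw => mul_ne_zero hw hy)
      (fun w hw => hy))
    (simpleZeros_theta_comp hp hp0 (f := fun w => w / y) (f' := fun _ => 1 / y)
      (fun w _ => by simpa using (hasDerivAt_id w).div_const y) (fun w hw => div_ne_zero hw hy)
      (fun w hw => one_div_ne_zero hy))
    (fun w hw => ?_) (fun w hw => ?_) ?_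
  · exact DifferentiableAt.comp (f := fun w => w * y) (g := fun x => theta x p) w
      (differentiableAt_theta hp (mul_ne_zero hw hy)) (by fun_prop)
  · exact DifferentiableAt.comp (f := fun w => w / y) (g := fun x => theta x p) w
      (differentiableAt_theta hp (div_ne_zero hw hy)) (by fun_prop)
  · intro w hw h1 h2
    apply hy2
    convert theta_div_eq_zero hp hp0 (mul_ne_zero hw hy) (div_ne_zero hw hy) h1 h2 using 2
    field_simp

/-! ### The denominator -/

/-- `θ(w²; p) ∏_{y ∈ Y} θ(w y^{±1}; p)`. -/
def denom (p : ℂ) (Y : Finset ℂ) (w : ℂ) : ℂ := theta (w ^ 2) p * ∏ y ∈ Y, pairTheta w y p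

/-- The set `Z` avoids all poles: `θ(z²; p) ≠ 0` and `θ(z y^{±1}; p) ≠ 0` for `z ≠ y` in `Z`. -/
structure Generic (p : ℂ) (Z : Finset ℂ) : Prop where
  ne_zero : ∀ z ∈ Z, z ≠ 0
  sq : ∀ z ∈ Z, theta (z ^ 2) p ≠ 0
  pair : ∀ z ∈ Z, ∀ y ∈ Z, z ≠ y → pairTheta z y p ≠ 0

theorem Generic.mono {p : ℂ} {Y Z : Finset ℂ} (h : Generic p Z) (hYZ : Y ⊆ Z) : Generic p Y :=
  ⟨fun z hz => h.1 z (hYZ hz), fun z hz => h.2 z (hYZ hz),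
    fun z hz y hy => h.3 z (hYZ hz) y (hYZ hy)⟩

theorem Generic.denom_ne_zero {p : ℂ} {Y : Finset ℂ} {w : ℂ} (hw : w ∉ Y)
    (h : Generic p (insert w Y)) : denom p Y w ≠ 0 :=
  mul_ne_zero (h.sq w (Finset.mem_insert_self _ _)) (Finset.prod_ne_zero_iff.mpr fun y hy =>
    h.pair w (Finset.mem_insert_self _ _) y (Finset.mem_insert_of_mem hy)
      (fun e => hw (e ▸ hy)))

theorem denom_insert {p : ℂ} {Y : Finset ℂ} {v : ℂ} (hv : v ∉ Y) (w : ℂ) :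
    denom p (insert v Y) w = denom p Y w * pairTheta w v p := by
  rw [denom, denom, Finset.prod_insert hv]
  ring

theorem denom_eq_zero_of_mem {p : ℂ} (hp : ‖p‖ < 1) {Y : Finset ℂ} {v : ℂ} (hv0 : v ≠ 0)
    (hv : v ∈ Y) : denom p Y v = 0 := by
  rw [denom, Finset.prod_eq_zero hv (f := fun y => pairTheta v y p) (pairTheta_self hp hv0), mul_zero]

theorem differentiableAt_denom {p : ℂ} (hp : ‖p‖ < 1) {Y : Finset ℂ} (hY : ∀ y ∈ Y, y ≠ 0) {w : ℂ}
    (hw : w ≠ 0) : DifferentiableAt ℂ (denom p Y) w := by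
  refine DifferentiableAt.mul (DifferentiableAt.comp (f := fun w => w ^ 2)
    (g := fun x => theta x p) w (differentiableAt_theta hp (pow_ne_zero 2 hw)) (by fun_prop)) ?_
  exact DifferentiableAt.fun_finsetProd fun y hy =>
    differentiableAt_pairTheta_left hp hw (hY y hy)

theorem theta_sq_mul_base {p w : ℂ} (hp : ‖p‖ < 1) (hp0 : p ≠ 0) (hw : w ≠ 0) :
    theta ((p * w) ^ 2) p = p⁻¹ * (w ^ 4)⁻¹ * theta (w ^ 2) p := by
  rw [show (p * w) ^ 2 = p * (p * w ^ 2) by ring,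
    theta_mul_base hp hp0 (by positivity), theta_mul_base hp hp0 (by positivity)]
  generalize theta (w ^ 2) p = A
  field_simp

theorem denom_mul_base {p : ℂ} (hp : ‖p‖ < 1) (hp0 : p ≠ 0) {Y : Finset ℂ} (hY : ∀ y ∈ Y, y ≠ 0)
    {w : ℂ} (hw : w ≠ 0) :
    denom p Y (p * w) = p⁻¹ * (w ^ (2 * Y.card + 4))⁻¹ * denom p Y w := by
  rw [denom, theta_sq_mul_base hp hp0 hw,
    Finset.prod_congr rfl fun y hy => pairTheta_mul_base_left hp hp0 hw (hY y hy),
    Finset.prod_mul_distrib, Finset.prod_const, denom, pow_add, pow_mul, inv_pow, mul_inv]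
  ring

theorem denom_inv {p : ℂ} (hp : ‖p‖ < 1) {Y : Finset ℂ} (hY : ∀ y ∈ Y, y ≠ 0)
    {w : ℂ} (hw : w ≠ 0) :
    denom p Y w⁻¹ = -(w ^ (2 * Y.card + 2))⁻¹ * denom p Y w := by
  rw [denom, inv_pow, theta_inv hp (pow_ne_zero 2 hw),
    Finset.prod_congr rfl fun y hy => pairTheta_inv_left hp hw (hY y hy),
    Finset.prod_mul_distrib, Finset.prod_const, denom, pow_add, pow_mul, inv_pow, mul_inv]
  ring

/-- Each factor has simple zeros, and genericity keeps the zeros of different factors apart: a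
common zero would force θ(y²) = 0 or θ(y z^{±1}) = 0 for points y ≠ z of Y. -/
theorem simpleZeros_denom {p : ℂ} (hp : ‖p‖ < 1) (hp0 : p ≠ 0) {Y : Finset ℂ}
    (hY : Generic p Y) : SimpleZeros (denom p Y) := by
  induction Y using Finset.induction_on with
  | empty =>
    rw [show denom p ∅ = fun w => theta (w ^ 2) p from funext fun w => by simp [denom]]
    exact simpleZeros_theta_sq hp hp0
  | insert y Y hy ih =>
    have hY' := hY.mono (Finset.subset_insert y Y)
    have hmem := Finset.mem_insert_self y Y
    have hy0 := hY.ne_zero y hmem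
    rw [show denom p (insert y Y) = fun w => denom p Y w * pairTheta w y p from
      funext (denom_insert hy)]
    refine (ih hY').mul (simpleZeros_pairTheta hp hp0 hy0 (hY.sq y hmem))
      (fun w hw => differentiableAt_denom hp hY'.ne_zero hw)
      (fun w hw => differentiableAt_pairTheta_left hp hw hy0) fun w hw h1 h2 => ?_
    rcases mul_eq_zero.mp h1 with h1 | h1
    · exact hY.sq y hmem (theta_sq_eq_zero_of_common hp hp0 hw hy0 h1 h2)
    · obtain ⟨z, hz, h1⟩ := Finset.prod_eq_zero_iff.mp h1
      exact hY.pair y hmem z (Finset.mem_insert_of_mem hz) (fun e => hy (e ▸ hz))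
        (pairTheta_eq_zero_of_common hp hp0 hw hy0 (hY'.ne_zero z hz) h2 h1)

/-! ### Quasi-periodic functions -/

/-- Holomorphic functions on `ℂ \ {0}` with the same behaviour under `w ↦ p w` and `w ↦ w⁻¹`
as `θ(w²; p) ∏_{y} θ(w y^{±1}; p) · θ(c w^{±1}; p)`, where `y` runs over `d` values. -/
structure Quasi (p : ℂ) (d : ℕ) (N : ℂ → ℂ) : Prop where
  diff : ∀ w ≠ 0, DifferentiableAt ℂ N w
  mul_base : ∀ w ≠ 0, N (p * w) = p⁻¹ ^ 2 * (w ^ (2 * d + 6))⁻¹ * N w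
  inv : ∀ w ≠ 0, N w⁻¹ = -(w ^ (2 * d + 2))⁻¹ * N w

namespace Quasi

variable {p : ℂ} {d : ℕ} {N M : ℂ → ℂ}

theorem add (hN : Quasi p d N) (hM : Quasi p d M) : Quasi p d fun w => N w + M w :=
  ⟨fun w hw => (hN.diff w hw).add (hM.diff w hw),
    fun w hw => by rw [hN.mul_base w hw, hM.mul_base w hw]; ring,
    fun w hw => by rw [hN.inv w hw, hM.inv w hw]; ring⟩

theorem const_mul (hN : Quasi p d N) (c : ℂ) : Quasi p d fun w => c * N w :=
  ⟨fun w hw => (hN.diff w hw).const_mul c,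
    fun w hw => by rw [hN.mul_base w hw]; ring,
    fun w hw => by rw [hN.inv w hw]; ring⟩

theorem zero : Quasi p d fun _ => 0 :=
  ⟨fun _ _ => differentiableAt_const _, fun _ _ => by ring, fun _ _ => by ring⟩

theorem sum {ι : Type*} {s : Finset ι} {N : ι → ℂ → ℂ} (h : ∀ i ∈ s, Quasi p d (N i)) :
    Quasi p d fun w => ∑ i ∈ s, N i w := by
  classical
  induction s using Finset.induction_on with
  | empty => simpa using zero
  | insert i s hi ih =>
    simp only [Finset.sum_insert hi]
    exact (h i (Finset.mem_insert_self _ _)).add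
      (ih fun j hj => h j (Finset.mem_insert_of_mem hj))

theorem zpow_mul_eq_zero_iff (hN : Quasi p d N) (hp0 : p ≠ 0) (k : ℤ) {w : ℂ} (hw : w ≠ 0) :
    N (p ^ k * w) = 0 ↔ N w = 0 := by
  have key : ∀ w ≠ 0, N (p * w) = 0 ↔ N w = 0 := fun w hw => by
    rw [hN.mul_base w hw]; simp [hp0, hw]
  induction k using Int.induction_on with
  | zero => simp
  | succ i ih => rw [zpow_add_one₀ hp0, mul_comm _ p, mul_assoc]; exact (key _ (by positivity)).trans ih
  | pred i ih =>
    refine (key _ (by positivity)).symm.trans (Iff.trans ?_ ih)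
    rw [zpow_sub_one₀ hp0, show p * (p ^ (-(i : ℤ)) * p⁻¹ * w) = p ^ (-(i : ℤ)) * w by field_simp]

theorem inv_eq_zero (hN : Quasi p d N) {w : ℂ} (hw : w ≠ 0) (h : N w = 0) : N w⁻¹ = 0 := by
  rw [hN.inv w hw, h, mul_zero]

/-- The zeros of θ(w²; p) are, modulo powers of p, the fixed points of w ↦ w⁻¹ and of w ↦ p/w. At a
fixed point the functional equations read N = -N. -/
theorem eq_zero_of_theta_sq (hN : Quasi p d N) (hp : ‖p‖ < 1) (hp0 : p ≠ 0) {w : ℂ} (hw : w ≠ 0)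
    (h : theta (w ^ 2) p = 0) : N w = 0 := by
  obtain ⟨k, hk⟩ := (theta_eq_zero_iff hp hp0 (pow_ne_zero 2 hw)).mp h
  -- Here k / 2 is rounded down: the shifted point u satisfies u² = 1 or u² = p according to the
  -- parity of k.
  rw [← hN.zpow_mul_eq_zero_iff hp0 (-(k / 2)) hw]
  have hu : p ^ (-(k / 2)) * w ≠ 0 := by positivity
  have hu2 : (p ^ (-(k / 2)) * w) ^ 2 = p ^ (k % 2) := by
    rw [mul_pow, hk, ← zpow_natCast, ← zpow_mul, ← zpow_add₀ hp0]
    congr 1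
    push_cast
    omega
  generalize p ^ (-(k / 2)) * w = u at hu hu2
  have hinv := hN.inv u hu
  rcases Int.emod_two_eq_zero_or_one k with hr | hr
  · rw [hr, zpow_zero] at hu2
    have h1 : u⁻¹ = u := inv_eq_of_mul_eq_one_left (by rw [← sq, hu2])
    rw [h1, show 2 * d + 2 = 2 * (d + 1) by ring, pow_mul, hu2, one_pow] at hinv
    linear_combination (1 / 2 : ℂ) * hinv
  · rw [hr, zpow_one] at hu2
    have h1 : u = p * u⁻¹ := by rw [← hu2]; field_simp
    have h2 := hN.mul_base u⁻¹ (inv_ne_zero hu)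
    rw [← h1, hinv] at h2
    have h3 : p⁻¹ ^ 2 * (u⁻¹ ^ (2 * d + 6))⁻¹ * (-(u ^ (2 * d + 2))⁻¹ * N u) = -N u := by
      rw [← hu2, inv_pow u, inv_inv]
      field_simp
      ring
    rw [h3] at h2
    linear_combination (1 / 2 : ℂ) * h2

theorem eq_zero_of_pairTheta (hN : Quasi p d N) (hp : ‖p‖ < 1) (hp0 : p ≠ 0) {w y : ℂ}
    (hw : w ≠ 0) (hy : y ≠ 0) (hNy : N y = 0) (h : pairTheta w y p = 0) : N w = 0 := by
  rcases mul_eq_zero.mp h with h | h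
  · obtain ⟨k, hk⟩ := (theta_eq_zero_iff hp hp0 (mul_ne_zero hw hy)).mp h
    rw [show w = p ^ k * y⁻¹ by rw [← hk]; field_simp, hN.zpow_mul_eq_zero_iff hp0 _ (inv_ne_zero hy)]
    exact hN.inv_eq_zero hy hNy
  · obtain ⟨k, hk⟩ := (theta_eq_zero_iff hp hp0 (div_ne_zero hw hy)).mp h
    rw [show w = p ^ k * y by rw [← hk]; field_simp, hN.zpow_mul_eq_zero_iff hp0 _ hy]
    exact hNy

/-- A function with too many zeros vanishes. -/
theorem eq_zero {Y : Finset ℂ} (hN : Quasi p Y.card N) (hp : ‖p‖ < 1) (hp0 : p ≠ 0)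
    {u v : ℂ} (huY : u ∉ Y) (hY : Generic p (insert u Y)) (hNY : ∀ y ∈ Y, N y = 0)
    (hNu : N u = 0) (hNv : N v = 0) (hv0 : v ≠ 0) (hv : denom p (insert u Y) v ≠ 0) :
    ∀ w ≠ 0, N w = 0 := by
  have hu0 := hY.ne_zero u (Finset.mem_insert_self _ _)
  have hY0 : ∀ y ∈ Y, y ≠ 0 := fun y hy => hY.ne_zero y (Finset.mem_insert_of_mem hy)
  have hvan : ∀ w ≠ 0, denom p (insert u Y) w = 0 → N w = 0 := by
    intro w hw h
    rcases mul_eq_zero.mp h with h | h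
    · exact hN.eq_zero_of_theta_sq hp hp0 hw h
    · obtain ⟨y, hy, h⟩ := Finset.prod_eq_zero_iff.mp h
      refine hN.eq_zero_of_pairTheta hp hp0 hw (hY.ne_zero y hy) ?_ h
      rcases Finset.mem_insert.mp hy with rfl | hy
      · exact hNu
      · exact hNY y hy
  have hdd : ∀ w ≠ 0, DifferentiableAt ℂ (denom p (insert u Y)) w := fun w hw =>
    differentiableAt_denom hp hY.ne_zero hw
  -- The denominator attached to Y ∪ {u} has the multiplier of N up to one factor p⁻¹, which w⁻¹
  -- supplies. N vanishes at all its zeros, so N is a constant multiple of it, and the extra zero v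
  -- kills the constant.
  obtain ⟨C, hC⟩ := exists_eq_const_mul_of_simple_zeros hp hp0 (N := N)
    (D := fun w => w⁻¹ * denom p (insert u Y) w)
    (μ := fun w => p⁻¹ ^ 2 * (w ^ (2 * Y.card + 6))⁻¹) hN.diff
    (fun w hw => (differentiableAt_inv hw).mul (hdd w hw)) (fun w hw => by positivity)
    hN.mul_base (fun w hw => by
      rw [denom_mul_base hp hp0 hY.ne_zero hw, Finset.card_insert_of_notMem huY]
      ring)
    (SimpleZeros.mul (SimpleZeros.of_ne_zero fun w hw => inv_ne_zero hw)
      (simpleZeros_denom hp hp0 hY) (fun w hw => differentiableAt_inv hw) hdd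
      fun w hw h => absurd h (inv_ne_zero hw))
    (fun w hw h => hvan w hw ((mul_eq_zero.mp h).resolve_left (inv_ne_zero hw)))
  have hC0 : C = 0 := by
    have := hC v hv0
    rw [hNv] at this
    exact (mul_eq_zero.mp this.symm).resolve_right (mul_ne_zero (inv_ne_zero hv0) hv)
  intro w hw
  rw [hC w hw, hC0, zero_mul]

end Quasi

theorem quasi_denom_mul {p : ℂ} (hp : ‖p‖ < 1) (hp0 : p ≠ 0) {Y : Finset ℂ}
    (hY : ∀ y ∈ Y, y ≠ 0) {c : ℂ} (hc : c ≠ 0) :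
    Quasi p Y.card fun w => denom p Y w * pairTheta c w p where
  diff w hw := (differentiableAt_denom hp hY hw).mul (differentiableAt_pairTheta_right hp hc hw)
  mul_base w hw := by
    rw [denom_mul_base hp hp0 hY hw, pairTheta_mul_base_right hp hp0 hc hw]
    ring
  inv w hw := by
    rw [denom_inv hp hY hw, pairTheta_inv_right]
    ring

/-! ### The functions that integrate to zero -/

/-- The numerator of `fPlus`. -/
def fNum (p t : ℂ) (b : Fin 6 → ℂ) (Y : Finset ℂ) (w : ℂ) : ℂ :=
  w⁻¹ * (∏ m, theta (b m * w) p) * ∏ y ∈ Y, pairTheta (t * w) y p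

/-- The coefficient `w⁻¹ ∏_m θ(b_m w) / θ(w²) · ∏_y θ(t w y^{±1}) / θ(w y^{±1})`. -/
def fPlus (p t : ℂ) (b : Fin 6 → ℂ) (Y : Finset ℂ) (w : ℂ) : ℂ :=
  fNum p t b Y w / denom p Y w

/-- The symmetrized function
`∑_w (f(w) + f(w⁻¹)) ∏_{v ≠ w} θ(c v^{±1}; p)` of the finite set `Z`. -/
def stokes (p t : ℂ) (b : Fin 6 → ℂ) (c : ℂ) (Z : Finset ℂ) : ℂ :=
  ∑ w ∈ Z, (fPlus p t b (Z.erase w) w + fPlus p t b (Z.erase w) w⁻¹) *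
    ∏ v ∈ Z.erase w, pairTheta c v p

section

variable {p t : ℂ} {b : Fin 6 → ℂ}

theorem differentiableAt_fNum (hp : ‖p‖ < 1) (ht : t ≠ 0) (hb : ∀ m, b m ≠ 0) {Y : Finset ℂ}
    (hY : ∀ y ∈ Y, y ≠ 0) {w : ℂ} (hw : w ≠ 0) : DifferentiableAt ℂ (fNum p t b Y) w := by
  refine ((differentiableAt_inv hw).mul (DifferentiableAt.fun_finsetProd fun m _ => ?_)).mul
    (DifferentiableAt.fun_finsetProd fun y hy => ?_)
  · exact DifferentiableAt.comp (f := fun w => b m * w) (g := fun x => theta x p) w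
      (differentiableAt_theta hp (mul_ne_zero (hb m) hw)) (by fun_prop)
  · exact DifferentiableAt.comp (f := fun w => t * w) (g := fun x => pairTheta x y p) w
      (differentiableAt_pairTheta_left hp (mul_ne_zero ht hw) (hY y hy)) (by fun_prop)

/-- The only use of the balancing condition in the algebra: the shifts of the theta factors produce
(∏ b_m · t^{2d})⁻¹ = p⁻¹ with d = |Y|, and w⁻¹ produces the other p⁻¹. -/
theorem fNum_mul_base (hp : ‖p‖ < 1) (hp0 : p ≠ 0) (ht : t ≠ 0) (hb : ∀ m, b m ≠ 0)
    {Y : Finset ℂ} (hY : ∀ y ∈ Y, y ≠ 0) (hbal : (∏ m, b m) * t ^ (2 * Y.card) = p) {w : ℂ}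
    (hw : w ≠ 0) :
    fNum p t b Y (p * w) = p⁻¹ ^ 2 * (w ^ (2 * Y.card + 6))⁻¹ * fNum p t b Y w := by
  have h1 : ∀ m, theta (b m * (p * w)) p = (-1 * (b m)⁻¹ * w⁻¹) * theta (b m * w) p := fun m => by
    rw [show b m * (p * w) = p * (b m * w) by ring,
      theta_mul_base hp hp0 (mul_ne_zero (hb m) hw), mul_inv]
    ring
  have h2 : ∀ y ∈ Y, pairTheta (t * (p * w)) y p = ((t ^ 2)⁻¹ * (w ^ 2)⁻¹) * pairTheta (t * w) y p :=
    fun y hy => by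
      rw [show t * (p * w) = p * (t * w) by ring,
        pairTheta_mul_base_left hp hp0 (mul_ne_zero ht hw) (hY y hy), mul_pow, mul_inv]
  rw [fNum, Finset.prod_congr rfl fun m _ => h1 m, Finset.prod_congr rfl h2,
    Finset.prod_mul_distrib, Finset.prod_mul_distrib, Finset.prod_mul_distrib,
    Finset.prod_mul_distrib, Finset.prod_inv_distrib, Finset.prod_const, Finset.prod_const,
    Finset.prod_const, Finset.card_univ, Fintype.card_fin, fNum, mul_pow, inv_pow (t ^ 2),
    inv_pow (w ^ 2), ← pow_mul, ← pow_mul, pow_add, mul_inv p w]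
  have hX : (∏ m, b m)⁻¹ * (t ^ (2 * Y.card))⁻¹ = p⁻¹ := by rw [← mul_inv, hbal]
  generalize ∏ m, theta (b m * w) p = A
  generalize ∏ y ∈ Y, pairTheta (t * w) y p = B
  rw [mul_inv, inv_pow w 6]
  linear_combination p⁻¹ * w⁻¹ * (w ^ 6)⁻¹ * (w ^ (2 * Y.card))⁻¹ * A * B * hX

/-- This is the numerator of f(w) + f(w⁻¹) over the denominator at w; the power of w and the sign
come from `denom_inv`. -/
theorem quasi_fNum (hp : ‖p‖ < 1) (hp0 : p ≠ 0) (ht : t ≠ 0) (hb : ∀ m, b m ≠ 0)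
    {Y : Finset ℂ} (hY : ∀ y ∈ Y, y ≠ 0) (hbal : (∏ m, b m) * t ^ (2 * Y.card) = p) :
    Quasi p Y.card fun w => fNum p t b Y w - w ^ (2 * Y.card + 2) * fNum p t b Y w⁻¹ where
  diff w hw := (differentiableAt_fNum hp ht hb hY hw).sub ((by fun_prop : DifferentiableAt ℂ
    (fun w : ℂ => w ^ (2 * Y.card + 2)) w).mul
    (DifferentiableAt.comp (f := fun w => w⁻¹) (g := fNum p t b Y) w
      (differentiableAt_fNum hp ht hb hY (inv_ne_zero hw)) (differentiableAt_inv hw)))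
  mul_base w hw := by
    have h := fNum_mul_base hp hp0 ht hb hY hbal (inv_ne_zero (mul_ne_zero hp0 hw))
    rw [show p * (p * w)⁻¹ = w⁻¹ by field_simp] at h
    rw [fNum_mul_base hp hp0 ht hb hY hbal hw, h]
    generalize fNum p t b Y w = A
    generalize fNum p t b Y (p * w)⁻¹ = B
    rw [inv_pow (p * w), inv_inv, mul_pow, mul_pow]
    field_simp
    ring
  inv w hw := by
    rw [inv_inv]
    generalize fNum p t b Y w = A
    generalize fNum p t b Y w⁻¹ = B
    rw [inv_pow w]
    field_simp
    ring

end

/-- The product of `denom p Y w` and `stokes p t b c (insert w Y)`, with all poles in `w`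
cancelled. -/
def stokesNum (p t : ℂ) (b : Fin 6 → ℂ) (c : ℂ) (Y : Finset ℂ) (w : ℂ) : ℂ :=
  (∏ y ∈ Y, pairTheta c y p) * (fNum p t b Y w - w ^ (2 * Y.card + 2) * fNum p t b Y w⁻¹) +
  ∑ v ∈ Y, (∏ y ∈ Y.erase v, pairTheta c y p) *
    (fPlus p t b (Y.erase v) v *
        (denom p (Y.erase v) w * pairTheta c w p * (-(w / v) * pairTheta (t * v) w p)) +
      fPlus p t b (Y.erase v) v⁻¹ *
        (denom p (Y.erase v) w * pairTheta c w p * (-(w / v⁻¹) * pairTheta (t * v⁻¹) w p)))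

section

variable {p t : ℂ} {b : Fin 6 → ℂ} {c : ℂ}

theorem Quasi.mul_pairTheta (hp : ‖p‖ < 1) (hp0 : p ≠ 0) (ht : t ≠ 0) {d : ℕ} {N : ℂ → ℂ}
    (hN : Quasi p d N) {u : ℂ} (hu : u ≠ 0) :
    Quasi p (d + 1) fun w => N w * (-(w / u) * pairTheta (t * u) w p) where
  diff w hw := (hN.diff w hw).mul ((by fun_prop : DifferentiableAt ℂ
    (fun w : ℂ => -(w / u)) w).mul (differentiableAt_pairTheta_right hp (mul_ne_zero ht hu) hw))
  mul_base w hw := by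
    rw [hN.mul_base w hw, pairTheta_mul_base_right hp hp0 (mul_ne_zero ht hu) hw,
      show 2 * (d + 1) + 6 = (2 * d + 6) + 2 by ring, pow_add w (2 * d + 6)]
    generalize N w = A
    generalize pairTheta (t * u) w p = B
    field_simp
  inv w hw := by
    rw [hN.inv w hw, pairTheta_inv_right, show 2 * (d + 1) + 2 = (2 * d + 2) + 2 by ring,
      pow_add w (2 * d + 2)]
    generalize N w = A
    generalize pairTheta (t * u) w p = B
    field_simp

theorem quasi_stokesNum (hp : ‖p‖ < 1) (hp0 : p ≠ 0) (ht : t ≠ 0) (hb : ∀ m, b m ≠ 0)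
    (hc : c ≠ 0) {Y : Finset ℂ} (hY : ∀ y ∈ Y, y ≠ 0)
    (hbal : (∏ m, b m) * t ^ (2 * Y.card) = p) :
    Quasi p Y.card (stokesNum p t b c Y) := by
  refine ((quasi_fNum hp hp0 ht hb hY hbal).const_mul _).add (Quasi.sum fun v hv => ?_)
  have hv0 := hY v hv
  have hY' : ∀ y ∈ Y.erase v, y ≠ 0 := fun y hy => hY y (Finset.mem_of_mem_erase hy)
  have hq := quasi_denom_mul hp hp0 hY' hc
  refine Quasi.const_mul ?_ _
  rw [← Finset.card_erase_add_one hv]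
  exact ((hq.mul_pairTheta hp hp0 ht hv0).const_mul _).add
    ((hq.mul_pairTheta hp hp0 ht (inv_ne_zero hv0)).const_mul _)

theorem fNum_insert {Y : Finset ℂ} {v : ℂ} (hv : v ∉ Y) (w : ℂ) :
    fNum p t b (insert v Y) w = fNum p t b Y w * pairTheta (t * w) v p := by
  rw [fNum, fNum, Finset.prod_insert hv]
  ring

/-- The symmetrized sum has no pole where two of its points collide: the residues of the terms
belonging to w and to v cancel as w → v. -/
theorem stokesNum_eq_zero (hp : ‖p‖ < 1) {Y : Finset ℂ} (hY : Generic p Y) {v : ℂ} (hv : v ∈ Y) :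
    stokesNum p t b c Y v = 0 := by
  have hv0 := hY.ne_zero v hv
  rw [stokesNum, Finset.sum_eq_single_of_mem v hv]
  · obtain ⟨Y, hvY, rfl⟩ : ∃ Y', v ∉ Y' ∧ Y = insert v Y' :=
      ⟨Y.erase v, Finset.notMem_erase v Y, (Finset.insert_erase hv).symm⟩
    have hD := hY.denom_ne_zero hvY
    have hY0 : ∀ y ∈ Y, y ≠ 0 := fun y hy => hY.ne_zero y (Finset.mem_insert_of_mem hy)
    rw [Finset.erase_insert hvY, Finset.prod_insert hvY, fNum_insert hvY, fNum_insert hvY,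
      Finset.card_insert_of_notMem hvY, fPlus, fPlus, denom_inv hp hY0 hv0]
    generalize denom p Y v = D at *
    generalize fNum p t b Y v = A
    generalize fNum p t b Y v⁻¹ = B
    generalize pairTheta (t * v) v p = T
    generalize pairTheta (t * v⁻¹) v p = T'
    generalize pairTheta c v p = P
    generalize ∏ y ∈ Y, pairTheta c y p = Q
    field_simp
    ring
  -- A summand for u ≠ v keeps the factor θ(w v^{±1}) in its denominator product, so it vanishes at
  -- w = v.
  · intro u hu huv
    rw [denom_eq_zero_of_mem hp hv0 (Finset.mem_erase.mpr ⟨huv.symm, hv⟩)]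
    ring

/-- In the term of v ∈ Y the pole θ(v w^{±1}) is cancelled by the factor θ(w v^{±1}) = -(w/v) θ(v
w^{±1}) of the denominator at w. -/
theorem stokesNum_eq (hp : ‖p‖ < 1) {Y : Finset ℂ} {w : ℂ} (hw : w ∉ Y)
    (hY : Generic p (insert w Y)) :
    stokesNum p t b c Y w = denom p Y w * stokes p t b c (insert w Y) := by
  have hY0 : ∀ y ∈ Y, y ≠ 0 := fun y hy => hY.ne_zero y (Finset.mem_insert_of_mem hy)
  have hmem := Finset.mem_insert_self w Y
  have hw0 := hY.ne_zero w hmem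
  rw [stokesNum, stokes, Finset.sum_insert hw, Finset.erase_insert hw, mul_add, Finset.mul_sum]
  congr 1
  · have hD := hY.denom_ne_zero hw
    rw [fPlus, fPlus, denom_inv hp hY0 hw0]
    generalize denom p Y w = D at *
    generalize fNum p t b Y w = A
    generalize fNum p t b Y w⁻¹ = B
    generalize ∏ y ∈ Y, pairTheta c y p = Q
    field_simp
    ring
  · refine Finset.sum_congr rfl fun v hv => ?_
    have hvw : v ≠ w := fun h => hw (h ▸ hv)
    have hv0 := hY0 v hv
    have hwY : w ∉ Y.erase v := fun h => hw (Finset.mem_of_mem_erase h)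
    rw [Finset.erase_insert_of_ne hvw.symm, Finset.prod_insert hwY]
    have hD : denom p Y w = denom p (Y.erase v) w * pairTheta w v p := by
      rw [← denom_insert (Finset.notMem_erase v Y), Finset.insert_erase hv]
    rw [hD, fPlus, fPlus, fPlus, fPlus, fNum_insert hwY, fNum_insert hwY, denom_insert hwY,
      denom_insert hwY, pairTheta_inv_left hp hv0 hw0, pairTheta_swap hp hv0 hw0]
    have hR := hY.pair v (Finset.mem_insert_of_mem hv) w hmem hvw
    generalize denom p (Y.erase v) v = D1
    generalize denom p (Y.erase v) v⁻¹ = D2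
    generalize denom p (Y.erase v) w = D3
    generalize pairTheta v w p = R at *
    generalize fNum p t b (Y.erase v) v = A
    generalize fNum p t b (Y.erase v) v⁻¹ = B
    generalize pairTheta (t * v) w p = T
    generalize pairTheta (t * v⁻¹) w p = T'
    generalize pairTheta c w p = P
    generalize ∏ y ∈ Y.erase v, pairTheta c y p = Q
    rw [mul_comm D1, mul_comm D2, ← div_div, ← div_div]
    rw [div_eq_mul_inv _ D1, div_eq_mul_inv _ D2, div_eq_mul_inv _ D1, div_eq_mul_inv _ D2]
    generalize D1⁻¹ = E1
    generalize D2⁻¹ = E2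
    field_simp
    ring

end

/-! ### Interpolation on two geometric progressions -/

/-- The points `a, a t, …, a t^{s-1}`. -/
def geom (a t : ℂ) (s : ℕ) : Finset ℂ := (Finset.range s).image fun i => a * t ^ i

/-- The points `a, a t, …, a t^{s-1}, b, b t, …, b t^{r-1}`. -/
def grid (a b t : ℂ) (s r : ℕ) : Finset ℂ := geom a t s ∪ geom b t r

theorem mem_geom {a t : ℂ} {s : ℕ} {x : ℂ} : x ∈ geom a t s ↔ ∃ i < s, a * t ^ i = x := by
  simp [geom]

theorem geom_succ (a t : ℂ) (s : ℕ) : geom a t (s + 1) = insert (a * t ^ s) (geom a t s) := by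
  rw [geom, Finset.range_add_one, Finset.image_insert, geom]

theorem geom_mono {a t : ℂ} {s s' : ℕ} (h : s ≤ s') : geom a t s ⊆ geom a t s' :=
  Finset.image_subset_image (Finset.range_mono h)

theorem grid_mono {a b t : ℂ} {s s' r r' : ℕ} (h : s ≤ s') (h' : r ≤ r') :
    grid a b t s r ⊆ grid a b t s' r' := Finset.union_subset_union (geom_mono h) (geom_mono h')

theorem grid_succ_left (a b t : ℂ) (s r : ℕ) :
    grid a b t (s + 1) r = insert (a * t ^ s) (grid a b t s r) := by
  rw [grid, geom_succ, Finset.insert_union, grid]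

theorem grid_succ_right (a b t : ℂ) (s r : ℕ) :
    grid a b t s (r + 1) = insert (b * t ^ r) (grid a b t s r) := by
  rw [grid, geom_succ, Finset.union_insert, grid]

theorem grid_comm (a b t : ℂ) (s r : ℕ) : grid a b t s r = grid b a t r s := Finset.union_comm _ _

/-- The two progressions of length `n` are disjoint, without repetitions, and avoid all poles. -/
structure GridGeneric (p t a b : ℂ) (n : ℕ) : Prop where
  gen : Generic p (grid a b t n n)
  inj_left : ∀ i < n, ∀ j < n, a * t ^ i = a * t ^ j → i = j
  inj_right : ∀ i < n, ∀ j < n, b * t ^ i = b * t ^ j → i = j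
  ne : ∀ i < n, ∀ j < n, a * t ^ i ≠ b * t ^ j

namespace GridGeneric

variable {p t a b : ℂ} {n : ℕ} (h : GridGeneric p t a b n)

include h

theorem symm : GridGeneric p t b a n :=
  ⟨grid_comm a b t n n ▸ h.gen, h.inj_right, h.inj_left, fun i hi j hj e => h.ne j hj i hi e.symm⟩

theorem notMem_left {s r : ℕ} (hs : s < n) (hr : r ≤ n) : a * t ^ s ∉ grid a b t s r := by
  rw [grid, Finset.mem_union, mem_geom, mem_geom]
  rintro (⟨i, hi, e⟩ | ⟨i, hi, e⟩)
  · exact hi.ne (h.inj_left i (hi.trans hs) s hs e)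
  · exact h.ne s hs i (hi.trans_le hr) e.symm

theorem notMem_right {s r : ℕ} (hs : s ≤ n) (hr : r < n) : b * t ^ r ∉ grid a b t s r := by
  rw [grid_comm]
  exact h.symm.notMem_left hr hs

theorem prod_geom_left (f : ℂ → ℂ) {s : ℕ} (hs : s ≤ n) :
    ∏ y ∈ geom a t s, f y = ∏ i ∈ Finset.range s, f (a * t ^ i) := by
  rw [geom, Finset.prod_image]
  intro i hi j hj e
  simp only [Finset.coe_range, Set.mem_Iio] at hi hj
  exact h.inj_left i (by omega) j (by omega) e

theorem prod_grid (f : ℂ → ℂ) {s r : ℕ} (hs : s ≤ n) (hr : r ≤ n) :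
    ∏ y ∈ grid a b t s r, f y =
      (∏ i ∈ Finset.range s, f (a * t ^ i)) * ∏ i ∈ Finset.range r, f (b * t ^ i) := by
  rw [grid, Finset.prod_union, h.prod_geom_left f hs, h.symm.prod_geom_left f hr]
  rw [Finset.disjoint_left]
  intro x hx hx'
  obtain ⟨i, hi, rfl⟩ := mem_geom.mp hx
  obtain ⟨j, hj, e⟩ := mem_geom.mp hx'
  exact h.ne i (by omega) j (by omega) e.symm

theorem card_grid {s r : ℕ} (hs : s ≤ n) (hr : r ≤ n) : (grid a b t s r).card = s + r := by
  induction s with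
  | zero =>
    induction r with
    | zero => simp [grid, geom]
    | succ r ih =>
      rw [grid_succ_right, Finset.card_insert_of_notMem (h.notMem_right (Nat.zero_le _) hr),
        ih (by omega)]
      omega
  | succ s ih =>
    rw [grid_succ_left, Finset.card_insert_of_notMem (h.notMem_left hs hr), ih (by omega)]
    omega

end GridGeneric

/-- A combination of the functions `stokes` and of two products. -/
def combo {ι : Type*} [Fintype ι] (p t : ℂ) (β : Fin 6 → ℂ) (c e : ι → ℂ) (a b A B : ℂ)
    (Z : Finset ℂ) : ℂ :=
  ∑ j, e j * stokes p t β (c j) Z + (A * ∏ z ∈ Z, pairTheta a z p + B * ∏ z ∈ Z, pairTheta b z p)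

/-- A combination that vanishes on the points of the grid vanishes everywhere. -/
theorem combo_eq_zero {ι : Type*} [Fintype ι] {p t : ℂ} {β : Fin 6 → ℂ} (hp : ‖p‖ < 1)
    (hp0 : p ≠ 0) (ht : t ≠ 0) (hβ : ∀ m, β m ≠ 0) {n : ℕ}
    (hbal : (∏ m, β m) * t ^ (2 * n) = p) {c e : ι → ℂ} (hc : ∀ j, c j ≠ 0) {a b A B : ℂ}
    (ha : a ≠ 0) (hb : b ≠ 0) (hg : GridGeneric p t a b (n + 1))
    (hbase : ∀ s r, s + r = n + 1 → combo p t β c e a b A B (grid a b t s r) = 0)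
    (m : ℕ) : ∀ (U : Finset ℂ) (s r : ℕ), U.card = m → m + s + r = n + 1 →
      Generic p (U ∪ grid a b t (n + 1) (n + 1)) → Disjoint U (grid a b t (n + 1) (n + 1)) →
      combo p t β c e a b A B (U ∪ grid a b t s r) = 0 := by
  -- Induction on the number of points off the grid. One such point w is treated as a variable;
  -- replacing it by the next point of either progression gives a case with fewer points off the
  -- grid.
  induction m with
  | zero =>
    intro U s r hU hsr _ _
    rw [Finset.card_eq_zero.mp hU, Finset.empty_union]
    exact hbase s r (by omega)
  | succ m ih =>
    intro U s r hU hsr hgen hdisj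
    obtain ⟨w, U, hwU, rfl, hUm⟩ := Finset.card_eq_succ.mp hU
    rw [Finset.disjoint_insert_left] at hdisj
    have hsub : U ∪ grid a b t (n + 1) (n + 1) ⊆ insert w U ∪ grid a b t (n + 1) (n + 1) :=
      Finset.union_subset_union_left (Finset.subset_insert _ _)
    have hgen' := hgen.mono hsub
    set Y := U ∪ grid a b t s r with hYdef
    have hgridsub : grid a b t s r ⊆ grid a b t (n + 1) (n + 1) :=
      grid_mono (by omega) (by omega)
    have hYsub : Y ⊆ U ∪ grid a b t (n + 1) (n + 1) := Finset.union_subset_union_right hgridsub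
    have hwY : w ∉ Y := by
      rw [hYdef, Finset.mem_union, not_or]
      exact ⟨hwU, fun h => hdisj.1 (hgridsub h)⟩
    have hu_mem : a * t ^ s ∈ grid a b t (n + 1) (n + 1) :=
      Finset.mem_union_left _ (mem_geom.mpr ⟨s, by omega, rfl⟩)
    have hv_mem : b * t ^ r ∈ grid a b t (n + 1) (n + 1) :=
      Finset.mem_union_right _ (mem_geom.mpr ⟨r, by omega, rfl⟩)
    have huY : a * t ^ s ∉ Y := by
      rw [hYdef, Finset.mem_union, not_or]
      exact ⟨fun h => Finset.disjoint_left.mp hdisj.2 h hu_mem,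
        hg.notMem_left (by omega) (by omega)⟩
    have hvY : b * t ^ r ∉ Y := by
      rw [hYdef, Finset.mem_union, not_or]
      exact ⟨fun h => Finset.disjoint_left.mp hdisj.2 h hv_mem,
        hg.notMem_right (by omega) (by omega)⟩
    have hvu : b * t ^ r ∉ insert (a * t ^ s) Y := by
      rw [Finset.mem_insert, not_or]
      exact ⟨fun h => hg.ne s (by omega) r (by omega) h.symm, hvY⟩
    have hcard : Y.card = n := by
      rw [hYdef, Finset.card_union_of_disjoint (hdisj.2.mono_right hgridsub), hUm,
        hg.card_grid (by omega) (by omega)]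
      omega
    have hY0 : ∀ y ∈ Y, y ≠ 0 := fun y hy => hgen'.ne_zero y (hYsub hy)
    have hYgen : Generic p Y := hgen'.mono hYsub
    -- The combination at {x} ∪ Y, as a function of x with its poles cleared. It vanishes at the n
    -- points of Y, and at at^s and bt^r by the induction hypothesis, which is enough for
    -- `Quasi.eq_zero`.
    let N : ℂ → ℂ := fun x => ∑ j, e j * stokesNum p t β (c j) Y x +
      ((A * ∏ z ∈ Y, pairTheta a z p) * (denom p Y x * pairTheta a x p) +
        (B * ∏ z ∈ Y, pairTheta b z p) * (denom p Y x * pairTheta b x p))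
    have hN : Quasi p Y.card N :=
      (Quasi.sum fun j _ => (quasi_stokesNum hp hp0 ht hβ (hc j) hY0
        (by rw [hcard]; exact hbal)).const_mul _).add
      (((quasi_denom_mul hp hp0 hY0 ha).const_mul _).add
        ((quasi_denom_mul hp hp0 hY0 hb).const_mul _))
    have hNY : ∀ y ∈ Y, N y = 0 := fun y hy => by
      simp only [N]
      rw [denom_eq_zero_of_mem hp (hY0 y hy) hy,
        Finset.sum_eq_zero fun j _ => by rw [stokesNum_eq_zero hp hYgen hy, mul_zero]]
      ring
    have hNx : ∀ x ∉ Y, Generic p (insert x Y) →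
        N x = denom p Y x * combo p t β c e a b A B (insert x Y) := fun x hx hgx => by
      simp only [N, combo]
      rw [Finset.sum_congr rfl fun j _ => by rw [stokesNum_eq hp hx hgx], Finset.prod_insert hx,
        Finset.prod_insert hx, mul_add, Finset.mul_sum]
      congr 1
      · exact Finset.sum_congr rfl fun j _ => by ring
      · ring
    have hgu : Generic p (insert (a * t ^ s) Y) := hgen'.mono
      (Finset.insert_subset (Finset.mem_union_right _ hu_mem) hYsub)
    have hgv : Generic p (insert (b * t ^ r) Y) := hgen'.mono
      (Finset.insert_subset (Finset.mem_union_right _ hv_mem) hYsub)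
    have hgvu : Generic p (insert (b * t ^ r) (insert (a * t ^ s) Y)) := hgen'.mono
      (Finset.insert_subset (Finset.mem_union_right _ hv_mem)
        (Finset.insert_subset (Finset.mem_union_right _ hu_mem) hYsub))
    have hgw : Generic p (insert w Y) := hgen.mono (Finset.insert_subset
      (Finset.mem_union_left _ (Finset.mem_insert_self _ _)) (hYsub.trans hsub))
    have hNu : N (a * t ^ s) = 0 := by
      rw [hNx _ huY hgu, hYdef, ← Finset.union_insert, ← grid_succ_left,
        ih U (s + 1) r hUm (by omega) hgen' hdisj.2, mul_zero]
    have hNv : N (b * t ^ r) = 0 := by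
      rw [hNx _ hvY hgv, hYdef, ← Finset.union_insert, ← grid_succ_right,
        ih U s (r + 1) hUm (by omega) hgen' hdisj.2, mul_zero]
    have hall := hN.eq_zero hp hp0 huY hgu hNY hNu hNv
      (hgv.ne_zero _ (Finset.mem_insert_self _ _)) (hgvu.denom_ne_zero hvu)
    have hw := hall w (hgw.ne_zero _ (Finset.mem_insert_self _ _))
    rw [hNx w hwY hgw] at hw
    rw [Finset.insert_union]
    exact (mul_eq_zero.mp hw).resolve_left (hgw.denom_ne_zero hwY)

/-! ### Values on the grid -/

theorem prod_range_shift (f : ℕ → ℂ) (m : ℕ) :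
    (∏ i ∈ Finset.range m, f (i + 1)) * f 0 = (∏ i ∈ Finset.range m, f i) * f m := by
  rw [← Finset.prod_range_succ, ← Finset.prod_range_succ']

theorem prod_range_shift_div {f : ℕ → ℂ} {m : ℕ} (hf : ∀ i ≤ m, f i ≠ 0) :
    ∏ i ∈ Finset.range m, f (i + 1) / f i = f m / f 0 := by
  have h : ∏ i ∈ Finset.range m, f i ≠ 0 := Finset.prod_ne_zero_iff.mpr fun i hi =>
    hf i (Finset.mem_range.mp hi).le
  rw [Finset.prod_div_distrib, div_eq_div_iff h (hf 0 (Nat.zero_le _)), prod_range_shift, mul_comm]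

/-- The product `∏_{i < s} θ(t^{s+1-i}; p) / θ(t^{s-i}; p)`. -/
def tauProd (p t : ℂ) (s : ℕ) : ℂ :=
  ∏ i ∈ Finset.range s, theta (t * (t ^ s / t ^ i)) p / theta (t ^ s / t ^ i) p

/-- The parameters `a = β k` and `b = β l` are in general position. -/
structure Regular (p t a b : ℂ) (n : ℕ) : Prop where
  left : ∀ j : ℕ, theta (a * a * t ^ j) p ≠ 0
  right : ∀ j : ℕ, theta (b * b * t ^ j) p ≠ 0
  quot : ∀ j : ℤ, theta (a / b * t ^ j) p ≠ 0
  prod : ∀ j ≤ 2 * n, theta (a * b * t ^ j) p ≠ 0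
  pow : ∀ j, 1 ≤ j → j ≤ n → theta (t ^ j) p ≠ 0
  tau : ∀ s ≤ n, tauProd p t s ≠ 0

section

variable {p t a b : ℂ} {n : ℕ}

theorem Regular.quot' (hp : ‖p‖ < 1) (ht : t ≠ 0) (ha : a ≠ 0) (hb : b ≠ 0)
    (h : Regular p t a b n) (j : ℤ) : theta (b / a * t ^ j) p ≠ 0 := by
  have hj : t ^ (-j) ≠ 0 := zpow_ne_zero _ ht
  have h1 : b / a * t ^ j = (a / b * t ^ (-j))⁻¹ := by
    rw [mul_inv, inv_div, zpow_neg, inv_inv]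
  rw [h1, theta_inv hp (mul_ne_zero (div_ne_zero ha hb) hj)]
  exact mul_ne_zero (neg_ne_zero.mpr (inv_ne_zero (mul_ne_zero (div_ne_zero ha hb) hj))) (h.quot _)

theorem Regular.symm (hp : ‖p‖ < 1) (ht : t ≠ 0) (ha : a ≠ 0) (hb : b ≠ 0)
    (h : Regular p t a b n) : Regular p t b a n :=
  ⟨h.right, h.left, h.quot' hp ht ha hb, fun j hj => mul_comm a b ▸ h.prod j hj, h.pow, h.tau⟩

theorem mul_pow_div_mul_pow (a b : ℂ) (ht : t ≠ 0) (i j : ℕ) :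
    a * t ^ i / (b * t ^ j) = a / b * t ^ ((i : ℤ) - j) := by
  rw [zpow_sub₀ ht, zpow_natCast, zpow_natCast, mul_div_mul_comm]

theorem theta_pow_div_ne_zero (hp : ‖p‖ < 1) (ht : t ≠ 0)
    (h : ∀ j, 1 ≤ j → j ≤ n → theta (t ^ j) p ≠ 0) {i j : ℕ} (hi : i ≤ n) (hj : j ≤ n)
    (hij : i ≠ j) : theta (t ^ i / t ^ j) p ≠ 0 := by
  rcases lt_or_gt_of_ne hij with hlt | hlt
  · rw [theta_swap hp (pow_ne_zero _ ht) (pow_ne_zero _ ht), ← pow_sub₀ t ht hlt.le |>.trans (div_eq_mul_inv _ _).symm]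
    exact mul_ne_zero (neg_ne_zero.mpr (div_ne_zero (pow_ne_zero _ ht) (pow_ne_zero _ ht)))
      (h _ (by omega) (by omega))
  · rw [← pow_sub₀ t ht hlt.le |>.trans (div_eq_mul_inv _ _).symm]
    exact h _ (by omega) (by omega)

theorem Regular.pair_same (hp : ‖p‖ < 1) (ht : t ≠ 0) (ha : a ≠ 0) (h : Regular p t a b n)
    {i j : ℕ} (hi : i ≤ n) (hj : j ≤ n) (hij : i ≠ j) :
    pairTheta (a * t ^ i) (a * t ^ j) p ≠ 0 := by
  refine mul_ne_zero ?_ ?_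
  · rw [show a * t ^ i * (a * t ^ j) = a * a * t ^ (i + j) by ring]
    exact h.left _
  · rw [mul_div_mul_left _ _ ha]
    exact theta_pow_div_ne_zero hp ht h.pow hi hj hij

theorem Regular.pair_ne (ht : t ≠ 0) (h : Regular p t a b n)
    {i j : ℕ} (hi : i ≤ n) (hj : j ≤ n) :
    pairTheta (a * t ^ i) (b * t ^ j) p ≠ 0 := by
  refine mul_ne_zero ?_ ?_
  · rw [show a * t ^ i * (b * t ^ j) = a * b * t ^ (i + j) by ring]
    exact h.prod _ (by omega)
  · rw [mul_pow_div_mul_pow _ _ ht]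
    exact h.quot _

theorem Regular.gridGeneric (hp : ‖p‖ < 1) (ht : t ≠ 0) (ha : a ≠ 0) (hb : b ≠ 0)
    (h : Regular p t a b n) : GridGeneric p t a b (n + 1) := by
  have h' := h.symm hp ht ha hb
  have inj : ∀ {a b : ℂ}, a ≠ 0 → Regular p t a b n → ∀ i < n + 1, ∀ j < n + 1,
      a * t ^ i = a * t ^ j → i = j := by
    intro a b ha h i hi j hj e
    by_contra hij
    apply h.pair_same hp ht ha (Nat.le_of_lt_succ hi) (Nat.le_of_lt_succ hj) hij
    rw [e, pairTheta_self hp (mul_ne_zero ha (pow_ne_zero _ ht))]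
  refine ⟨⟨?_, ?_, ?_⟩, inj ha h, inj hb h', ?_⟩
  · intro z hz
    rcases Finset.mem_union.mp hz with hz | hz <;> obtain ⟨i, hi, rfl⟩ := mem_geom.mp hz
    exacts [mul_ne_zero ha (pow_ne_zero _ ht), mul_ne_zero hb (pow_ne_zero _ ht)]
  · intro z hz
    rcases Finset.mem_union.mp hz with hz | hz <;> obtain ⟨i, hi, rfl⟩ := mem_geom.mp hz
    · rw [show (a * t ^ i) ^ 2 = a * a * t ^ (2 * i) by ring]
      exact h.left _
    · rw [show (b * t ^ i) ^ 2 = b * b * t ^ (2 * i) by ring]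
      exact h.right _
  · intro z hz y hy hzy
    rcases Finset.mem_union.mp hz with hz | hz <;> obtain ⟨i, hi, rfl⟩ := mem_geom.mp hz <;>
      rcases Finset.mem_union.mp hy with hy | hy <;> obtain ⟨j, hj, rfl⟩ := mem_geom.mp hy
    · exact h.pair_same hp ht ha (by omega) (by omega) (fun e => hzy (e ▸ rfl))
    · exact h.pair_ne ht (by omega) (by omega)
    · exact h'.pair_ne ht (by omega) (by omega)
    · exact h'.pair_same hp ht hb (by omega) (by omega) (fun e => hzy (e ▸ rfl))
  · intro i hi j hj e
    apply h.pair_ne ht (Nat.le_of_lt_succ hi) (Nat.le_of_lt_succ hj)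
    rw [e, pairTheta_self hp (mul_ne_zero hb (pow_ne_zero _ ht))]

/-! ### Evaluation of the `stokes` sums on the two progressions. -/

variable {β : Fin 6 → ℂ}

/-- At w = a the factor θ(β_k w⁻¹) is θ(1) = 0; at a later point w = at^{j+1} the predecessor y =
at^j gives θ(t w⁻¹ y) = θ(1) = 0. -/
theorem fPlus_inv_eq_zero (hp : ‖p‖ < 1) (ht : t ≠ 0) (ha : a ≠ 0) {k : Fin 6} (hk : β k = a)
    {Y : Finset ℂ} {i : ℕ} (hY : ∀ j, i = j + 1 → a * t ^ j ∈ Y) :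
    fPlus p t β Y (a * t ^ i)⁻¹ = 0 := by
  rw [fPlus, fNum, div_eq_zero_iff]
  left
  rcases i with _ | j
  · rw [Finset.prod_eq_zero (Finset.mem_univ k), mul_zero, zero_mul]
    rw [hk, pow_zero, mul_one, mul_inv_cancel₀ ha, theta_one hp]
  · rw [Finset.prod_eq_zero (hY j rfl) (f := fun y => pairTheta (t * (a * t ^ (j + 1))⁻¹) y p),
      mul_zero]
    have : t * (a * t ^ (j + 1))⁻¹ * (a * t ^ j) = 1 := by
      rw [pow_succ]; field_simp
    rw [pairTheta, this, theta_one hp, zero_mul]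

/-- If the successor y = tw is present, then θ(tw/y) = θ(1) = 0. So only the last point of a
progression can contribute. -/
theorem fPlus_eq_zero (hp : ‖p‖ < 1) (ht : t ≠ 0) (ha : a ≠ 0)
    {Y : Finset ℂ} {i : ℕ} (hY : a * t ^ (i + 1) ∈ Y) :
    fPlus p t β Y (a * t ^ i) = 0 := by
  rw [fPlus, fNum, div_eq_zero_iff]
  left
  rw [Finset.prod_eq_zero hY (f := fun y => pairTheta (t * (a * t ^ i)) y p), mul_zero]
  have h : t * (a * t ^ i) = a * t ^ (i + 1) := by ring
  rw [h, pairTheta_self hp (mul_ne_zero ha (pow_ne_zero _ ht))]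

theorem stokes_term_eq_zero (hp : ‖p‖ < 1) (ht : t ≠ 0) (ha : a ≠ 0) {k : Fin 6} (hk : β k = a)
    (hg : GridGeneric p t a b n) {s r i : ℕ} (hs : s ≤ n) (hi : i + 1 < s) :
    fPlus p t β ((grid a b t s r).erase (a * t ^ i)) (a * t ^ i) +
      fPlus p t β ((grid a b t s r).erase (a * t ^ i)) (a * t ^ i)⁻¹ = 0 := by
  have hmem : ∀ j < s, j ≠ i → a * t ^ j ∈ (grid a b t s r).erase (a * t ^ i) := fun j hj hji =>
    Finset.mem_erase.mpr ⟨fun e => hji (hg.inj_left j (by omega) i (by omega) e),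
      Finset.mem_union_left _ (mem_geom.mpr ⟨j, hj, rfl⟩)⟩
  rw [fPlus_eq_zero hp ht ha (hmem (i + 1) hi (by omega)),
    fPlus_inv_eq_zero hp ht ha hk fun j hj => hmem j (by omega) (by omega), add_zero]

theorem stokes_term_last (hp : ‖p‖ < 1) (ht : t ≠ 0) (ha : a ≠ 0) {k : Fin 6} (hk : β k = a)
    (hg : GridGeneric p t a b n) {s r : ℕ} (hs : s < n) (hr : r ≤ n) (c : ℂ) :
    (fPlus p t β ((grid a b t (s + 1) r).erase (a * t ^ s)) (a * t ^ s) +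
      fPlus p t β ((grid a b t (s + 1) r).erase (a * t ^ s)) (a * t ^ s)⁻¹) *
      ∏ v ∈ (grid a b t (s + 1) r).erase (a * t ^ s), pairTheta c v p =
    fPlus p t β (grid a b t s r) (a * t ^ s) * ∏ v ∈ grid a b t s r, pairTheta c v p := by
  rw [grid_succ_left, Finset.erase_insert (hg.notMem_left hs hr),
    fPlus_inv_eq_zero hp ht ha hk (Y := grid a b t s r) fun j hj =>
      Finset.mem_union_left _ (mem_geom.mpr ⟨j, by omega, rfl⟩), add_zero]

theorem stokes_grid_left (hp : ‖p‖ < 1) (ht : t ≠ 0) (ha : a ≠ 0) {k : Fin 6} (hk : β k = a)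
    (hg : GridGeneric p t a b n) {s : ℕ} (hs : s < n) (c : ℂ) :
    stokes p t β c (grid a b t (s + 1) 0) =
      fPlus p t β (grid a b t s 0) (a * t ^ s) * ∏ v ∈ grid a b t s 0, pairTheta c v p := by
  rw [← stokes_term_last hp ht ha hk hg hs (Nat.zero_le _) c, stokes]
  refine Finset.sum_eq_single_of_mem _ (Finset.mem_union_left _ (mem_geom.mpr ⟨s, by omega, rfl⟩)) ?_
  intro w hw hne
  have hw' : w ∈ geom a t (s + 1) := by simpa [grid, geom] using hw
  obtain ⟨i, hi, rfl⟩ := mem_geom.mp hw'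
  rw [stokes_term_eq_zero hp ht ha hk hg hs (i := i)
    (by have : i ≠ s := fun e => hne (e ▸ rfl)
        omega), zero_mul]

/-- Of all the terms only those of the two end points at^s and bt^r survive, and in them only the
part f(w). This is what makes the linear conditions a two-term recursion. -/
theorem stokes_grid (hp : ‖p‖ < 1) (ht : t ≠ 0) (ha : a ≠ 0) (hb : b ≠ 0) {k l : Fin 6}
    (hk : β k = a) (hl : β l = b) (hg : GridGeneric p t a b n) {s r : ℕ} (hs : s < n) (hr : r < n)
    (c : ℂ) :
    stokes p t β c (grid a b t (s + 1) (r + 1)) =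
      fPlus p t β (grid a b t s (r + 1)) (a * t ^ s) *
        ∏ v ∈ grid a b t s (r + 1), pairTheta c v p +
      fPlus p t β (grid a b t (s + 1) r) (b * t ^ r) *
        ∏ v ∈ grid a b t (s + 1) r, pairTheta c v p := by
  have h2 := stokes_term_last hp ht hb hl hg.symm hr (Nat.succ_le_of_lt hs) c
  rw [grid_comm b a, grid_comm b a] at h2
  rw [← stokes_term_last hp ht ha hk hg hs hr c, ← h2, stokes]
  refine Finset.sum_eq_add _ _ (hg.ne s hs r hr) ?_
    (fun h => absurd (Finset.mem_union_left _ (mem_geom.mpr ⟨s, by omega, rfl⟩)) h)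
    (fun h => absurd (Finset.mem_union_right _ (mem_geom.mpr ⟨r, by omega, rfl⟩)) h)
  intro w hw hne
  rcases Finset.mem_union.mp hw with hw | hw <;> obtain ⟨i, hi, rfl⟩ := mem_geom.mp hw
  · rw [stokes_term_eq_zero hp ht ha hk hg hs (i := i)
      (by have : i ≠ s := fun e => hne.1 (e ▸ rfl)
          omega), zero_mul]
  · rw [grid_comm, stokes_term_eq_zero hp ht hb hl hg.symm hr (i := i)
      (by have : i ≠ r := fun e => hne.2 (e ▸ rfl)
          omega), zero_mul]

/-- The value of `fPlus` at the last point of a progression. -/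
theorem fPlus_grid (hp : ‖p‖ < 1) (ht : t ≠ 0) (ha : a ≠ 0) (hb : b ≠ 0) {k l : Fin 6}
    (hkl : k ≠ l) (hk : β k = a) (hl : β l = b) (hR : Regular p t a b n) {s r : ℕ}
    (hsr : s + r = n) :
    fPlus p t β (grid a b t s r) (a * t ^ s) =
      (a * t ^ s)⁻¹ * (∏ m ∈ (Finset.univ.erase k).erase l, theta (β m * a * t ^ s) p) *
        tauProd p t s * theta (a * b * t ^ n) p *
        (theta (a / b * t ^ ((s : ℤ) + 1)) p / theta (a / b * t ^ (2 * (s : ℤ) + 1 - n)) p) := by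
  have hg := hR.gridGeneric hp ht ha hb
  rw [fPlus, fNum, denom, hg.prod_grid _ (by omega) (by omega),
    hg.prod_grid _ (by omega) (by omega)]
  -- Within the same progression the factors θ(a²t^{s+i}) telescope, and the quotients of powers of
  -- t form `tauProd`, which involves neither a nor b.
  have hA : (∏ i ∈ Finset.range s, pairTheta (t * (a * t ^ s)) (a * t ^ i) p) /
      (∏ i ∈ Finset.range s, pairTheta (a * t ^ s) (a * t ^ i) p) =
      theta (a * a * t ^ (s + s)) p / theta (a * a * t ^ s) p * tauProd p t s := by
    have h1 := prod_range_shift_div (f := fun i => theta (a * a * t ^ (s + i)) p) (m := s)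
      fun i _ => hR.left _
    simp only [add_zero] at h1
    rw [← h1, tauProd, ← Finset.prod_div_distrib, ← Finset.prod_mul_distrib]
    refine Finset.prod_congr rfl fun i _ => ?_
    rw [pairTheta, pairTheta, mul_div_mul_comm]
    congr 3
    · ring
    · ring
    · rw [mul_left_comm, mul_div_mul_left _ _ ha, mul_div_assoc]
    · rw [mul_div_mul_left _ _ ha]
  -- Against the other progression both families telescope; the exponents of t in the second one
  -- decrease with i, so the shift lemma is applied to reciprocals.
  have hB : (∏ i ∈ Finset.range r, pairTheta (t * (a * t ^ s)) (b * t ^ i) p) /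
      (∏ i ∈ Finset.range r, pairTheta (a * t ^ s) (b * t ^ i) p) =
      theta (a * b * t ^ n) p / theta (a * b * t ^ s) p *
        (theta (a / b * t ^ ((s : ℤ) + 1)) p / theta (a / b * t ^ (2 * (s : ℤ) + 1 - n)) p) := by
    have h1 := prod_range_shift_div (f := fun i => theta (a * b * t ^ (s + i)) p) (m := r)
      fun i _ => hR.prod _ (by omega)
    have h2 := prod_range_shift_div
      (f := fun i => (theta (a / b * t ^ ((s : ℤ) + 1 - i)) p)⁻¹) (m := r)
      fun i _ => inv_ne_zero (hR.quot _)
    simp only [add_zero, hsr, Nat.cast_zero, sub_zero] at h1 h2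
    have h3 : (2 * (s : ℤ) + 1 - n) = (s : ℤ) + 1 - r := by omega
    have h4 : theta (a / b * t ^ ((s : ℤ) + 1)) p / theta (a / b * t ^ ((s : ℤ) + 1 - r)) p =
        (theta (a / b * t ^ ((s : ℤ) + 1 - r)) p)⁻¹ / (theta (a / b * t ^ ((s : ℤ) + 1)) p)⁻¹ := by
      rw [div_inv_eq_mul, div_eq_mul_inv, mul_comm]
    rw [h3, h4, ← h1, ← h2, ← Finset.prod_div_distrib, ← Finset.prod_mul_distrib]
    refine Finset.prod_congr rfl fun i _ => ?_
    have e1 : a * t ^ (s + 1) * (b * t ^ i) = a * b * t ^ (s + (i + 1)) := by ring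
    have e2 : a * t ^ s * (b * t ^ i) = a * b * t ^ (s + i) := by ring
    have e3 : ((s + 1 : ℕ) : ℤ) - i = (s : ℤ) + 1 - i := by push_cast; ring
    have e4 : (s : ℤ) + 1 - ((i + 1 : ℕ) : ℤ) = (s : ℤ) - i := by push_cast; ring
    rw [pairTheta, pairTheta, mul_div_mul_comm, mul_pow_div_mul_pow _ _ ht,
      show t * (a * t ^ s) = a * t ^ (s + 1) by ring, mul_pow_div_mul_pow _ _ ht, div_inv_eq_mul,
      e1, e2, e3, e4, mul_comm (theta _ p)⁻¹, ← div_eq_mul_inv]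
  have h6 : ∏ m, theta (β m * (a * t ^ s)) p = theta (a * a * t ^ s) p *
      (theta (a * b * t ^ s) p *
        ∏ m ∈ (Finset.univ.erase k).erase l, theta (β m * a * t ^ s) p) := by
    simp only [← mul_assoc]
    rw [← Finset.mul_prod_erase Finset.univ _ (Finset.mem_univ k),
      ← Finset.mul_prod_erase (Finset.univ.erase k) _ (Finset.mem_erase.mpr ⟨hkl.symm, Finset.mem_univ l⟩),
      hk, hl, mul_comm b a]
    exact (mul_assoc _ _ _).symm
  have h7 : (a * t ^ s) ^ 2 = a * a * t ^ (s + s) := by ring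
  have n1 := hR.left (s + s)
  have n2 := hR.left s
  have n3 := hR.prod s (by omega)
  -- θ(w²) = θ(a²t^{2s}) and the factors m = k, l of the numerator cancel against the boundary terms
  -- of the telescoping products.
  rw [mul_div_mul_comm, mul_div_mul_comm, hA, hB, h6, h7]
  generalize theta (a / b * t ^ ((s : ℤ) + 1)) p / theta (a / b * t ^ (2 * (s : ℤ) + 1 - n)) p = X
  generalize theta (a * a * t ^ (s + s)) p = X1 at *
  generalize theta (a * a * t ^ s) p = X2 at *
  generalize theta (a * b * t ^ s) p = X3 at *
  generalize ∏ m ∈ (Finset.univ.erase k).erase l, theta (β m * a * t ^ s) p = X4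
  generalize tauProd p t s = X5
  field_simp

end

/-! ### The combination that relates two products -/

theorem exists_mulVec_eq_of_upperTriangular {N : ℕ} (M : Matrix (Fin N) (Fin N) ℂ)
    (h0 : ∀ i j, j < i → M i j = 0) (h1 : ∀ i, M i i ≠ 0) (γ : Fin N → ℂ) :
    ∃ e : Fin N → ℂ, ∀ i, ∑ j, e j * M i j = γ i := by
  have hdet : IsUnit M.det := by
    rw [Matrix.det_of_isUpperTriangular (fun i j hij => h0 i j hij)]
    exact (Finset.prod_ne_zero_iff.mpr fun i _ => h1 i).isUnit
  have hM : IsUnit M := (Matrix.isUnit_iff_isUnit_det M).mpr hdet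
  obtain ⟨e, he⟩ := Matrix.mulVec_surjective_iff_isUnit.mpr hM γ
  refine ⟨e, fun i => ?_⟩
  rw [← he, Matrix.mulVec, dotProduct]
  exact Finset.sum_congr rfl fun j _ => mul_comm _ _

/-- The reflection identity behind the evaluation of the ratio of the two coefficients. -/
theorem prod_reflection {T : ℤ → ℂ} (hT : ∀ j, T j ≠ 0) (n : ℕ) :
    ∏ r ∈ Finset.range (n + 1), T (-r - 1) * T r / T (n - 1 - 2 * r) =
      ∏ r ∈ Finset.range (n + 1), T (r + 1) * T (-r) / T (2 * r + 1 - n) := by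
  have hne : ∀ f : ℕ → ℤ, ∏ r ∈ Finset.range (n + 1), T (f r) ≠ 0 := fun f =>
    Finset.prod_ne_zero_iff.mpr fun r _ => hT _
  -- Reversing the order r ↦ n - r makes each of the three products a shift of its counterpart by r
  -- ↦ r + 1. The boundary factors T(0), T(-n-1) and T(n+1) then balance.
  have h0 : ∏ r ∈ Finset.range (n + 1), T (n - 1 - 2 * r) =
      ∏ r ∈ Finset.range (n + 1), T (2 * r - 1 - n) := by
    rw [← Finset.prod_range_reflect]
    refine Finset.prod_congr rfl fun r hr => ?_
    have : r ≤ n := Nat.lt_succ_iff.mp (Finset.mem_range.mp hr)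
    congr 1
    omega
  have h1 := prod_range_shift (fun r => T (-r)) (n + 1)
  have h2 := prod_range_shift (fun r => T r) (n + 1)
  have h3 := prod_range_shift (fun r => T (2 * r - 1 - n)) (n + 1)
  simp only [Finset.prod_div_distrib, Finset.prod_mul_distrib, h0]
  have e1 : ∀ x : ℤ, -(x + 1) = -x - 1 := fun x => by ring
  have e3 : ∀ x : ℤ, 2 * (x + 1) - 1 - n = 2 * x + 1 - n := fun x => by ring
  have e4 : (2 * (n : ℤ) + 1 - n) = n + 1 := by ring
  have e5 : (2 * (0 : ℤ) - 1 - n) = -n - 1 := by ring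
  simp only [Nat.cast_add, Nat.cast_one, e1, e3, e4, e5, Nat.cast_zero, neg_zero] at h1 h2 h3
  rw [div_eq_div_iff (hne _) (hne _)]
  have n1 := hne fun r => -r - 1
  have z0 := hT 0
  have z1 := hT (-n - 1)
  have z2 := hT (n + 1)
  generalize ∏ r ∈ Finset.range (n + 1), T (-r - 1) = P1 at *
  generalize ∏ r ∈ Finset.range (n + 1), T (-r) = P2 at *
  generalize ∏ r ∈ Finset.range (n + 1), T (r + 1) = P3 at *
  generalize ∏ r ∈ Finset.range (n + 1), T r = P4 at *
  generalize ∏ r ∈ Finset.range (n + 1), T (2 * r + 1 - n) = P5 at *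
  generalize ∏ r ∈ Finset.range (n + 1), T (2 * r - 1 - n) = P6 at *
  apply mul_right_cancel₀ (mul_ne_zero (mul_ne_zero z0 z1) z2)
  calc P1 * P4 * P5 * (T 0 * T (-n - 1) * T (n + 1))
      = (P1 * T 0) * (P4 * T (n + 1)) * (P5 * T (-n - 1)) := by ring
    _ = (P2 * T (-n - 1)) * (P3 * T 0) * (P6 * T (n + 1)) := by rw [h1, h3, ← h2]
    _ = _ := by ring

section

variable {p t a b : ℂ} {n : ℕ} {β : Fin 6 → ℂ}

/-- After insertion of the closed form `fPlus_grid` the two products share, for each r, a factor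
symmetric in a and b up to a⁻¹. What is left is a sign for each r, powers of t with product 1, and
theta quotients in a/b that `prod_reflection` matches. -/
theorem prod_fPlus_grid (hp : ‖p‖ < 1) (ht : t ≠ 0) (ha : a ≠ 0) (hb : b ≠ 0) {k l : Fin 6}
    (hkl : k ≠ l) (hk : β k = a) (hl : β l = b) (hR : Regular p t a b n) :
    (∏ r ∈ Finset.range (n + 1), fPlus p t β (grid a b t (n - r) r) (b * t ^ r)) *
        (∏ i ∈ Finset.range (n + 1), pairTheta b (a * t ^ i) p) *
        (∏ i ∈ Finset.range (n + 1), ∏ m ∈ (Finset.univ.erase k).erase l,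
          theta (β m * a * t ^ i) p) =
      (-1) ^ (n + 1) * ((∏ s ∈ Finset.range (n + 1), fPlus p t β (grid a b t s (n - s)) (a * t ^ s)) *
        (∏ i ∈ Finset.range (n + 1), pairTheta a (b * t ^ i) p) *
        (∏ i ∈ Finset.range (n + 1), ∏ m ∈ (Finset.univ.erase k).erase l,
          theta (β m * b * t ^ i) p)) := by
  let T : ℤ → ℂ := fun j => theta (a / b * t ^ j) p
  have hab := div_ne_zero ha hb
  have hT' : ∀ j : ℤ, theta (b / a * t ^ j) p = -(b / a * t ^ j) * T (-j) := fun j => by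
    have h1 : b / a * t ^ j = (a / b * t ^ (-j))⁻¹ := by
      rw [mul_inv, inv_div, zpow_neg, inv_inv]
    rw [h1, theta_inv hp (mul_ne_zero hab (zpow_ne_zero _ ht))]
  -- The exponents n - 2r for 0 ≤ r ≤ n sum to zero.
  have htt : ∏ r ∈ Finset.range (n + 1), t ^ ((n : ℤ) - 2 * r) = 1 := by
    have h1 : ∏ r ∈ Finset.range (n + 1), t ^ (n - r : ℤ) =
        ∏ r ∈ Finset.range (n + 1), t ^ (r : ℤ) := by
      rw [← Finset.prod_range_reflect]
      refine Finset.prod_congr rfl fun r hr => ?_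
      have : r ≤ n := Nat.lt_succ_iff.mp (Finset.mem_range.mp hr)
      congr 1
      omega
    have h2 : ∀ r : ℕ, t ^ ((n : ℤ) - 2 * r) = t ^ ((n : ℤ) - r) / t ^ (r : ℤ) := fun r => by
      rw [← zpow_sub₀ ht]; congr 1; ring
    rw [Finset.prod_congr rfl fun r _ => h2 r, Finset.prod_div_distrib, h1, div_self]
    exact Finset.prod_ne_zero_iff.mpr fun r _ => zpow_ne_zero _ ht
  have hrefl := prod_reflection (T := T) hR.quot n
  have hconst : ∏ _r ∈ Finset.range (n + 1), (-1 : ℂ) = (-1) ^ (n + 1) := by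
    rw [Finset.prod_const, Finset.card_range]
  rw [← hconst, ← Finset.prod_mul_distrib, ← Finset.prod_mul_distrib, ← Finset.prod_mul_distrib,
    ← Finset.prod_mul_distrib, ← Finset.prod_mul_distrib]
  have hL : ∀ r ∈ Finset.range (n + 1),
      fPlus p t β (grid a b t (n - r) r) (b * t ^ r) * pairTheta b (a * t ^ r) p *
        (∏ m ∈ (Finset.univ.erase k).erase l, theta (β m * a * t ^ r) p) =
      (-a⁻¹ * (t ^ r)⁻¹ * tauProd p t r * theta (a * b * t ^ n) p * theta (a * b * t ^ r) p *
        (∏ m ∈ (Finset.univ.erase k).erase l, theta (β m * a * t ^ r) p) *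
        (∏ m ∈ (Finset.univ.erase k).erase l, theta (β m * b * t ^ r) p)) *
        t ^ ((n : ℤ) - 2 * r) * (T (-r - 1) * T r / T (n - 1 - 2 * r)) := fun r hr => by
    have hrn : r ≤ n := Nat.lt_succ_iff.mp (Finset.mem_range.mp hr)
    rw [grid_comm, fPlus_grid hp ht hb ha hkl.symm hl hk (hR.symm hp ht ha hb)
      (show r + (n - r) = n by omega), Finset.erase_right_comm, hT', hT', pairTheta,
      show b * (a * t ^ r) = a * b * t ^ r by ring,
      show b / (a * t ^ r) = b / a * t ^ (-(r : ℤ)) by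
        rw [zpow_neg, zpow_natCast, div_mul_eq_div_mul_one_div, one_div], hT', neg_neg,
      show (-((r : ℤ) + 1)) = -r - 1 by ring, show -(2 * (r : ℤ) + 1 - n) = n - 1 - 2 * r by ring,
      mul_comm b a]
    have e1 : t ^ ((r : ℤ) + 1) = t ^ (n - 2 * r : ℤ) * t ^ r * t ^ (2 * (r : ℤ) + 1 - n) := by
      rw [← zpow_natCast t r, ← zpow_add₀ ht, ← zpow_add₀ ht]; congr 1; ring
    have e2 : t ^ (-(r : ℤ)) = (t ^ r)⁻¹ := by rw [zpow_neg, zpow_natCast]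
    rw [e1, e2]
    have z1 : t ^ (2 * (r : ℤ) + 1 - n) ≠ 0 := zpow_ne_zero _ ht
    have z2 : t ^ r ≠ 0 := pow_ne_zero _ ht
    have z3 : T (n - 1 - 2 * r) ≠ 0 := hR.quot _
    generalize t ^ (2 * (r : ℤ) + 1 - n) = X1 at *
    generalize t ^ (n - 2 * r : ℤ) = X2 at *
    generalize t ^ r = X3 at *
    generalize T (n - 1 - 2 * r) = X4 at *
    generalize T (-r - 1) = X5 at *
    generalize T r = X6 at *
    generalize tauProd p t r = X7
    generalize ∏ m ∈ (Finset.univ.erase k).erase l, theta (β m * a * X3) p = X8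
    generalize ∏ m ∈ (Finset.univ.erase k).erase l, theta (β m * b * X3) p = X9
    generalize theta (a * b * t ^ n) p = X10
    generalize theta (a * b * X3) p = X11
    field_simp
  have hRr : ∀ r ∈ Finset.range (n + 1),
      -1 * (fPlus p t β (grid a b t r (n - r)) (a * t ^ r) * pairTheta a (b * t ^ r) p *
        (∏ m ∈ (Finset.univ.erase k).erase l, theta (β m * b * t ^ r) p)) =
      (-a⁻¹ * (t ^ r)⁻¹ * tauProd p t r * theta (a * b * t ^ n) p * theta (a * b * t ^ r) p *
        (∏ m ∈ (Finset.univ.erase k).erase l, theta (β m * a * t ^ r) p) *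
        (∏ m ∈ (Finset.univ.erase k).erase l, theta (β m * b * t ^ r) p)) *
        (T (r + 1) * T (-r) / T (2 * r + 1 - n)) := fun r hr => by
    have hrn : r ≤ n := Nat.lt_succ_iff.mp (Finset.mem_range.mp hr)
    rw [fPlus_grid hp ht ha hb hkl hk hl hR (show r + (n - r) = n by omega), pairTheta,
      show a * (b * t ^ r) = a * b * t ^ r by ring,
      show a / (b * t ^ r) = a / b * t ^ (-(r : ℤ)) by
        rw [zpow_neg, zpow_natCast, div_mul_eq_div_mul_one_div, one_div], mul_inv]
    simp only [T]
    ring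
  rw [Finset.prod_congr rfl hL, Finset.prod_congr rfl hRr, Finset.prod_mul_distrib,
    Finset.prod_mul_distrib, htt, mul_one, hrefl, ← Finset.prod_mul_distrib]

end

section

variable {p t a b : ℂ} {n : ℕ} {β : Fin 6 → ℂ}

theorem fPlus_grid_ne_zero (hp : ‖p‖ < 1) (ht : t ≠ 0) (ha : a ≠ 0) (hb : b ≠ 0) {k l : Fin 6}
    (hkl : k ≠ l) (hk : β k = a) (hl : β l = b) (hR : Regular p t a b n)
    (hE : ∀ m, m ≠ k → m ≠ l → ∀ i ≤ n, theta (β m * a * t ^ i) p ≠ 0) {s r : ℕ}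
    (hsr : s + r = n) : fPlus p t β (grid a b t s r) (a * t ^ s) ≠ 0 := by
  rw [fPlus_grid hp ht ha hb hkl hk hl hR hsr]
  refine mul_ne_zero (mul_ne_zero (mul_ne_zero (mul_ne_zero ?_ ?_) (hR.tau s (by omega)))
    (hR.prod n (by omega))) (div_ne_zero (hR.quot _) (hR.quot _))
  · exact inv_ne_zero (mul_ne_zero ha (pow_ne_zero _ ht))
  · refine Finset.prod_ne_zero_iff.mpr fun m hm => ?_
    simp only [Finset.mem_erase, Finset.mem_univ, and_true] at hm
    exact hE m hm.2 hm.1 s (by omega)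

/-- There is a combination of the functions `stokes` and of two products that vanishes on the grid,
with coefficients in the ratio that the integral identity predicts. -/
theorem exists_combo (hp : ‖p‖ < 1) (ht : t ≠ 0) (ha : a ≠ 0) (hb : b ≠ 0) {k l : Fin 6}
    (hkl : k ≠ l) (hk : β k = a) (hl : β l = b) (hR : Regular p t a b n)
    (hEa : ∀ m, m ≠ k → m ≠ l → ∀ i ≤ n, theta (β m * a * t ^ i) p ≠ 0)
    (hEb : ∀ m, m ≠ k → m ≠ l → ∀ i ≤ n, theta (β m * b * t ^ i) p ≠ 0) :
    ∃ (e : Fin (n + 1) → ℂ) (A B : ℂ),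
      (∀ s r, s + r = n + 1 →
        combo p t β (fun j : Fin (n + 1) => a * t ^ (j : ℕ)) e a b A B (grid a b t s r) = 0) ∧
      ∀ La Lb, A * La + B * Lb = 0 →
        La * (∏ i ∈ Finset.range (n + 1), ∏ m ∈ (Finset.univ.erase k).erase l,
          theta (β m * b * t ^ i) p) =
        Lb * ∏ i ∈ Finset.range (n + 1), ∏ m ∈ (Finset.univ.erase k).erase l,
          theta (β m * a * t ^ i) p := by
  have hg := hR.gridGeneric hp ht ha hb
  have hR' := hR.symm hp ht ha hb
  let α : ℕ → ℂ := fun s => fPlus p t β (grid a b t s (n - s)) (a * t ^ s)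
  let α' : ℕ → ℂ := fun r => fPlus p t β (grid a b t (n - r) r) (b * t ^ r)
  have hα : ∀ s ≤ n, α s ≠ 0 := fun s hs =>
    fPlus_grid_ne_zero hp ht ha hb hkl hk hl hR hEa (by omega)
  have hα' : ∀ s ≤ n, α' s ≠ 0 := fun s hs => by
    simp only [α']
    rw [grid_comm]
    exact fPlus_grid_ne_zero hp ht hb ha hkl.symm hl hk hR' (fun m h1 h2 => hEb m h2 h1) (by omega)
  -- The solution of α_s γ_s + α'_r γ_{s+1} = 0 for s + r = n - 1, normalized by γ_0 = 1. These are
  -- the conditions at the grids that contain both a and b.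
  let γ : ℕ → ℂ := fun s => ∏ i ∈ Finset.range s, (-α i / α' (n - 1 - i))
  -- The values c_j = at^j are chosen for triangularity: ∏_y θ(c_j y^{±1}) over the grid (s, n-s)
  -- vanishes for j < s, since at^j is then a grid point.
  obtain ⟨e, he⟩ := exists_mulVec_eq_of_upperTriangular
    (fun s j : Fin (n + 1) => ∏ y ∈ grid a b t s (n - s), pairTheta (a * t ^ (j : ℕ)) y p)
    (fun s j hjs => Finset.prod_eq_zero
      (Finset.mem_union_left _ (mem_geom.mpr ⟨j, hjs, rfl⟩))
      (pairTheta_self hp (mul_ne_zero ha (pow_ne_zero _ ht))))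
    (fun s => by
      have hs := s.2
      rw [hg.prod_grid _ (by omega) (by omega)]
      refine mul_ne_zero (Finset.prod_ne_zero_iff.mpr fun i hi => ?_)
        (Finset.prod_ne_zero_iff.mpr fun i hi => ?_)
      · have hi := Finset.mem_range.mp hi
        exact hR.pair_same hp ht ha (by omega) (by omega) hi.ne'
      · have hi := Finset.mem_range.mp hi
        exact hR.pair_ne ht (by omega) (by omega))
    (fun s => γ s)
  have he' : ∀ s r, s + r = n →
      ∑ j, e j * ∏ y ∈ grid a b t s r, pairTheta (a * t ^ (j : ℕ)) y p = γ s := by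
    intro s r hsr
    have := he ⟨s, by omega⟩
    simp only at this
    rw [← this, show n - s = r by omega]
  let PA : ℂ := ∏ i ∈ Finset.range (n + 1), pairTheta a (b * t ^ i) p
  let PB : ℂ := ∏ i ∈ Finset.range (n + 1), pairTheta b (a * t ^ i) p
  have hPA : PA ≠ 0 := Finset.prod_ne_zero_iff.mpr fun i hi => by
    simpa using hR.pair_ne ht (Nat.zero_le n) (Nat.lt_succ_iff.mp (Finset.mem_range.mp hi))
  have hPB : PB ≠ 0 := Finset.prod_ne_zero_iff.mpr fun i hi => by
    simpa using hR'.pair_ne ht (Nat.zero_le n) (Nat.lt_succ_iff.mp (Finset.mem_range.mp hi))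
  have hvan : ∀ {a b : ℂ}, a ≠ 0 → ∀ s r, ∏ z ∈ grid a b t (s + 1) r, pairTheta a z p = 0 :=
    fun {a b} ha s r => Finset.prod_eq_zero
      (Finset.mem_union_left _ (mem_geom.mpr ⟨0, by omega, by rw [pow_zero, mul_one]⟩))
      (pairTheta_self hp ha)
  -- A and B solve the two end equations, at the grids that consist of one progression only; in the
  -- mixed grids both products vanish.
  refine ⟨e, -α' n / PA, -(α n * γ n) / PB, ?_, ?_⟩
  · intro s r hsr
    rw [combo]
    rcases s with _ | s
    · obtain rfl : r = n + 1 := by omega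
      have h1 : ∀ j : Fin (n + 1), stokes p t β (a * t ^ (j : ℕ)) (grid a b t 0 (n + 1)) =
          α' n * ∏ y ∈ grid a b t 0 n, pairTheta (a * t ^ (j : ℕ)) y p := fun j => by
        rw [grid_comm, stokes_grid_left hp ht hb hl hg.symm (by omega), grid_comm]
        simp only [α', Nat.sub_self]
      have h2 : ∏ z ∈ grid a b t 0 (n + 1), pairTheta a z p = PA := by
        rw [hg.prod_grid _ (Nat.zero_le _) le_rfl, Finset.range_zero, Finset.prod_empty, one_mul]
      have h3 : ∏ z ∈ grid a b t 0 (n + 1), pairTheta b z p = 0 := by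
        rw [grid_comm]; exact hvan hb n 0
      rw [Finset.sum_congr rfl fun j _ => by rw [h1 j, mul_left_comm], ← Finset.mul_sum,
        he' 0 n (by omega), h2, h3]
      simp only [γ, Finset.range_zero, Finset.prod_empty]
      field_simp
      ring
    · rcases r with _ | r
      · obtain rfl : s = n := by omega
        have h1 : ∀ j : Fin (s + 1), stokes p t β (a * t ^ (j : ℕ)) (grid a b t (s + 1) 0) =
            α s * ∏ y ∈ grid a b t s 0, pairTheta (a * t ^ (j : ℕ)) y p := fun j => by
          rw [stokes_grid_left hp ht ha hk hg (by omega)]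
          simp only [α, Nat.sub_self]
        have h2 : ∏ z ∈ grid a b t (s + 1) 0, pairTheta b z p = PB := by
          rw [hg.prod_grid _ le_rfl (Nat.zero_le _), Finset.range_zero, Finset.prod_empty, mul_one]
        rw [Finset.sum_congr rfl fun j _ => by rw [h1 j, mul_left_comm], ← Finset.mul_sum,
          he' s 0 (by omega), h2, hvan ha]
        field_simp
        ring
      · have h1 : ∀ j : Fin (n + 1), stokes p t β (a * t ^ (j : ℕ)) (grid a b t (s + 1) (r + 1)) =
            α s * ∏ y ∈ grid a b t s (r + 1), pairTheta (a * t ^ (j : ℕ)) y p +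
            α' r * ∏ y ∈ grid a b t (s + 1) r, pairTheta (a * t ^ (j : ℕ)) y p := fun j => by
          rw [stokes_grid hp ht ha hb hk hl hg (by omega) (by omega)]
          simp only [α, α', show n - s = r + 1 by omega, show n - r = s + 1 by omega]
        have h2 : ∏ z ∈ grid a b t (s + 1) (r + 1), pairTheta b z p = 0 := by
          rw [grid_comm]; exact hvan hb _ _
        have h3 : γ (s + 1) = γ s * (-α s / α' r) := by
          simp only [γ]
          rw [Finset.prod_range_succ, show n - 1 - s = r by omega]
        have h4 := hα' r (by omega)
        rw [Finset.sum_congr rfl fun j _ => by rw [h1 j, mul_add, mul_left_comm, mul_left_comm (e j)],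
          Finset.sum_add_distrib, ← Finset.mul_sum, ← Finset.mul_sum,
          he' s (r + 1) (by omega), he' (s + 1) r (by omega), h2, hvan ha, h3]
        field_simp
        ring
  -- Multiplying out the recursion expresses γ_n through the products of α and α', so A : B becomes
  -- the ratio of the two products compared by `prod_fPlus_grid`.
  · intro La Lb hL
    have hγ : γ n * ∏ i ∈ Finset.range n, α' i = (-1) ^ n * ∏ i ∈ Finset.range n, α i := by
      have hc : ∏ _i ∈ Finset.range n, (-1 : ℂ) = (-1) ^ n := by
        rw [Finset.prod_const, Finset.card_range]
      rw [← Finset.prod_range_reflect α', ← Finset.prod_mul_distrib, ← hc,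
        ← Finset.prod_mul_distrib]
      refine Finset.prod_congr rfl fun i hi => ?_
      have h4 := hα' (n - 1 - i) (by omega)
      field_simp
    have hid := prod_fPlus_grid hp ht ha hb hkl hk hl hR
    rw [Finset.prod_range_succ (fun r => fPlus p t β (grid a b t (n - r) r) (b * t ^ r)),
      Finset.prod_range_succ (fun s => fPlus p t β (grid a b t s (n - s)) (a * t ^ s))] at hid
    change (∏ i ∈ Finset.range n, α' i) * α' n * PB * _ =
      (-1) ^ (n + 1) * ((∏ i ∈ Finset.range n, α i) * α n * PA * _) at hid
    have hL' : α' n * PB * La + α n * γ n * PA * Lb = 0 := by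
      field_simp at hL
      linear_combination -hL
    have hne : (-1 : ℂ) ^ (n + 1) * ((∏ i ∈ Finset.range n, α i) * α n * PA) ≠ 0 := by
      refine mul_ne_zero (pow_ne_zero _ (by norm_num)) (mul_ne_zero (mul_ne_zero ?_
        (hα n le_rfl)) hPA)
      exact Finset.prod_ne_zero_iff.mpr fun i hi => hα i (Finset.mem_range.mp hi).le
    apply mul_left_cancel₀ hne
    generalize (∏ i ∈ Finset.range (n + 1), ∏ m ∈ (Finset.univ.erase k).erase l,
      theta (β m * a * t ^ i) p) = Ea at *
    generalize (∏ i ∈ Finset.range (n + 1), ∏ m ∈ (Finset.univ.erase k).erase l,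
      theta (β m * b * t ^ i) p) = Eb at *
    generalize ∏ i ∈ Finset.range n, α' i = X at *
    generalize ∏ i ∈ Finset.range n, α i = X' at *
    rw [pow_succ] at hid ⊢
    linear_combination (-La) * hid + X * Ea * hL' - Ea * α n * PA * Lb * hγ

end

/-! ### Contour shift in one variable -/

/-- By Cauchy the integrals of G(w) dw/w over |w| = 1 and |w| = |q|⁻¹ agree; the map w ↦ 1/(qw)
exchanges the circles and turns G into -G. -/
theorem integral_circle_eq_zero_of_reflection {q : ℂ} (hq : ‖q‖ < 1) (hq0 : q ≠ 0) {G : ℂ → ℂ}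
    (hG : ∀ w, 1 ≤ ‖w‖ → ‖w‖ ≤ ‖q‖⁻¹ → DifferentiableAt ℂ G w)
    (hrefl : ∀ w ≠ 0, G (q * w)⁻¹ = -G w) :
    ∫ θ in (0 : ℝ)..2 * π, G (Complex.exp (θ * Complex.I)) = 0 := by
  have hqpos := norm_pos_iff.mpr hq0
  have hR : (1 : ℝ) ≤ ‖q‖⁻¹ := (one_le_inv₀ hqpos).mpr hq.le
  have key := Complex.circleIntegral_sub_center_inv_smul_eq_of_differentiable_on_annulus_off_countable
    (c := 0) (r := 1) (R := ‖q‖⁻¹) one_pos hR (f := G) Set.countable_empty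
    (fun w hw => (hG w (by simpa using hw.2) (by simpa using hw.1)).continuousAt.continuousWithinAt)
    (fun w hw => hG w (by have := hw.1.2; simp at this; exact this.le)
      (by have := hw.1.1; simp at this; exact this.le))
  have hcirc : ∀ R : ℝ, 0 < R → (∮ z in C(0, R), (z - 0)⁻¹ • G z) =
      Complex.I * ∫ θ in (0 : ℝ)..2 * π, G (R * Complex.exp (θ * Complex.I)) := by
    intro R hR
    have hR0 : (R : ℂ) ≠ 0 := Complex.ofReal_ne_zero.mpr hR.ne'
    rw [circleIntegral, ← intervalIntegral.integral_const_mul]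
    refine intervalIntegral.integral_congr fun θ _ => ?_
    have h0 := Complex.exp_ne_zero (θ * Complex.I)
    simp only [deriv_circleMap, circleMap, zero_add, sub_zero, smul_eq_mul]
    field_simp
  rw [hcirc _ one_pos, hcirc _ (by positivity)] at key
  have key := mul_left_cancel₀ Complex.I_ne_zero key
  simp only [Complex.ofReal_one, one_mul] at key
  set f : ℝ → ℂ := fun θ => G (((‖q‖⁻¹ : ℝ) : ℂ) * Complex.exp (θ * Complex.I)) with hf
  have hper : Function.Periodic f (2 * π) := by
    intro θ
    simp only [hf]
    congr 2
    push_cast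
    rw [add_mul]
    exact Complex.exp_periodic _
  -- The point 1/(q e^{iθ}) has modulus |q|⁻¹ and argument -arg q - θ.
  have h1 : ∀ θ : ℝ, f (-q.arg - θ) = -G (Complex.exp (θ * Complex.I)) := by
    intro θ
    rw [← hrefl _ (Complex.exp_ne_zero _)]
    simp only [hf]
    congr 1
    rw [mul_inv, ← Complex.exp_neg]
    conv_rhs => rw [← Complex.norm_mul_exp_arg_mul_I q, mul_inv, ← Complex.exp_neg]
    rw [mul_assoc, ← Complex.exp_add]
    push_cast
    ring_nf
  have h2 : ∫ θ in (0 : ℝ)..2 * π, f (-q.arg - θ) = ∫ θ in (0 : ℝ)..2 * π, f θ := by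
    rw [intervalIntegral.integral_comp_sub_left]
    have := hper.intervalIntegral_add_eq (-q.arg - 2 * π) 0
    rw [zero_add] at this
    rw [← this]
    congr 1
    ring
  rw [intervalIntegral.integral_congr fun θ _ => h1 θ, intervalIntegral.integral_neg] at h2
  change _ = intervalIntegral f 0 (2 * π) MeasureTheory.volume at h2
  rw [key] at h2
  linear_combination (-1 / 2 : ℂ) * h2

/-! ### The regular one-variable integrand -/

/-- The product of `fPlus` and of the part of `Psi` that depends on `w`, all poles cancelled. -/
def gKernel {n : ℕ} (p q t : ℂ) (β : Fin 6 → ℂ) (y : Fin n → ℂ) (w : ℂ) : ℂ :=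
  w⁻¹ * theta (w ^ 2)⁻¹ q *
    (∏ m, ellGamma (q * (β m * w)) p q * ellGamma (β m * w⁻¹) p q) *
    ∏ k, ellGamma (q * (t * w * y k)) p q * ellGamma (q * (t * w * (y k)⁻¹)) p q *
      (ellGamma (t * w⁻¹ * y k) p q * ellGamma (t * w⁻¹ * (y k)⁻¹) p q) * pairTheta w⁻¹ (y k) q

/-- The map w ↦ 1/(qw) exchanges Γ(qcw) with Γ(cw⁻¹) in every pair and preserves the factors θ(w⁻¹
y^{±1}; q); the sign comes from w⁻¹ θ(w⁻²; q). -/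
theorem gKernel_reflection {n : ℕ} {p q t : ℂ} (hq : ‖q‖ < 1) (hq0 : q ≠ 0) (β : Fin 6 → ℂ)
    {y : Fin n → ℂ} (hy : ∀ k, y k ≠ 0) {w : ℂ} (hw : w ≠ 0) :
    gKernel p q t β y (q * w)⁻¹ = -gKernel p q t β y w := by
  rw [gKernel, gKernel]
  have e1 : ∀ u : ℂ, q * (u * (q * w)⁻¹) = u * w⁻¹ := fun u => by field_simp
  have e2 : ∀ u : ℂ, u * (q * w) = q * (u * w) := fun u => by ring
  have e3 : ∀ u : ℂ, q * (t * (q * w)⁻¹ * u) = t * w⁻¹ * u := fun u => by field_simp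
  have e4 : ∀ u : ℂ, q * (t * w) * u = q * (t * w * u) := fun u => by ring
  simp only [inv_inv, e1, e2, e3, e4]
  have h0 : (q * w) * theta (((q * w)⁻¹ ^ 2)⁻¹) q = -(w⁻¹ * theta (w ^ 2)⁻¹ q) := by
    rw [inv_pow, inv_inv, theta_sq_mul_base hq hq0 hw, theta_inv hq (pow_ne_zero 2 hw)]
    generalize theta (w ^ 2) q = A
    field_simp
  have h1 : ∀ k, pairTheta (q * w) (y k) q = pairTheta w⁻¹ (y k) q := fun k => by
    rw [pairTheta_mul_base_left hq hq0 hw (hy k), pairTheta_inv_left hq hw (hy k)]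
  rw [h0]
  simp only [h1]
  have h2 : ∀ m, ellGamma (β m * w⁻¹) p q * ellGamma (q * (β m * w)) p q =
      ellGamma (q * (β m * w)) p q * ellGamma (β m * w⁻¹) p q := fun m => mul_comm _ _
  have h3 : ∀ k, ellGamma (t * w⁻¹ * y k) p q * ellGamma (t * w⁻¹ * (y k)⁻¹) p q *
      (ellGamma (q * (t * w * y k)) p q * ellGamma (q * (t * w * (y k)⁻¹)) p q) =
      ellGamma (q * (t * w * y k)) p q * ellGamma (q * (t * w * (y k)⁻¹)) p q *
      (ellGamma (t * w⁻¹ * y k) p q * ellGamma (t * w⁻¹ * (y k)⁻¹) p q) := fun k => mul_comm _ _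
  simp only [h2, h3]
  ring

theorem differentiableAt_ellGamma_comp {p q : ℂ} (hp : ‖p‖ < 1) (hq : ‖q‖ < 1) {f : ℂ → ℂ} {w : ℂ}
    (hf : DifferentiableAt ℂ f w) (h0 : f w ≠ 0) (h1 : ‖f w‖ < 1) :
    DifferentiableAt ℂ (fun w => ellGamma (f w) p q) w :=
  DifferentiableAt.comp (f := f) (g := fun u => ellGamma u p q) w
    (differentiableAt_ellGamma hp hq h0 h1) hf

/-- On 1 ≤ |w| ≤ |q|⁻¹ both qcw and cw⁻¹ have modulus less than 1 when |c| < 1, so no elliptic gamma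
factor has a pole. -/
theorem differentiableAt_gKernel {n : ℕ} {p q t : ℂ} (hp : ‖p‖ < 1) (hq : ‖q‖ < 1) (hq0 : q ≠ 0)
    (ht0 : t ≠ 0) (ht : ‖t‖ < 1) {β : Fin 6 → ℂ} (hβ0 : ∀ m, β m ≠ 0) (hβ : ∀ m, ‖β m‖ < 1)
    {y : Fin n → ℂ} (hy : ∀ k, ‖y k‖ = 1) {w : ℂ} (hw : 1 ≤ ‖w‖) (hw' : ‖w‖ ≤ ‖q‖⁻¹) :
    DifferentiableAt ℂ (gKernel p q t β y) w := by
  have hw0 : w ≠ 0 := norm_pos_iff.mp (one_pos.trans_le hw)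
  have hy0 : ∀ k, y k ≠ 0 := fun k => norm_pos_iff.mp (by rw [hy k]; exact one_pos)
  have hqpos := norm_pos_iff.mpr hq0
  have hqw : ‖q‖ * ‖w‖ ≤ 1 := by
    calc ‖q‖ * ‖w‖ ≤ ‖q‖ * ‖q‖⁻¹ := by gcongr
      _ = 1 := mul_inv_cancel₀ hqpos.ne'
  have hwi : ‖w‖⁻¹ ≤ 1 := inv_le_one_of_one_le₀ hw
  have hA : ∀ {c v : ℂ}, ‖c‖ < 1 → ‖v‖ = 1 → ‖q * (c * w * v)‖ < 1 := fun {c v} hc hv => by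
    rw [norm_mul, norm_mul, norm_mul, hv]
    nlinarith [norm_nonneg c, norm_nonneg w]
  have hB : ∀ {c v : ℂ}, ‖c‖ < 1 → ‖v‖ = 1 → ‖c * w⁻¹ * v‖ < 1 := fun {c v} hc hv => by
    rw [norm_mul, norm_mul, norm_inv, hv]
    nlinarith [norm_nonneg c, inv_nonneg.mpr (norm_nonneg w)]
  have hdi : DifferentiableAt ℂ (fun w : ℂ => w⁻¹) w := differentiableAt_inv hw0
  have hw2 : w ^ 2 ≠ 0 := pow_ne_zero 2 hw0
  have gA : ∀ {c v : ℂ}, ‖c‖ < 1 → c ≠ 0 → ‖v‖ = 1 →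
      DifferentiableAt ℂ (fun w => ellGamma (q * (c * w * v)) p q) w := fun {c v} hc hc0 hv =>
    differentiableAt_ellGamma_comp hp hq (f := fun w => q * (c * w * v)) (by fun_prop)
      (mul_ne_zero hq0 (mul_ne_zero (mul_ne_zero hc0 hw0)
        (norm_pos_iff.mp (by rw [hv]; exact one_pos)))) (hA hc hv)
  have gB : ∀ {c v : ℂ}, ‖c‖ < 1 → c ≠ 0 → ‖v‖ = 1 →
      DifferentiableAt ℂ (fun w => ellGamma (c * w⁻¹ * v) p q) w := fun {c v} hc hc0 hv =>
    differentiableAt_ellGamma_comp hp hq (f := fun w => c * w⁻¹ * v)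
      ((hdi.const_mul c).mul_const v)
      (mul_ne_zero (mul_ne_zero hc0 (inv_ne_zero hw0))
        (norm_pos_iff.mp (by rw [hv]; exact one_pos))) (hB hc hv)
  have gA' : ∀ {c : ℂ}, ‖c‖ < 1 → c ≠ 0 →
      DifferentiableAt ℂ (fun w => ellGamma (q * (c * w)) p q) w := fun {c} hc hc0 => by
    simpa only [mul_one] using gA hc hc0 (norm_one (α := ℂ))
  have gB' : ∀ {c : ℂ}, ‖c‖ < 1 → c ≠ 0 →
      DifferentiableAt ℂ (fun w => ellGamma (c * w⁻¹) p q) w := fun {c} hc hc0 => by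
    simpa only [mul_one] using gB hc hc0 (norm_one (α := ℂ))
  have hth : DifferentiableAt ℂ (fun w => theta (w ^ 2)⁻¹ q) w :=
    DifferentiableAt.comp (f := fun w => (w ^ 2)⁻¹) (g := fun u => theta u q) w
      (differentiableAt_theta hq (inv_ne_zero hw2)) (by fun_prop (disch := assumption))
  have hpair : ∀ k, DifferentiableAt ℂ (fun w => pairTheta w⁻¹ (y k) q) w := fun k =>
    DifferentiableAt.comp (f := fun w => w⁻¹) (g := fun u => pairTheta u (y k) q) w
      (differentiableAt_pairTheta_left hq (inv_ne_zero hw0) (hy0 k)) hdi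
  have hyi : ∀ k, ‖(y k)⁻¹‖ = 1 := fun k => by rw [norm_inv, hy, inv_one]
  exact ((hdi.fun_mul hth).fun_mul (DifferentiableAt.fun_finsetProd fun m _ =>
    (gA' (hβ m) (hβ0 m)).fun_mul (gB' (hβ m) (hβ0 m)))).fun_mul
    (DifferentiableAt.fun_finsetProd fun k _ =>
      (((gA ht ht0 (hy k)).fun_mul (gA ht ht0 (hyi k))).fun_mul
        ((gB ht ht0 (hy k)).fun_mul (gB ht ht0 (hyi k)))).fun_mul (hpair k))

theorem integral_gKernel {n : ℕ} {p q t : ℂ} (hp : ‖p‖ < 1) (hq : ‖q‖ < 1) (hq0 : q ≠ 0)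
    (ht0 : t ≠ 0) (ht : ‖t‖ < 1) {β : Fin 6 → ℂ} (hβ0 : ∀ m, β m ≠ 0) (hβ : ∀ m, ‖β m‖ < 1)
    {y : Fin n → ℂ} (hy : ∀ k, ‖y k‖ = 1) :
    ∫ θ in (0 : ℝ)..2 * π, gKernel p q t β y (Complex.exp (θ * Complex.I)) = 0 :=
  integral_circle_eq_zero_of_reflection hq hq0
    (fun _ hw hw' => differentiableAt_gKernel hp hq hq0 ht0 ht hβ0 hβ hy hw hw')
    (fun _ hw => gKernel_reflection hq hq0 β
      (fun k => norm_pos_iff.mp (by rw [hy k]; exact one_pos)) hw)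

theorem integral_gKernel_inv {n : ℕ} {p q t : ℂ} (hp : ‖p‖ < 1) (hq : ‖q‖ < 1) (hq0 : q ≠ 0)
    (ht0 : t ≠ 0) (ht : ‖t‖ < 1) {β : Fin 6 → ℂ} (hβ0 : ∀ m, β m ≠ 0) (hβ : ∀ m, ‖β m‖ < 1)
    {y : Fin n → ℂ} (hy : ∀ k, ‖y k‖ = 1) :
    ∫ θ in (0 : ℝ)..2 * π, gKernel p q t β y (Complex.exp (θ * Complex.I))⁻¹ = 0 := by
  let f : ℝ → ℂ := fun θ => gKernel p q t β y (Complex.exp (θ * Complex.I))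
  have hper : Function.Periodic f (2 * π) := by
    intro θ
    simp only [f]
    congr 1
    push_cast
    rw [add_mul]
    exact Complex.exp_periodic _
  have h1 : ∀ θ : ℝ, gKernel p q t β y (Complex.exp (θ * Complex.I))⁻¹ = f (0 - θ) := fun θ => by
    simp only [f]
    rw [← Complex.exp_neg]
    push_cast
    ring_nf
  rw [intervalIntegral.integral_congr fun θ _ => h1 θ, intervalIntegral.integral_comp_sub_left]
  have := hper.intervalIntegral_add_eq (0 - 2 * π) 0
  rw [zero_add] at this
  rw [← integral_gKernel hp hq hq0 ht0 ht hβ0 hβ hy, ← this]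
  congr 1
  ring

/-! ### The structure of the weight function -/

/-- The factor of `Psi` that depends on one variable. -/
def psiOne (p q : ℂ) (β : Fin 6 → ℂ) (w : ℂ) : ℂ :=
  (∏ m, ellGammaPM (β m) w p q) / ellGammaPM 1 (w ^ 2) p q

/-- The factor of `Psi` that depends on two variables. -/
def psiTwo (p q t u v : ℂ) : ℂ := ellGammaPMPM t u v p q / ellGammaPMPM 1 u v p q

theorem psiOne_inv (p q : ℂ) (β : Fin 6 → ℂ) (w : ℂ) : psiOne p q β w⁻¹ = psiOne p q β w := by
  simp only [psiOne, ellGammaPM, inv_pow, inv_inv]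
  rw [mul_comm (ellGamma (1 * (w ^ 2)⁻¹) p q)]
  congr 1
  exact Finset.prod_congr rfl fun m _ => mul_comm _ _

theorem ellGammaPMPM_inv (c u v p q : ℂ) :
    ellGammaPMPM c u⁻¹ v p q = ellGammaPMPM c u v p q := by
  simp only [ellGammaPMPM, inv_inv]
  ring

theorem ellGammaPMPM_comm (c u v p q : ℂ) :
    ellGammaPMPM c u v p q = ellGammaPMPM c v u p q := by
  rw [ellGammaPMPM, ellGammaPMPM, mul_right_comm c u, mul_right_comm c u, mul_right_comm c u⁻¹,
    mul_right_comm c u⁻¹]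
  ring

theorem psiTwo_inv (p q t u v : ℂ) : psiTwo p q t u⁻¹ v = psiTwo p q t u v := by
  rw [psiTwo, psiTwo, ellGammaPMPM_inv, ellGammaPMPM_inv]

theorem psiTwo_comm (p q t u v : ℂ) : psiTwo p q t u v = psiTwo p q t v u := by
  rw [psiTwo, psiTwo, ellGammaPMPM_comm, ellGammaPMPM_comm 1]

theorem Psi_eq {n : ℕ} (p q t : ℂ) (β : Fin 6 → ℂ) (z : Fin n → ℂ) :
    Psi p q t β z = (∏ i, psiOne p q β (z i)) *
      ∏ j, ∏ k ∈ Finset.Ioi j, psiTwo p q t (z j) (z k) := rfl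

/-- By symmetry of f the pairs that contain i may all be written with i first. This isolates one
variable of the weight. -/
theorem prod_pairs_succAbove {n : ℕ} (i : Fin (n + 1)) {f : Fin (n + 1) → Fin (n + 1) → ℂ}
    (hf : ∀ j k, f j k = f k j) :
    ∏ j, ∏ k ∈ Finset.Ioi j, f j k = (∏ k, f i (i.succAbove k)) *
      ∏ j, ∏ k ∈ Finset.Ioi j, f (i.succAbove j) (i.succAbove k) := by
  have h : ∀ {N : ℕ} (g : Fin N → Fin N → ℂ) (j : Fin N),
      ∏ k ∈ Finset.Ioi j, g j k = ∏ k, if j < k then g j k else 1 := fun g j => by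
    rw [← Finset.prod_filter]
    congr 1
    ext k
    simp
  have hR := Finset.prod_congr (s₁ := Finset.univ) rfl
    fun j _ => h (fun j k => f (i.succAbove j) (i.succAbove k)) j
  rw [hR, Finset.prod_congr rfl fun j _ => h f j, Fin.prod_univ_succAbove _ i]
  simp only [Fin.prod_univ_succAbove _ i, lt_self_iff_false, if_false, one_mul,
    Fin.succAbove_lt_succAbove_iff, Finset.prod_mul_distrib]
  rw [← mul_assoc, ← Finset.prod_mul_distrib]
  congr 1
  refine Finset.prod_congr rfl fun k _ => ?_
  rcases lt_or_gt_of_ne (Fin.succAbove_ne i k) with hk | hk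
  · rw [if_neg hk.not_gt, if_pos hk, one_mul, hf]
  · rw [if_pos hk, if_neg hk.not_gt, mul_one]

theorem Psi_succAbove {n : ℕ} (p q t : ℂ) (β : Fin 6 → ℂ) (z : Fin (n + 1) → ℂ) (i : Fin (n + 1)) :
    Psi p q t β z = (psiOne p q β (z i) * ∏ k, psiTwo p q t (z i) (z (i.succAbove k))) *
      Psi p q t β (fun k => z (i.succAbove k)) := by
  rw [Psi_eq, Psi_eq, prod_pairs_succAbove i (f := fun j k => psiTwo p q t (z j) (z k))
    (fun j k => psiTwo_comm _ _ _ _ _), Fin.prod_univ_succAbove _ i]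
  ring

theorem norm_ne_zero_of_eq_one {u : ℂ} (hu : ‖u‖ = 1) : u ≠ 0 :=
  norm_pos_iff.mp (by rw [hu]; exact one_pos)

section

variable {p q t : ℂ} {β : Fin 6 → ℂ} (hp : ‖p‖ < 1) (hq : ‖q‖ < 1)

include hp hq

theorem psiOne_eq {w : ℂ} (hw : ‖w‖ = 1) :
    psiOne p q β w = (∏ m, ellGamma (β m * w) p q * ellGamma (β m * w⁻¹) p q) *
      (theta (w ^ 2) p * theta (w ^ 2)⁻¹ q) := by
  rw [psiOne, div_eq_mul_inv, ellGammaPM, one_mul, one_mul,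
    inv_ellGamma_mul_ellGamma_inv hp hq (by rw [norm_pow, hw, one_pow])]
  rfl

theorem psiTwo_eq {u v : ℂ} (hu : ‖u‖ = 1) (hv : ‖v‖ = 1) :
    psiTwo p q t u v = ellGamma (t * u * v) p q * ellGamma (t * u * v⁻¹) p q *
      (ellGamma (t * u⁻¹ * v) p q * ellGamma (t * u⁻¹ * v⁻¹) p q) *
      (pairTheta u v p * pairTheta u⁻¹ v q) := by
  have h1 := inv_ellGamma_mul_ellGamma_inv hp hq (u := u * v) (by rw [norm_mul, hu, hv, one_mul])
  have h2 := inv_ellGamma_mul_ellGamma_inv hp hq (u := u * v⁻¹)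
    (by rw [norm_mul, norm_inv, hu, hv, inv_one, one_mul])
  rw [mul_inv u] at h1
  rw [mul_inv u, inv_inv] at h2
  have h3 : (ellGammaPMPM 1 u v p q)⁻¹ = pairTheta u v p * pairTheta u⁻¹ v q := by
    simp only [ellGammaPMPM, one_mul]
    rw [pairTheta, pairTheta, div_eq_mul_inv, div_eq_mul_inv]
    have h4 : ∀ A B C D : ℂ, (A * B * C * D)⁻¹ = (A * D)⁻¹ * (B * C)⁻¹ := fun A B C D => by
      rw [← mul_inv]; congr 1; ring
    rw [h4, h1, h2]
    ring
  rw [psiTwo, div_eq_mul_inv, h3, ellGammaPMPM]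
  ring

theorem psiOne_update (hq0 : q ≠ 0) {m : Fin 6} (hβ0 : β m ≠ 0) (hβ : ‖β m‖ < 1) {w : ℂ}
    (hw : ‖w‖ = 1) :
    psiOne p q (Function.update β m (q * β m)) w = psiOne p q β w * pairTheta (β m) w p := by
  have hw0 := norm_ne_zero_of_eq_one hw
  have h1 : ‖β m * w‖ < 1 := by rw [norm_mul, hw, mul_one]; exact hβ
  have h2 : ‖β m * w⁻¹‖ < 1 := by rw [norm_mul, norm_inv, hw, inv_one, mul_one]; exact hβ
  have h3 : ellGammaPM (q * β m) w p q = ellGammaPM (β m) w p q * pairTheta (β m) w p := by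
    rw [ellGammaPM, ellGammaPM, mul_assoc q, mul_assoc q,
      ellGamma_mul_base hp hq hq0 (mul_ne_zero hβ0 hw0) h1,
      ellGamma_mul_base hp hq hq0 (mul_ne_zero hβ0 (inv_ne_zero hw0)) h2, pairTheta,
      div_eq_mul_inv (β m)]
    ring
  rw [psiOne, psiOne, ← Finset.mul_prod_erase _ _ (Finset.mem_univ m),
    ← Finset.mul_prod_erase _ (fun m => ellGammaPM (β m) w p q) (Finset.mem_univ m),
    Finset.prod_congr rfl fun j hj => by rw [Function.update_of_ne (Finset.ne_of_mem_erase hj)],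
    Function.update_self, h3]
  ring

theorem Psi_update (hq0 : q ≠ 0) {m : Fin 6} (hβ0 : β m ≠ 0) (hβ : ‖β m‖ < 1) {n : ℕ}
    {z : Fin n → ℂ} (hz : ∀ i, ‖z i‖ = 1) :
    Psi p q t (Function.update β m (q * β m)) z =
      Psi p q t β z * ∏ i, pairTheta (β m) (z i) p := by
  rw [Psi_eq, Psi_eq, Finset.prod_congr rfl fun i _ => psiOne_update hp hq hq0 hβ0 hβ (hz i),
    Finset.prod_mul_distrib]
  ring

/-- The poles of `fPlus` cancel against the zeros of the weight function. -/
theorem fPlus_mul_psi (hq0 : q ≠ 0) (ht0 : t ≠ 0) (ht : ‖t‖ < 1)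
    (hβ0 : ∀ m, β m ≠ 0) (hβ : ∀ m, ‖β m‖ < 1) {n : ℕ} {y : Fin n → ℂ} (hy : ∀ k, ‖y k‖ = 1)
    (hinj : Function.Injective y) {w : ℂ} (hw : ‖w‖ = 1)
    (hD : denom p (Finset.univ.image y) w ≠ 0) :
    fPlus p t β (Finset.univ.image y) w * (psiOne p q β w * ∏ k, psiTwo p q t w (y k)) =
      gKernel p q t β y w := by
  have hw0 := norm_ne_zero_of_eq_one hw
  -- The numerator thetas of `fPlus` raise the arguments of the gamma factors by q; its denominator
  -- is cancelled by the p-theta part of the reciprocal gamma factors.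
  have hA : ∀ {c v : ℂ}, ‖c‖ < 1 → c ≠ 0 → ‖v‖ = 1 →
      ellGamma (q * (c * w * v)) p q = theta (c * w * v) p * ellGamma (c * w * v) p q :=
    fun {c v} hc hc0 hv => ellGamma_mul_base hp hq hq0
      (mul_ne_zero (mul_ne_zero hc0 hw0) (norm_ne_zero_of_eq_one hv))
      (by rw [norm_mul, norm_mul, hw, hv, mul_one, mul_one]; exact hc)
  have h1 : ∀ m, ellGamma (q * (β m * w)) p q * ellGamma (β m * w⁻¹) p q =
      theta (β m * w) p * (ellGamma (β m * w) p q * ellGamma (β m * w⁻¹) p q) := fun m => by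
    have := hA (hβ m) (hβ0 m) (norm_one (α := ℂ))
    rw [mul_one] at this
    rw [this, mul_assoc]
  have h2 : ∀ k, ellGamma (q * (t * w * y k)) p q * ellGamma (q * (t * w * (y k)⁻¹)) p q *
      (ellGamma (t * w⁻¹ * y k) p q * ellGamma (t * w⁻¹ * (y k)⁻¹) p q) * pairTheta w⁻¹ (y k) q =
      pairTheta (t * w) (y k) p * (ellGamma (t * w * y k) p q * ellGamma (t * w * (y k)⁻¹) p q *
      (ellGamma (t * w⁻¹ * y k) p q * ellGamma (t * w⁻¹ * (y k)⁻¹) p q) * pairTheta w⁻¹ (y k) q) :=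
    fun k => by
      rw [hA ht ht0 (hy k), hA ht ht0 (by rw [norm_inv, hy, inv_one]), 
        show pairTheta (t * w) (y k) p = theta (t * w * y k) p * theta (t * w * (y k)⁻¹) p by
          rw [pairTheta, div_eq_mul_inv (t * w)]]
      ring
  have hi : ∀ f : ℂ → ℂ, ∏ v ∈ Finset.univ.image y, f v = ∏ k, f (y k) := fun f =>
    Finset.prod_image fun i _ j _ e => hinj e
  rw [gKernel, Finset.prod_congr rfl fun m _ => h1 m, Finset.prod_congr rfl fun k _ => h2 k,
    psiOne_eq hp hq hw, Finset.prod_congr rfl fun k _ => psiTwo_eq hp hq hw (hy k),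
    Finset.prod_mul_distrib (f := fun m => theta (β m * w) p),
    Finset.prod_mul_distrib (f := fun k => pairTheta (t * w) (y k) p)]
  have h3 : ∏ k, ellGamma (t * w * y k) p q * ellGamma (t * w * (y k)⁻¹) p q *
      (ellGamma (t * w⁻¹ * y k) p q * ellGamma (t * w⁻¹ * (y k)⁻¹) p q) *
      (pairTheta w (y k) p * pairTheta w⁻¹ (y k) q) =
      (∏ k, pairTheta w (y k) p) *
      ∏ k, ellGamma (t * w * y k) p q * ellGamma (t * w * (y k)⁻¹) p q *
      (ellGamma (t * w⁻¹ * y k) p q * ellGamma (t * w⁻¹ * (y k)⁻¹) p q) * pairTheta w⁻¹ (y k) q := by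
    rw [← Finset.prod_mul_distrib]
    exact Finset.prod_congr rfl fun k _ => by ring
  rw [h3]
  rw [fPlus, fNum]
  rw [denom] at hD ⊢
  simp only [hi] at hD ⊢
  generalize theta (w ^ 2) p = X1 at *
  generalize ∏ k, pairTheta w (y k) p = X2 at *
  rw [div_mul_eq_mul_div, div_eq_iff hD]
  ring

/-! ### Continuity -/

variable {X : Type*} [TopologicalSpace X]

theorem continuous_ellGamma_comp {f : X → ℂ} (hf : Continuous f) (h0 : ∀ x, f x ≠ 0)
    (h1 : ∀ x, ‖f x‖ < 1) : Continuous fun x => ellGamma (f x) p q :=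
  continuous_iff_continuousAt.mpr fun x =>
    ContinuousAt.comp (g := fun u => ellGamma u p q) (f := f)
      (differentiableAt_ellGamma hp hq (h0 x) (h1 x)).continuousAt hf.continuousAt

omit hq in
theorem continuous_theta_comp {f : X → ℂ} (hf : Continuous f) (h0 : ∀ x, f x ≠ 0) :
    Continuous fun x => theta (f x) p :=
  continuous_iff_continuousAt.mpr fun x =>
    ContinuousAt.comp (g := fun u => theta u p) (f := f)
      (differentiableAt_theta hp (h0 x)).continuousAt hf.continuousAt

omit hq in
theorem continuous_pairTheta_comp {f g : X → ℂ} (hf : Continuous f) (hg : Continuous g)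
    (h0 : ∀ x, f x ≠ 0) (h1 : ∀ x, g x ≠ 0) : Continuous fun x => pairTheta (f x) (g x) p :=
  (continuous_theta_comp hp (hf.mul hg) fun x => mul_ne_zero (h0 x) (h1 x)).mul
    (continuous_theta_comp hp (hf.div hg h1) fun x => div_ne_zero (h0 x) (h1 x))

theorem continuous_Psi (ht0 : t ≠ 0) (ht : ‖t‖ < 1) {n : ℕ} {b : X → Fin 6 → ℂ} {z : X → Fin n → ℂ}
    (hb : Continuous b) (hz : Continuous z) (hb0 : ∀ x m, b x m ≠ 0) (hb1 : ∀ x m, ‖b x m‖ < 1)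
    (hz1 : ∀ x i, ‖z x i‖ = 1) : Continuous fun x => Psi p q t (b x) (z x) := by
  have hz0 : ∀ x i, z x i ≠ 0 := fun x i => norm_ne_zero_of_eq_one (hz1 x i)
  have cz : ∀ i, Continuous fun x => z x i := fun i => (continuous_apply i).comp hz
  have czi : ∀ i, Continuous fun x => (z x i)⁻¹ := fun i => (cz i).inv₀ fun x => hz0 x i
  have cb : ∀ m, Continuous fun x => b x m := fun m => (continuous_apply m).comp hb
  have hz1i : ∀ x i, ‖(z x i)⁻¹‖ = 1 := fun x i => by rw [norm_inv, hz1, inv_one]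
  have hzi : ∀ x i, (z x i)⁻¹ ≠ 0 := fun x i => inv_ne_zero (hz0 x i)
  have gam : ∀ {c u v : X → ℂ}, Continuous c → Continuous u → Continuous v → (∀ x, c x ≠ 0) →
      (∀ x, ‖c x‖ < 1) → (∀ x, ‖u x‖ = 1) → (∀ x, ‖v x‖ = 1) →
      Continuous fun x => ellGamma (c x * u x * v x) p q :=
    fun {c u v} hc hu hv hc0 hc1 hu1 hv1 => continuous_ellGamma_comp hp hq ((hc.mul hu).mul hv)
      (fun x => mul_ne_zero (mul_ne_zero (hc0 x) (norm_ne_zero_of_eq_one (hu1 x)))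
        (norm_ne_zero_of_eq_one (hv1 x)))
      (fun x => by rw [norm_mul, norm_mul, hu1, hv1, mul_one, mul_one]; exact hc1 x)
  have gam' : ∀ {c u : X → ℂ}, Continuous c → Continuous u → (∀ x, c x ≠ 0) →
      (∀ x, ‖c x‖ < 1) → (∀ x, ‖u x‖ = 1) → Continuous fun x => ellGamma (c x * u x) p q :=
    fun {c u} hc hu hc0 hc1 hu1 => by
      simpa using gam hc hu (continuous_const (y := (1 : ℂ))) hc0 hc1 hu1 (fun _ => norm_one)
  -- On the torus the reciprocal gamma factors are theta functions, so this form has no division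
  -- left that could spoil continuity. Joint continuity in the parameters is needed for the
  -- deformation argument.
  have hPsi : (fun x => Psi p q t (b x) (z x)) = fun x => (∏ i,
      (∏ m, ellGamma (b x m * z x i) p q * ellGamma (b x m * (z x i)⁻¹) p q) *
        (theta (z x i ^ 2) p * theta (z x i ^ 2)⁻¹ q)) *
      ∏ j, ∏ k ∈ Finset.Ioi j, ellGamma (t * z x j * z x k) p q * ellGamma (t * z x j * (z x k)⁻¹) p q *
      (ellGamma (t * (z x j)⁻¹ * z x k) p q * ellGamma (t * (z x j)⁻¹ * (z x k)⁻¹) p q) *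
      (pairTheta (z x j) (z x k) p * pairTheta (z x j)⁻¹ (z x k) q) := by
    funext x
    rw [Psi_eq, Finset.prod_congr rfl fun i _ => psiOne_eq hp hq (hz1 x i),
      Finset.prod_congr rfl fun j _ => Finset.prod_congr rfl fun k _ =>
        psiTwo_eq hp hq (hz1 x j) (hz1 x k)]
  rw [hPsi]
  refine (continuous_finsetProd _ fun i _ => (continuous_finsetProd _ fun m _ => ?_).mul ?_).mul
    (continuous_finsetProd _ fun j _ => continuous_finsetProd _ fun k _ => ?_)
  · exact (gam' (cb m) (cz i) (fun x => hb0 x m) (fun x => hb1 x m) fun x => hz1 x i).mul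
      (gam' (cb m) (czi i) (fun x => hb0 x m) (fun x => hb1 x m) fun x => hz1i x i)
  · exact (continuous_theta_comp hp ((cz i).pow 2) fun x => pow_ne_zero 2 (hz0 x i)).mul
      (continuous_theta_comp hq (((cz i).pow 2).inv₀ fun x => pow_ne_zero 2 (hz0 x i))
        fun x => inv_ne_zero (pow_ne_zero 2 (hz0 x i)))
  · have ct := continuous_const (X := X) (y := t)
    exact (((gam ct (cz j) (cz k) (fun _ => ht0) (fun _ => ht) (hz1 · j) (hz1 · k)).mul
      (gam ct (cz j) (czi k) (fun _ => ht0) (fun _ => ht) (hz1 · j) (hz1i · k))).mul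
      ((gam ct (czi j) (cz k) (fun _ => ht0) (fun _ => ht) (hz1i · j) (hz1 · k)).mul
      (gam ct (czi j) (czi k) (fun _ => ht0) (fun _ => ht) (hz1i · j) (hz1i · k)))).mul
      ((continuous_pairTheta_comp hp (cz j) (cz k) (hz0 · j) (hz0 · k)).mul
      (continuous_pairTheta_comp hq (czi j) (cz k) (hzi · j) (hz0 · k)))

theorem continuous_gKernel (hq0 : q ≠ 0) (ht0 : t ≠ 0) (ht : ‖t‖ < 1) (hβ0 : ∀ m, β m ≠ 0)
    (hβ : ∀ m, ‖β m‖ < 1) {n : ℕ} {y : X → Fin n → ℂ} {w : X → ℂ} (hy : ∀ k, Continuous fun x => y x k)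
    (hw : Continuous w) (hy1 : ∀ x k, ‖y x k‖ = 1) (hw1 : ∀ x, ‖w x‖ = 1) :
    Continuous fun x => gKernel p q t β (y x) (w x) := by
  have hw0 : ∀ x, w x ≠ 0 := fun x => norm_ne_zero_of_eq_one (hw1 x)
  have hy0 : ∀ k x, y x k ≠ 0 := fun k x => norm_ne_zero_of_eq_one (hy1 x k)
  have cwi : Continuous fun x => (w x)⁻¹ := hw.inv₀ hw0
  have cyi : ∀ k, Continuous fun x => (y x k)⁻¹ := fun k => (hy k).inv₀ (hy0 k)
  have hw1i : ∀ x, ‖(w x)⁻¹‖ = 1 := fun x => by rw [norm_inv, hw1, inv_one]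
  have hy1i : ∀ k x, ‖(y x k)⁻¹‖ = 1 := fun k x => by rw [norm_inv, hy1, inv_one]
  have gam : ∀ {c : ℂ} {u v : X → ℂ}, Continuous u → Continuous v → c ≠ 0 → ‖c‖ < 1 →
      (∀ x, ‖u x‖ = 1) → (∀ x, ‖v x‖ = 1) →
      Continuous fun x => ellGamma (c * u x * v x) p q :=
    fun {c u v} hu hv hc0 hc1 hu1 hv1 => continuous_ellGamma_comp hp hq
      ((continuous_const.mul hu).mul hv)
      (fun x => mul_ne_zero (mul_ne_zero hc0 (norm_ne_zero_of_eq_one (hu1 x)))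
        (norm_ne_zero_of_eq_one (hv1 x)))
      (fun x => by rw [norm_mul, norm_mul, hu1, hv1, mul_one, mul_one]; exact hc1)
  have gam' : ∀ {c : ℂ} {u : X → ℂ}, Continuous u → c ≠ 0 → ‖c‖ < 1 → (∀ x, ‖u x‖ = 1) →
      Continuous fun x => ellGamma (c * u x) p q :=
    fun {c u} hu hc0 hc1 hu1 => by
      simpa using gam hu (continuous_const (y := (1 : ℂ))) hc0 hc1 hu1 (fun _ => norm_one)
  have hqc : ∀ {c : ℂ}, ‖c‖ < 1 → ‖q * c‖ < 1 := fun {c} hc => by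
    rw [norm_mul]; nlinarith [norm_nonneg c, norm_nonneg q]
  simp only [gKernel]
  refine ((cwi.mul ?_).mul (continuous_finsetProd _ fun m _ => ?_)).mul
    (continuous_finsetProd _ fun k _ => ?_)
  · exact continuous_theta_comp hq ((hw.pow 2).inv₀ fun x => pow_ne_zero 2 (hw0 x))
        fun x => inv_ne_zero (pow_ne_zero 2 (hw0 x))
  · simp only [← mul_assoc q]
    exact (gam' hw (mul_ne_zero hq0 (hβ0 m)) (hqc (hβ m)) hw1).mul (gam' cwi (hβ0 m) (hβ m) hw1i)
  · simp only [← mul_assoc q]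
    exact (((gam hw (hy k) (mul_ne_zero hq0 ht0) (hqc ht) hw1 (hy1 · k)).mul
      (gam hw (cyi k) (mul_ne_zero hq0 ht0) (hqc ht) hw1 (hy1i k))).mul
      ((gam cwi (hy k) ht0 ht hw1i (hy1 · k)).mul (gam cwi (cyi k) ht0 ht hw1i (hy1i k)))).mul
      (continuous_pairTheta_comp hq cwi (hy k) (fun x => inv_ne_zero (hw0 x)) (hy0 k))

end

/-! ### Averages over the torus -/

/-- The point of the torus with given angles. -/
def circ {n : ℕ} (θ : Fin n → ℝ) (i : Fin n) : ℂ := Complex.exp (θ i * Complex.I)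

theorem norm_circ {n : ℕ} (θ : Fin n → ℝ) (i : Fin n) : ‖circ θ i‖ = 1 :=
  Complex.norm_exp_ofReal_mul_I _

theorem continuous_circ (n : ℕ) : Continuous (circ (n := n)) := by
  unfold circ
  fun_prop

/-- The integral over all angles. -/
def torusAvg {n : ℕ} (E : (Fin n → ℂ) → ℂ) : ℂ :=
  ∫ θ in Set.Icc (0 : Fin n → ℝ) (fun _ => 2 * π), E (circ θ)

/-- Fubini's theorem, with the i-th angle integrated first. -/
theorem integral_Icc_eq_zero {n : ℕ} (i : Fin (n + 1)) {f : (Fin (n + 1) → ℝ) → ℂ}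
    (hf : Continuous f) (h : ∀ Θ : Fin n → ℝ, ∫ x in (0 : ℝ)..2 * π, f (i.insertNth x Θ) = 0) :
    ∫ θ in Set.Icc (0 : Fin (n + 1) → ℝ) (fun _ => 2 * π), f θ = 0 := by
  set e : ℝ × (Fin n → ℝ) ≃ᵐ (Fin (n + 1) → ℝ) :=
    (MeasurableEquiv.piFinSuccAbove (fun _ => ℝ) i).symm
  have hem : MeasureTheory.MeasurePreserving e :=
    (MeasureTheory.volume_preserving_piFinSuccAbove (fun _ : Fin (n + 1) => ℝ) i).symm _
  have heπ : (e ⁻¹' Set.Icc 0 fun _ => 2 * π) =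
      Set.Icc 0 (2 * π) ×ˢ Set.Icc (0 : Fin n → ℝ) fun _ => 2 * π :=
    ((Fin.insertNthOrderIso (fun _ => ℝ) i).preimage_Icc _ _).trans (Set.Icc_prod_eq _ _)
  have hint : MeasureTheory.IntegrableOn (fun x => f (e x))
      (Set.Icc 0 (2 * π) ×ˢ Set.Icc (0 : Fin n → ℝ) fun _ => 2 * π) := by
    have := hf.integrableOn_Icc (μ := MeasureTheory.volume) (a := (0 : Fin (n + 1) → ℝ))
      (b := fun _ => 2 * π)
    rwa [← hem.integrableOn_comp_preimage e.measurableEmbedding, heπ] at this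
  rw [← hem.map_eq, MeasureTheory.setIntegral_map_equiv, heπ]
  rw [MeasureTheory.Measure.volume_eq_prod, ← MeasureTheory.Measure.prod_restrict,
    MeasureTheory.integral_prod_symm]
  · refine MeasureTheory.integral_eq_zero_of_ae (.of_forall fun Θ => ?_)
    have := h Θ
    rw [intervalIntegral.integral_of_le Real.two_pi_pos.le,
      ← MeasureTheory.integral_Icc_eq_integral_Ioc] at this
    exact this
  · rwa [MeasureTheory.IntegrableOn, MeasureTheory.Measure.volume_eq_prod,
      ← MeasureTheory.Measure.prod_restrict] at hint

theorem circ_insertNth_self {n : ℕ} (i : Fin (n + 1)) (x : ℝ) (Θ : Fin n → ℝ) :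
    circ (i.insertNth x Θ : Fin (n + 1) → ℝ) i = Complex.exp (x * Complex.I) := by
  simp [circ]

theorem circ_insertNth_succAbove {n : ℕ} (i : Fin (n + 1)) (x : ℝ) (Θ : Fin n → ℝ) (k : Fin n) :
    circ (i.insertNth x Θ : Fin (n + 1) → ℝ) (i.succAbove k) = circ Θ k := by
  simp [circ]

/-! ### Points of the torus in general position -/

/-- No two of the numbers `z_i^{±1}` coincide. -/
def Distinct {n : ℕ} (z : Fin n → ℂ) : Prop :=
  (∀ i, z i ^ 2 ≠ 1) ∧ ∀ i j, i ≠ j → z i * z j ≠ 1 ∧ z i / z j ≠ 1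

theorem Distinct.injective {n : ℕ} {z : Fin n → ℂ} (h : Distinct z) (hz : ∀ i, z i ≠ 0) :
    Function.Injective z := by
  intro i j e
  by_contra hij
  exact (h.2 i j hij).2 (by rw [e, div_self (hz j)])

theorem countable_exp_eq_one (φ : ℝ) {e : ℝ} (he : e ≠ 0) :
    {ε : ℝ | Complex.exp (((φ + e * ε : ℝ) : ℂ) * Complex.I) = 1}.Countable := by
  refine (Set.countable_range fun k : ℤ => (2 * π * k - φ) / e).mono ?_
  intro ε hε
  obtain ⟨k, hk⟩ := Complex.exp_eq_one_iff.mp hε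
  refine ⟨k, ?_⟩
  have h1 : ((φ + e * ε : ℝ) : ℂ) = ((2 * π * k : ℝ) : ℂ) := by
    apply mul_right_cancel₀ Complex.I_ne_zero
    rw [hk]
    push_cast
    ring
  have h2 : φ + e * ε = 2 * π * k := Complex.ofReal_injective h1
  simp only
  field_simp
  linarith

/-- Through every point runs a line that leaves the generic set only at countably many parameters,
so two continuous functions that agree on generic points agree everywhere. -/
theorem eq_of_distinct {n : ℕ} {f g : (Fin n → ℝ) → ℂ} (hf : Continuous f) (hg : Continuous g)
    (h : ∀ θ, Distinct (circ θ) → f θ = g θ) (θ : Fin n → ℝ) : f θ = g θ := by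
  -- The slopes are positive and distinct, so doubles, sums and differences of them are nonzero.
  let γ : ℝ → Fin n → ℝ := fun ε i => θ i + ε * ((i : ℕ) + 1)
  have hγ : Continuous γ := by fun_prop
  let B : Set ℝ := (⋃ i : Fin n, {ε | circ (γ ε) i ^ 2 = 1}) ∪
    (⋃ i : Fin n, ⋃ j : Fin n, ⋃ _ : i ≠ j, {ε | circ (γ ε) i * circ (γ ε) j = 1} ∪
      {ε | circ (γ ε) i / circ (γ ε) j = 1})
  have hB : B.Countable := by
    refine (Set.countable_iUnion fun i => ?_).union (Set.countable_iUnion fun i =>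
      Set.countable_iUnion fun j => Set.countable_iUnion fun hij => Set.Countable.union ?_ ?_)
    · have he : (2 * ((i : ℕ) + 1) : ℝ) ≠ 0 := by positivity
      convert countable_exp_eq_one (2 * θ i) he using 4 with ε
      rw [circ, ← Complex.exp_nat_mul]
      congr 1
      simp only [γ]
      push_cast
      ring
    · have he : ((i : ℕ) + 1 + ((j : ℕ) + 1) : ℝ) ≠ 0 := by positivity
      convert countable_exp_eq_one (θ i + θ j) he using 4 with ε
      rw [circ, circ, ← Complex.exp_add]
      congr 1
      simp only [γ]
      push_cast
      ring
    · have he : ((i : ℕ) - (j : ℕ) : ℝ) ≠ 0 := by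
        rw [sub_ne_zero]
        exact fun e => hij (Fin.ext (Nat.cast_injective e))
      convert countable_exp_eq_one (θ i - θ j) he using 4 with ε
      rw [circ, circ, ← Complex.exp_sub]
      congr 1
      simp only [γ]
      push_cast
      ring
  have hext := Continuous.ext_on (hB.dense_compl ℝ) (hf.comp hγ) (hg.comp hγ) fun ε hε => by
    apply h
    simp only [B, Set.mem_compl_iff, Set.mem_union, Set.mem_iUnion, not_or, not_exists,
      Set.mem_ofPred_eq] at hε
    exact ⟨hε.1, fun i j hij => hε.2 i j hij⟩
  have := congrFun hext 0
  simpa [γ] using this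

theorem theta_ne_zero_of_norm_eq_one {p u : ℂ} (hp : ‖p‖ < 1) (hp0 : p ≠ 0) (hu : ‖u‖ = 1)
    (hu1 : u ≠ 1) : theta u p ≠ 0 := by
  rw [Ne, theta_eq_zero_iff hp hp0 (norm_ne_zero_of_eq_one hu)]
  rintro ⟨k, rfl⟩
  apply hu1
  rw [norm_zpow] at hu
  have := (zpow_eq_one_iff_right₀ (norm_nonneg p) hp.ne).mp hu
  rw [this, zpow_zero]

/-- A power of p on the unit circle is 1, and no power of p has modulus strictly between |p| and 1;
the latter excludes coincidences between points of the torus and points of Y. -/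
theorem Distinct.generic {n : ℕ} {z : Fin n → ℂ} (h : Distinct z) (hz : ∀ i, ‖z i‖ = 1) {p : ℂ}
    (hp : ‖p‖ < 1) (hp0 : p ≠ 0) {Y : Finset ℂ} (hY : Generic p Y)
    (hYn : ∀ y ∈ Y, ‖p‖ < ‖y‖ ∧ ‖y‖ < 1) : Generic p (Finset.univ.image z ∪ Y) := by
  have key : ∀ i, ∀ y ∈ Y, pairTheta (z i) y p ≠ 0 := by
    intro i y hy
    have hzi := norm_ne_zero_of_eq_one (hz i)
    have hy0 := hY.ne_zero y hy
    obtain ⟨h1, h2⟩ := hYn y hy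
    refine mul_ne_zero (theta_ne_zero hp hp0 ?_ ?_) ?_
    · rwa [norm_mul, hz, one_mul]
    · rwa [norm_mul, hz, one_mul]
    · rw [theta_swap hp hzi hy0]
      refine mul_ne_zero (neg_ne_zero.mpr (div_ne_zero hzi hy0)) (theta_ne_zero hp hp0 ?_ ?_)
      · rwa [norm_div, hz, div_one]
      · rwa [norm_div, hz, div_one]
  refine ⟨?_, ?_, ?_⟩
  · intro u hu
    rcases Finset.mem_union.mp hu with hu | hu
    · obtain ⟨i, _, rfl⟩ := Finset.mem_image.mp hu
      exact norm_ne_zero_of_eq_one (hz i)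
    · exact hY.ne_zero u hu
  · intro u hu
    rcases Finset.mem_union.mp hu with hu | hu
    · obtain ⟨i, _, rfl⟩ := Finset.mem_image.mp hu
      exact theta_ne_zero_of_norm_eq_one hp hp0 (by rw [norm_pow, hz, one_pow]) (h.1 i)
    · exact hY.sq u hu
  · intro u hu v hv huv
    rcases Finset.mem_union.mp hu with hu | hu <;> rcases Finset.mem_union.mp hv with hv | hv
    · obtain ⟨i, _, rfl⟩ := Finset.mem_image.mp hu
      obtain ⟨j, _, rfl⟩ := Finset.mem_image.mp hv
      have hij : i ≠ j := fun e => huv (e ▸ rfl)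
      exact mul_ne_zero
        (theta_ne_zero_of_norm_eq_one hp hp0 (by rw [norm_mul, hz, hz, one_mul]) (h.2 i j hij).1)
        (theta_ne_zero_of_norm_eq_one hp hp0 (by rw [norm_div, hz, hz, div_one]) (h.2 i j hij).2)
    · obtain ⟨i, _, rfl⟩ := Finset.mem_image.mp hu
      exact key i v hv
    · obtain ⟨i, _, rfl⟩ := Finset.mem_image.mp hv
      have hzi := norm_ne_zero_of_eq_one (hz i)
      rw [pairTheta_swap hp hzi (hY.ne_zero u hu)]
      exact mul_ne_zero (neg_ne_zero.mpr (div_ne_zero (hY.ne_zero u hu) hzi)) (key i u hu)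
    · exact hY.pair u hu v hv huv

/-! ### The functions `stokes` integrate to zero -/

/-- The product of `Psi` and `stokes`, all poles cancelled. -/
def stokesPsi {n : ℕ} (p q t : ℂ) (β : Fin 6 → ℂ) (c : ℂ) (z : Fin (n + 1) → ℂ) : ℂ :=
  ∑ i, (gKernel p q t β (fun k => z (i.succAbove k)) (z i) +
      gKernel p q t β (fun k => z (i.succAbove k)) (z i)⁻¹) *
    ((∏ k, pairTheta c (z (i.succAbove k)) p) * Psi p q t β (fun k => z (i.succAbove k)))

section

variable {p q t : ℂ} {β : Fin 6 → ℂ} (hp : ‖p‖ < 1) (hp0 : p ≠ 0) (hq : ‖q‖ < 1) (hq0 : q ≠ 0)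
  (ht0 : t ≠ 0) (ht : ‖t‖ < 1) (hβ0 : ∀ m, β m ≠ 0) (hβ : ∀ m, ‖β m‖ < 1)

include hp hq hq0 ht0 ht hβ0 hβ

/-- The left side is meaningful only away from the poles of the coefficients; the right side is
continuous on the whole torus and is the function that gets integrated. -/
theorem Psi_mul_stokes {n : ℕ} {z : Fin (n + 1) → ℂ} (hz : ∀ i, ‖z i‖ = 1)
    (hinj : Function.Injective z) (hgen : Generic p (Finset.univ.image z)) (c : ℂ) :
    Psi p q t β z * stokes p t β c (Finset.univ.image z) = stokesPsi p q t β c z := by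
  rw [stokes, Finset.sum_image fun i _ j _ e => hinj e, Finset.mul_sum, stokesPsi]
  refine Finset.sum_congr rfl fun i _ => ?_
  set y : Fin n → ℂ := fun k => z (i.succAbove k) with hy
  have hyinj : Function.Injective y := hinj.comp Fin.succAbove_right_injective
  have herase : (Finset.univ.image z).erase (z i) = Finset.univ.image y := by
    ext u
    simp only [Finset.mem_erase, Finset.mem_image, Finset.mem_univ, true_and, hy]
    constructor
    · rintro ⟨hu, j, rfl⟩
      obtain ⟨k, rfl⟩ := Fin.exists_succAbove_eq (show j ≠ i from fun e => hu (e ▸ rfl))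
      exact ⟨k, rfl⟩
    · rintro ⟨k, rfl⟩
      exact ⟨fun e => Fin.succAbove_ne i k (hinj e), _, rfl⟩
  have hnot : z i ∉ Finset.univ.image y := by
    rw [← herase]; exact Finset.notMem_erase _ _
  have hY0 : ∀ v ∈ Finset.univ.image y, v ≠ 0 := fun v hv => by
    rw [← herase] at hv
    exact hgen.ne_zero v (Finset.mem_of_mem_erase hv)
  have hzi := norm_ne_zero_of_eq_one (hz i)
  have hD : denom p (Finset.univ.image y) (z i) ≠ 0 :=
    Generic.denom_ne_zero hnot (by
      rw [← herase, Finset.insert_erase (Finset.mem_image_of_mem z (Finset.mem_univ i))]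
      exact hgen)
  have hD' : denom p (Finset.univ.image y) (z i)⁻¹ ≠ 0 := by
    rw [denom_inv hp hY0 hzi]
    exact mul_ne_zero (neg_ne_zero.mpr (inv_ne_zero (pow_ne_zero _ hzi))) hD
  have hy1 : ∀ k, ‖y k‖ = 1 := fun k => hz _
  have h1 := fPlus_mul_psi hp hq hq0 ht0 ht hβ0 hβ hy1 hyinj (hz i) hD
  have h2 := fPlus_mul_psi hp hq hq0 ht0 ht hβ0 hβ hy1 hyinj
    (by rw [norm_inv, hz, inv_one] : ‖(z i)⁻¹‖ = 1) hD'
  rw [psiOne_inv, Finset.prod_congr rfl fun k _ => psiTwo_inv p q t (z i) (y k)] at h2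
  rw [herase, Finset.prod_image fun a _ b _ e => hyinj e, Psi_succAbove p q t β z i, ← h1, ← h2]
  ring

theorem continuous_stokesPsi_term {n : ℕ} {c : ℂ} (hc : c ≠ 0) (i : Fin (n + 1)) :
    Continuous fun θ : Fin (n + 1) → ℝ =>
      (gKernel p q t β (fun k => circ θ (i.succAbove k)) (circ θ i) +
        gKernel p q t β (fun k => circ θ (i.succAbove k)) (circ θ i)⁻¹) *
      ((∏ k, pairTheta c (circ θ (i.succAbove k)) p) *
        Psi p q t β (fun k => circ θ (i.succAbove k))) := by
  have cc : ∀ j, Continuous fun θ : Fin (n + 1) → ℝ => circ θ j := fun j =>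
    (continuous_apply j).comp (continuous_circ _)
  have c0 : ∀ (θ : Fin (n + 1) → ℝ) j, circ θ j ≠ 0 := fun θ j =>
    norm_ne_zero_of_eq_one (norm_circ θ j)
  have ci : Continuous fun θ : Fin (n + 1) → ℝ => (circ θ i)⁻¹ := (cc i).inv₀ fun θ => c0 θ i
  refine ((continuous_gKernel hp hq hq0 ht0 ht hβ0 hβ (fun k => cc _) (cc i)
    (fun θ k => norm_circ θ _) (fun θ => norm_circ θ i)).add
    (continuous_gKernel hp hq hq0 ht0 ht hβ0 hβ (fun k => cc _) ci
    (fun θ k => norm_circ θ _) (fun θ => by rw [norm_inv, norm_circ, inv_one]))).mul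
    ((continuous_finsetProd _ fun k _ => continuous_pairTheta_comp hp continuous_const (cc _)
      (fun _ => hc) (fun θ => c0 θ _)).mul
      (continuous_Psi hp hq ht0 ht continuous_const (continuous_pi fun k => cc _)
        (fun _ => hβ0) (fun _ => hβ) (fun θ k => norm_circ θ _)))

theorem continuous_stokesPsi {n : ℕ} {c : ℂ} (hc : c ≠ 0) :
    Continuous fun θ : Fin (n + 1) → ℝ => stokesPsi p q t β c (circ θ) :=
  continuous_finsetSum _ fun i _ => continuous_stokesPsi_term hp hq hq0 ht0 ht hβ0 hβ hc i

theorem integral_gKernel_add_inv {n : ℕ} {y : Fin n → ℂ} (hy : ∀ k, ‖y k‖ = 1) :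
    ∫ x in (0 : ℝ)..2 * π, (gKernel p q t β y (Complex.exp (x * Complex.I)) +
      gKernel p q t β y (Complex.exp (x * Complex.I))⁻¹) = 0 := by
  have cexp : Continuous fun x : ℝ => Complex.exp (x * Complex.I) := by fun_prop
  have cexpi : Continuous fun x : ℝ => (Complex.exp (x * Complex.I))⁻¹ :=
    cexp.inv₀ fun x => Complex.exp_ne_zero _
  have hexp : ∀ x : ℝ, ‖Complex.exp (x * Complex.I)‖ = 1 := fun x =>
    Complex.norm_exp_ofReal_mul_I x
  have h1 := continuous_gKernel hp hq hq0 ht0 ht hβ0 hβ (y := fun _ : ℝ => y)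
    (fun k => continuous_const) cexp (fun _ => hy) hexp
  have h2 := continuous_gKernel hp hq hq0 ht0 ht hβ0 hβ (y := fun _ : ℝ => y)
    (fun k => continuous_const) cexpi (fun _ => hy) (fun x => by rw [norm_inv, hexp, inv_one])
  rw [intervalIntegral.integral_add (h1.intervalIntegrable _ _) (h2.intervalIntegrable _ _),
    integral_gKernel hp hq hq0 ht0 ht hβ0 hβ hy, integral_gKernel_inv hp hq hq0 ht0 ht hβ0 hβ hy,
    add_zero]

/-- In the i-th term the i-th variable enters only through the two kernels, whose integral over that
variable is zero. -/
theorem torusAvg_stokesPsi {n : ℕ} {c : ℂ} (hc : c ≠ 0) :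
    torusAvg (n := n + 1) (stokesPsi p q t β c) = 0 := by
  rw [torusAvg]
  simp only [stokesPsi]
  rw [MeasureTheory.integral_finsetSum]
  · refine Finset.sum_eq_zero fun i _ => integral_Icc_eq_zero i
      (continuous_stokesPsi_term hp hq hq0 ht0 ht hβ0 hβ hc i) fun Θ => ?_
    simp only [circ_insertNth_self, circ_insertNth_succAbove]
    rw [intervalIntegral.integral_mul_const]
    exact mul_eq_zero_of_left
      (integral_gKernel_add_inv hp hq hq0 ht0 ht hβ0 hβ (norm_circ Θ)) _
  · intro i _
    exact (continuous_stokesPsi_term hp hq hq0 ht0 ht hβ0 hβ hc i).integrableOn_Icc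

omit hq0 in
theorem continuous_Psi_mul_prod {n : ℕ} {c : ℂ} (hc : c ≠ 0) :
    Continuous fun θ : Fin n → ℝ => Psi p q t β (circ θ) * ∏ i, pairTheta c (circ θ i) p :=
  (continuous_Psi hp hq ht0 ht continuous_const (continuous_circ n) (fun _ => hβ0) (fun _ => hβ)
    norm_circ).mul (continuous_finsetProd _ fun i _ => continuous_pairTheta_comp hp continuous_const
      ((continuous_apply i).comp (continuous_circ n)) (fun _ => hc)
      fun θ => norm_ne_zero_of_eq_one (norm_circ θ i))

include hp0

/-- The integral identity for parameters in general position. -/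
theorem torusAvg_relation_of_regular {n : ℕ} (hbal : (∏ m, β m) * t ^ (2 * n) = p) {k l : Fin 6}
    (hkl : k ≠ l) (hR : Regular p t (β k) (β l) n)
    (hEa : ∀ m, m ≠ k → m ≠ l → ∀ i ≤ n, theta (β m * β k * t ^ i) p ≠ 0)
    (hEb : ∀ m, m ≠ k → m ≠ l → ∀ i ≤ n, theta (β m * β l * t ^ i) p ≠ 0)
    (hgrid : ∀ m, ∀ i ≤ n, ‖p‖ < ‖β m * t ^ i‖ ∧ ‖β m * t ^ i‖ < 1) :
    torusAvg (n := n + 1) (fun z => Psi p q t β z * ∏ i, pairTheta (β k) (z i) p) *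
        (∏ i ∈ Finset.range (n + 1), ∏ m ∈ (Finset.univ.erase k).erase l,
          theta (β m * β l * t ^ i) p) =
      torusAvg (n := n + 1) (fun z => Psi p q t β z * ∏ i, pairTheta (β l) (z i) p) *
        ∏ i ∈ Finset.range (n + 1), ∏ m ∈ (Finset.univ.erase k).erase l,
          theta (β m * β k * t ^ i) p := by
  obtain ⟨e, A, B, hbase, hconc⟩ := exists_combo hp ht0 (hβ0 k) (hβ0 l) hkl rfl rfl hR hEa hEb
  apply hconc
  have hg := hR.gridGeneric hp ht0 (hβ0 k) (hβ0 l)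
  have hgn : ∀ y ∈ grid (β k) (β l) t (n + 1) (n + 1), ‖p‖ < ‖y‖ ∧ ‖y‖ < 1 := by
    intro y hy
    rcases Finset.mem_union.mp hy with hy | hy <;> obtain ⟨i, hi, rfl⟩ := mem_geom.mp hy
    exacts [hgrid k i (by omega), hgrid l i (by omega)]
  have hc0 : ∀ j : Fin (n + 1), β k * t ^ (j : ℕ) ≠ 0 := fun j =>
    mul_ne_zero (hβ0 k) (pow_ne_zero _ ht0)
  have cS : ∀ j : Fin (n + 1), Continuous fun θ : Fin (n + 1) → ℝ =>
      stokesPsi p q t β (β k * t ^ (j : ℕ)) (circ θ) := fun j =>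
    continuous_stokesPsi hp hq hq0 ht0 ht hβ0 hβ (hc0 j)
  have ck := continuous_Psi_mul_prod hp hq ht0 ht hβ0 hβ (n := n + 1) (hβ0 k)
  have cl := continuous_Psi_mul_prod hp hq ht0 ht hβ0 hβ (n := n + 1) (hβ0 l)
  -- `combo_eq_zero` gives the identity at generic points with no grid point left; continuity
  -- extends it to the torus, where it can be integrated.
  have hpt : ∀ θ : Fin (n + 1) → ℝ,
      A * (Psi p q t β (circ θ) * ∏ i, pairTheta (β k) (circ θ i) p) +
      B * (Psi p q t β (circ θ) * ∏ i, pairTheta (β l) (circ θ i) p) =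
      -∑ j, e j * stokesPsi p q t β (β k * t ^ (j : ℕ)) (circ θ) := by
    refine eq_of_distinct ((continuous_const.mul ck).add (continuous_const.mul cl))
      (continuous_finsetSum _ fun j _ => continuous_const.mul (cS j)).neg fun θ hθ => ?_
    have hn := norm_circ θ
    have hinj := hθ.injective fun i => norm_ne_zero_of_eq_one (hn i)
    have hgen := hθ.generic hn hp hp0 hg.gen hgn
    have hdisj : Disjoint (Finset.univ.image (circ θ)) (grid (β k) (β l) t (n + 1) (n + 1)) := by
      rw [Finset.disjoint_left]
      intro u hu hu'
      obtain ⟨i, _, rfl⟩ := Finset.mem_image.mp hu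
      exact (hgn _ hu').2.ne (hn i)
    have hcombo := combo_eq_zero hp hp0 ht0 hβ0 hbal hc0 (hβ0 k) (hβ0 l) hg hbase (n + 1)
      (Finset.univ.image (circ θ)) 0 0
      (by rw [Finset.card_image_of_injective _ hinj, Finset.card_univ, Fintype.card_fin])
      (by omega) hgen hdisj
    rw [show grid (β k) (β l) t 0 0 = ∅ from rfl, Finset.union_empty, combo,
      Finset.prod_image fun i _ j _ e => hinj e, Finset.prod_image fun i _ j _ e => hinj e] at hcombo
    have h1 : ∀ j : Fin (n + 1), e j * stokesPsi p q t β (β k * t ^ (j : ℕ)) (circ θ) =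
        Psi p q t β (circ θ) *
          (e j * stokes p t β (β k * t ^ (j : ℕ)) (Finset.univ.image (circ θ))) := fun j => by
      rw [← Psi_mul_stokes hp hq hq0 ht0 ht hβ0 hβ hn hinj (hgen.mono Finset.subset_union_left)]
      ring
    rw [Finset.sum_congr rfl fun j _ => h1 j, ← Finset.mul_sum]
    linear_combination Psi p q t β (circ θ) * hcombo
  simp only [torusAvg]
  rw [← MeasureTheory.integral_const_mul, ← MeasureTheory.integral_const_mul,
    ← MeasureTheory.integral_add (ck.integrableOn_Icc.const_mul A) (cl.integrableOn_Icc.const_mul B),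
    MeasureTheory.integral_congr_ae (.of_forall hpt), MeasureTheory.integral_neg,
    MeasureTheory.integral_finsetSum _ fun j _ => (cS j).integrableOn_Icc.const_mul (e j)]
  rw [Finset.sum_eq_zero, neg_zero]
  intro j _
  rw [MeasureTheory.integral_const_mul]
  have := torusAvg_stokesPsi hp hq hq0 ht0 ht hβ0 hβ (n := n) (hc0 j)
  rw [torusAvg] at this
  rw [this, mul_zero]

end

/-! ### Removing the genericity assumptions -/

/-- By balancing, p is β_k β_l t^i times further factors of modulus at most 1, including at least
one β_m, which makes the inequality strict. Such arguments lie between |p| and 1, where θ has no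
zeros. -/
theorem norm_lt_mul_mul_pow {p t : ℂ} {β : Fin 6 → ℂ} {N : ℕ} (ht0 : t ≠ 0) (ht : ‖t‖ < 1)
    (hβ0 : ∀ m, β m ≠ 0) (hβ : ∀ m, ‖β m‖ < 1) (hbal : (∏ m, β m) * t ^ N = p)
    {k l : Fin 6} (hkl : k ≠ l) {i : ℕ} (hi : i ≤ N) : ‖p‖ < ‖β k * β l * t ^ i‖ := by
  obtain ⟨m, hmk, hml⟩ : ∃ m : Fin 6, m ≠ k ∧ m ≠ l := by
    revert k l; decide
  have hl : l ∈ Finset.univ.erase k := Finset.mem_erase.mpr ⟨hkl.symm, Finset.mem_univ _⟩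
  have hm : m ∈ (Finset.univ.erase k).erase l :=
    Finset.mem_erase.mpr ⟨hml, Finset.mem_erase.mpr ⟨hmk, Finset.mem_univ _⟩⟩
  have hrest : ‖∏ m ∈ (Finset.univ.erase k).erase l, β m‖ < 1 := by
    rw [norm_prod, ← Finset.mul_prod_erase _ _ hm]
    refine (mul_le_of_le_one_right (norm_nonneg _) ?_).trans_lt (hβ m)
    exact Finset.prod_le_one (fun _ _ => norm_nonneg _) fun j _ => (hβ j).le
  have hpos : 0 < ‖β k * β l * t ^ i‖ :=
    norm_pos_iff.mpr (mul_ne_zero (mul_ne_zero (hβ0 k) (hβ0 l)) (pow_ne_zero _ ht0))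
  have hsplit : p = β k * β l * t ^ i * (∏ m ∈ (Finset.univ.erase k).erase l, β m) *
      t ^ (N - i) := by
    rw [← hbal, ← Finset.mul_prod_erase _ _ (Finset.mem_univ k), ← Finset.mul_prod_erase _ _ hl,
      ← Nat.add_sub_cancel' hi, pow_add, Nat.add_sub_cancel_left]
    ring
  rw [hsplit, norm_mul, norm_mul _ (∏ m ∈ _, β m), mul_assoc]
  refine mul_lt_of_lt_one_right hpos ?_
  refine (mul_le_of_le_one_right (norm_nonneg _) ?_).trans_lt hrest
  rw [norm_pow]
  exact pow_le_one₀ (norm_nonneg _) ht.le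

theorem norm_mul_mul_pow_lt_one {t x y : ℂ} (ht : ‖t‖ < 1) (hx : ‖x‖ < 1) (hy : ‖y‖ < 1) (i : ℕ) :
    ‖x * y * t ^ i‖ < 1 := by
  rw [norm_mul, norm_mul, norm_pow]
  exact mul_lt_one_of_nonneg_of_lt_one_left (by positivity)
    (mul_lt_one_of_nonneg_of_lt_one_left (norm_nonneg _) hx hy.le)
    (pow_le_one₀ (norm_nonneg _) ht.le)

theorem theta_mul_mul_pow_ne_zero {p t : ℂ} {β : Fin 6 → ℂ} {N : ℕ} (hp : ‖p‖ < 1) (hp0 : p ≠ 0)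
    (ht0 : t ≠ 0) (ht : ‖t‖ < 1) (hβ0 : ∀ m, β m ≠ 0) (hβ : ∀ m, ‖β m‖ < 1)
    (hbal : (∏ m, β m) * t ^ N = p) {k l : Fin 6} (hkl : k ≠ l) {i : ℕ} (hi : i ≤ N) :
    theta (β k * β l * t ^ i) p ≠ 0 :=
  theta_ne_zero hp hp0 (norm_lt_mul_mul_pow ht0 ht hβ0 hβ hbal hkl hi)
    (norm_mul_mul_pow_lt_one ht (hβ k) (hβ l) i)

theorem theta_pow_ne_zero {p t : ℂ} {N j : ℕ} (hp : ‖p‖ < 1) (hp0 : p ≠ 0)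
    (ht : ‖t‖ < 1) (hpt : ‖p‖ < ‖t‖ ^ N) (hj0 : j ≠ 0) (hj : j ≤ N) : theta (t ^ j) p ≠ 0 := by
  refine theta_ne_zero hp hp0 ?_ ?_ <;> rw [norm_pow]
  · exact hpt.trans_le (pow_le_pow_of_le_one (norm_nonneg _) ht.le hj)
  · exact pow_lt_one₀ (norm_nonneg _) ht hj0

/-- The exponents of t reach s + 1 ≤ n + 1; a nonempty product has n ≥ 1, so n + 1 ≤ 2n and the
bound on |p| suffices. -/
theorem tauProd_ne_zero {p t : ℂ} {n s : ℕ} (hp : ‖p‖ < 1) (hp0 : p ≠ 0) (ht0 : t ≠ 0)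
    (ht : ‖t‖ < 1) (hpt : ‖p‖ < ‖t‖ ^ (2 * n)) (hs : s ≤ n) : tauProd p t s ≠ 0 := by
  refine Finset.prod_ne_zero_iff.mpr fun i hi => ?_
  have hi := Finset.mem_range.mp hi
  rw [show t ^ s / t ^ i = t ^ (s - i) from (pow_sub₀ t ht0 hi.le).symm, ← pow_succ']
  exact div_ne_zero (theta_pow_ne_zero hp hp0 ht hpt (by omega) (by omega))
    (theta_pow_ne_zero hp hp0 ht hpt (by omega) (by omega))

/-- A zero means C e^{ex} t^j = p^k; taking logarithms of moduli determines x from the pair (j, k).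
-/
theorem countable_setOf_theta_mul_exp_eq_zero {p t C : ℂ} (hp : ‖p‖ < 1) (hp0 : p ≠ 0)
    (ht0 : t ≠ 0) (hC : C ≠ 0) {e : ℝ} (he : e ≠ 0) :
    {x : ℝ | ∃ j : ℤ, theta (C * Complex.exp (e * x) * t ^ j) p = 0}.Countable := by
  refine (Set.countable_range fun v : ℤ × ℤ =>
    (v.2 * Real.log ‖p‖ - v.1 * Real.log ‖t‖ - Real.log ‖C‖) / e).mono ?_
  rintro x ⟨j, hj⟩
  obtain ⟨k, hk⟩ := (theta_eq_zero_iff hp hp0 (mul_ne_zero (mul_ne_zero hC (Complex.exp_ne_zero _))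
    (zpow_ne_zero _ ht0))).mp hj
  refine ⟨(j, k), ?_⟩
  have h := congrArg (fun u : ℂ => Real.log ‖u‖) hk
  have hx : ‖Complex.exp (e * x)‖ = Real.exp (e * x) := by
    rw [← Complex.ofReal_mul, Complex.norm_exp_ofReal]
  simp only [norm_mul, norm_zpow, hx] at h
  rw [Real.log_mul (by positivity) (by positivity), Real.log_mul (by positivity) (by positivity),
    Real.log_exp, Real.log_zpow, Real.log_zpow] at h
  simp only
  rw [div_eq_iff he]
  linarith

theorem continuous_torusAvg {X : Type*} [TopologicalSpace X] [FirstCountableTopology X]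
    [LocallyCompactSpace X] {n : ℕ} {E : X → (Fin n → ℂ) → ℂ}
    (hE : Continuous fun v : X × (Fin n → ℝ) => E v.1 (circ v.2)) :
    Continuous fun x => torusAvg (E x) :=
  continuous_parametric_integral_of_continuous hE isCompact_Icc

/-- A deformation of the parameters that keeps their product. -/
def deform (β : Fin 6 → ℂ) (e : Fin 6 → ℝ) (x : ℝ) (m : Fin 6) : ℂ :=
  β m * Complex.exp (e m * x)

theorem deform_zero (β : Fin 6 → ℂ) (e : Fin 6 → ℝ) : deform β e 0 = β := by
  ext m; simp [deform]

theorem prod_deform (β : Fin 6 → ℂ) {e : Fin 6 → ℝ} (he : ∑ m, e m = 0) (x : ℝ) :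
    ∏ m, deform β e x m = ∏ m, β m := by
  simp only [deform]
  rw [Finset.prod_mul_distrib, ← Complex.exp_sum, ← Finset.sum_mul, ← Complex.ofReal_sum, he]
  simp

theorem continuous_deform (β : Fin 6 → ℂ) (e : Fin 6 → ℝ) : Continuous (deform β e) := by
  unfold deform
  fun_prop

/-- A third parameter absorbs the change and keeps the balancing condition. With 1 and 2, the
quantities β_k², β_l² and β_k/β_l move with the nonzero exponents 2, 4 and -1. -/
theorem exists_exponents {k l : Fin 6} (hkl : k ≠ l) :
    ∃ e : Fin 6 → ℝ, ∑ m, e m = 0 ∧ e k = 1 ∧ e l = 2 := by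
  obtain ⟨m, hmk, hml⟩ : ∃ m : Fin 6, m ≠ k ∧ m ≠ l := by
    revert k l; decide
  refine ⟨Pi.single k 1 + Pi.single l 2 + Pi.single m (-3), ?_, ?_, ?_⟩
  · simp only [Pi.add_apply, Finset.sum_add_distrib, Finset.sum_pi_single', Finset.mem_univ, if_true]
    norm_num
  · simp [hkl, hmk.symm]
  · simp [hkl.symm, hml.symm]

section

variable {p q t : ℂ} {β : Fin 6 → ℂ} (hp : ‖p‖ < 1) (hp0 : p ≠ 0) (hq : ‖q‖ < 1) (hq0 : q ≠ 0)
  (ht0 : t ≠ 0) (ht : ‖t‖ < 1) (hβ0 : ∀ m, β m ≠ 0) (hβ : ∀ m, ‖β m‖ < 1)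
  {n : ℕ} (hpt : ‖p‖ < ‖t‖ ^ (2 * n)) (hbal : (∏ m, β m) * t ^ (2 * n) = p) {k l : Fin 6}
  (hkl : k ≠ l)

include hp hp0 hq hq0 ht0 ht hβ0 hβ hpt hbal hkl

theorem torusAvg_relation_of_generic (h1 : ∀ j : ℕ, theta (β k * β k * t ^ j) p ≠ 0)
    (h2 : ∀ j : ℕ, theta (β l * β l * t ^ j) p ≠ 0)
    (h3 : ∀ j : ℤ, theta (β k / β l * t ^ j) p ≠ 0) :
    torusAvg (n := n + 1) (fun z => Psi p q t β z * ∏ i, pairTheta (β k) (z i) p) *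
        (∏ i ∈ Finset.range (n + 1), ∏ m ∈ (Finset.univ.erase k).erase l,
          theta (β m * β l * t ^ i) p) =
      torusAvg (n := n + 1) (fun z => Psi p q t β z * ∏ i, pairTheta (β l) (z i) p) *
        ∏ i ∈ Finset.range (n + 1), ∏ m ∈ (Finset.univ.erase k).erase l,
          theta (β m * β k * t ^ i) p := by
  have hne : ∀ {m m' : Fin 6}, m ≠ m' → ∀ i ≤ 2 * n, theta (β m * β m' * t ^ i) p ≠ 0 :=
    fun hm i hi => theta_mul_mul_pow_ne_zero hp hp0 ht0 ht hβ0 hβ hbal hm hi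
  refine torusAvg_relation_of_regular hp hp0 hq hq0 ht0 ht hβ0 hβ hbal hkl
    ⟨h1, h2, h3, hne hkl, fun j h0 hj => theta_pow_ne_zero hp hp0 ht hpt (by omega) (by omega),
      fun s hs => tauProd_ne_zero hp hp0 ht0 ht hpt hs⟩
    (fun m hk _ i hi => hne hk i (by omega)) (fun m _ hl i hi => hne hl i (by omega))
    fun m i hi => ⟨?_, ?_⟩
  · obtain ⟨m', hm'⟩ := exists_ne m
    refine (norm_lt_mul_mul_pow ht0 ht hβ0 hβ hbal hm'.symm (by omega : i ≤ 2 * n)).trans_le ?_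
    rw [mul_right_comm, norm_mul _ (β m')]
    exact mul_le_of_le_one_right (norm_nonneg _) (hβ m').le
  · rw [norm_mul, norm_pow]
    exact mul_lt_one_of_nonneg_of_lt_one_left (norm_nonneg _) (hβ m)
      (pow_le_one₀ (norm_nonneg _) ht.le)

/-- Both sides are continuous along the deformation and agree off a countable set of deformation
parameters, hence also at 0. -/
theorem torusAvg_relation :
    torusAvg (n := n + 1) (fun z => Psi p q t β z * ∏ i, pairTheta (β k) (z i) p) *
        (∏ i ∈ Finset.range (n + 1), ∏ m ∈ (Finset.univ.erase k).erase l,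
          theta (β m * β l * t ^ i) p) =
      torusAvg (n := n + 1) (fun z => Psi p q t β z * ∏ i, pairTheta (β l) (z i) p) *
        ∏ i ∈ Finset.range (n + 1), ∏ m ∈ (Finset.univ.erase k).erase l,
          theta (β m * β k * t ^ i) p := by
  obtain ⟨e, he, hek, hel⟩ := exists_exponents hkl
  have hb0 : ∀ x m, deform β e x m ≠ 0 := fun x m => mul_ne_zero (hβ0 m) (Complex.exp_ne_zero _)
  -- Continuity of the weight needs all parameters inside the unit disc; U is an open neighbourhood
  -- of 0, so dense sets of reals stay dense in it.
  let U : Set ℝ := {x | ∀ m, ‖deform β e x m‖ < 1}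
  have hU : IsOpen U := by
    have : U = ⋂ m, {x | ‖deform β e x m‖ < 1} := by ext; simp [U]
    rw [this]
    exact isOpen_iInter_of_finite fun m => isOpen_lt
      ((continuous_apply m).comp (continuous_deform β e)).norm continuous_const
  have : LocallyCompactSpace U := hU.locallyCompactSpace
  have hb : Continuous fun x : U => deform β e x :=
    (continuous_deform β e).comp continuous_subtype_val
  have hbm : ∀ m, Continuous fun x : U => deform β e x m := fun m => (continuous_apply m).comp hb
  let F : Fin 6 → (Fin 6 → ℂ) → ℂ := fun m b =>
    torusAvg (n := n + 1) fun z => Psi p q t b z * ∏ i, pairTheta (b m) (z i) p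
  let G : Fin 6 → (Fin 6 → ℂ) → ℂ := fun k' b =>
    ∏ i ∈ Finset.range (n + 1), ∏ m ∈ (Finset.univ.erase k).erase l, theta (b m * b k' * t ^ i) p
  have hT : ∀ m, Continuous fun x : U => F m (deform β e x) := fun m =>
    continuous_torusAvg <| (continuous_Psi hp hq ht0 ht (hb.comp continuous_fst)
      ((continuous_circ _).comp continuous_snd) (fun v => hb0 _) (fun v => v.1.2)
      (fun v => norm_circ _)).mul <| continuous_finsetProd _ fun i _ =>
        continuous_pairTheta_comp hp ((hbm m).comp continuous_fst)
          ((continuous_apply i).comp ((continuous_circ _).comp continuous_snd)) (fun v => hb0 _ _)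
          fun v => norm_ne_zero_of_eq_one (norm_circ _ _)
  have hP : ∀ k', Continuous fun x : U => G k' (deform β e x) :=
    fun k' => continuous_finsetProd _ fun i _ => continuous_finsetProd _ fun m _ =>
      continuous_theta_comp hp (((hbm m).mul (hbm k')).mul continuous_const) fun x =>
        mul_ne_zero (mul_ne_zero (hb0 _ _) (hb0 _ _)) (pow_ne_zero _ ht0)
  have hdense := ((((countable_setOf_theta_mul_exp_eq_zero hp hp0 ht0
      (mul_ne_zero (hβ0 k) (hβ0 k)) (two_ne_zero (α := ℝ))).union
    (countable_setOf_theta_mul_exp_eq_zero hp hp0 ht0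
      (mul_ne_zero (hβ0 l) (hβ0 l)) (four_ne_zero (α := ℝ)))).union
    (countable_setOf_theta_mul_exp_eq_zero hp hp0 ht0
      (div_ne_zero (hβ0 k) (hβ0 l)) (neg_ne_zero.mpr (one_ne_zero (α := ℝ))))).dense_compl ℝ).preimage
    hU.isOpenMap_subtype_val
  suffices hall : (fun x : U => F k (deform β e x) * G l (deform β e x)) =
      fun x : U => F l (deform β e x) * G k (deform β e x) by
    have h0 : (0 : ℝ) ∈ U := by
      intro m; rw [deform_zero]; exact hβ m
    have h := congrFun hall ⟨0, h0⟩
    change F k (deform β e 0) * G l (deform β e 0) = F l (deform β e 0) * G k (deform β e 0) at h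
    rw [deform_zero] at h
    exact h
  refine Continuous.ext_on hdense ((hT k).mul (hP l)) ((hT l).mul (hP k)) ?_
  rintro ⟨x, hx⟩ hxg
  simp only [Set.mem_preimage, Set.mem_compl_iff, Set.mem_union, Set.mem_ofPred_eq, not_or,
    not_exists] at hxg
  obtain ⟨⟨g1, g2⟩, g3⟩ := hxg
  refine torusAvg_relation_of_generic hp hp0 hq hq0 ht0 ht (hb0 x) hx hpt
    (by rw [prod_deform β he, hbal]) hkl (fun j => ?_) (fun j => ?_) (fun j => ?_)
  · convert g1 j using 2
    rw [zpow_natCast, deform, hek, Complex.ofReal_one, Complex.ofReal_ofNat, one_mul, two_mul,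
      Complex.exp_add]
    ring
  · convert g2 j using 2
    rw [zpow_natCast, deform, hel, Complex.ofReal_ofNat, Complex.ofReal_ofNat,
      show (4 : ℂ) * x = 2 * x + 2 * x by ring, Complex.exp_add]
    ring
  · convert g3 j using 2
    rw [deform, deform, hek, hel, Complex.ofReal_neg, Complex.ofReal_one, Complex.ofReal_ofNat,
      show (-1 : ℂ) * x = 1 * x - 2 * x by ring, Complex.exp_sub]
    have := hβ0 l
    field_simp

end

/-! ### The elliptic Selberg integral -/

theorem torusMap_zero_one {n : ℕ} (θ : Fin n → ℝ) :
    torusMap (fun _ => 0) (fun _ => 1) θ = circ θ := by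
  ext i; simp [torusMap, circ]

theorem continuous_Psi_circ {p q t : ℂ} {a : Fin 6 → ℂ} (hp : ‖p‖ < 1) (hq : ‖q‖ < 1)
    (ht0 : t ≠ 0) (ht : ‖t‖ < 1) (ha0 : ∀ m, a m ≠ 0) (ha : ∀ m, ‖a m‖ < 1) (n : ℕ) :
    Continuous fun θ : Fin n → ℝ => Psi p q t a (circ θ) :=
  continuous_Psi hp hq ht0 ht continuous_const (continuous_circ n) (fun _ => ha0) (fun _ => ha)
    norm_circ

theorem torusIntegrable_integrand {p q t : ℂ} {a : Fin 6 → ℂ} (hp : ‖p‖ < 1) (hq : ‖q‖ < 1)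
    (ht0 : t ≠ 0) (ht : ‖t‖ < 1) (ha0 : ∀ m, a m ≠ 0) (ha : ∀ m, ‖a m‖ < 1) (n : ℕ) :
    TorusIntegrable (n := n) (integrand p q t a) (fun _ => 0) (fun _ => 1) := by
  simp only [TorusIntegrable, torusMap_zero_one, integrand]
  exact ((continuous_Psi_circ hp hq ht0 ht ha0 ha n).div
    (continuous_finsetProd _ fun i _ => (continuous_apply i).comp (continuous_circ n))
    fun θ => Finset.prod_ne_zero_iff.mpr fun i _ =>
      norm_ne_zero_of_eq_one (norm_circ θ i)).integrableOn_Icc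

/-- On the unit circle dz/z = i dθ, which cancels the denominator of the integrand. -/
theorem selbergI_eq (n : ℕ) (p q t : ℂ) (a : Fin 6 → ℂ) :
    selbergI n p q t a =
      ((2 * π * Complex.I) ^ n)⁻¹ * (Complex.I ^ n * torusAvg (n := n) (Psi p q t a)) := by
  rw [selbergI]
  congr 1
  rw [torusIntegral, torusAvg, ← MeasureTheory.integral_const_mul]
  refine MeasureTheory.integral_congr_ae (.of_forall fun θ => ?_)
  have h0 : ∏ i, circ θ i ≠ 0 := Finset.prod_ne_zero_iff.mpr fun i _ =>
    norm_ne_zero_of_eq_one (norm_circ θ i)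
  beta_reduce
  rw [torusMap_zero_one, smul_eq_mul, integrand, Finset.prod_mul_distrib, Fin.prod_const]
  simp only [Complex.ofReal_one, one_mul]
  change (∏ i, circ θ i) * _ * _ = _
  field_simp

theorem torusAvg_Psi_update {p q t : ℂ} {β : Fin 6 → ℂ} (hp : ‖p‖ < 1) (hq : ‖q‖ < 1)
    (hq0 : q ≠ 0) {m : Fin 6} (hβ0 : β m ≠ 0) (hβ : ‖β m‖ < 1) (n : ℕ) :
    torusAvg (n := n) (fun z => Psi p q t β z * ∏ i, pairTheta (β m) (z i) p) =
      torusAvg (n := n) (Psi p q t (Function.update β m (q * β m))) := by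
  simp only [torusAvg]
  exact MeasureTheory.integral_congr_ae (.of_forall fun θ =>
    (Psi_update hp hq hq0 hβ0 hβ (norm_circ θ)).symm)

theorem prod_erase_castSucc_erase_last {M : Type*} [CommMonoid M] (k : Fin 5) (f : Fin 6 → M) :
    ∏ m ∈ (Finset.univ.erase k.castSucc).erase (Fin.last 5), f m =
      ∏ m ∈ Finset.univ.erase k, f m.castSucc := by
  rw [← Finset.prod_image (f := f) (g := Fin.castSucc)
    fun a _ b _ e => Fin.castSucc_injective 5 e]
  congr 1
  revert k
  decide

/-- The transformation formula in terms of `β = (a_1, …, a_5, q⁻¹ a_6)`. -/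
theorem selbergI_update {p q t : ℂ} {β : Fin 6 → ℂ} (hp : ‖p‖ < 1) (hp0 : p ≠ 0) (hq : ‖q‖ < 1)
    (hq0 : q ≠ 0) (ht0 : t ≠ 0) (ht : ‖t‖ < 1) (hβ0 : ∀ m, β m ≠ 0) (hβ : ∀ m, ‖β m‖ < 1)
    {N : ℕ} (hpt : ‖p‖ < ‖t‖ ^ (2 * N)) (hbal : (∏ m, β m) * t ^ (2 * N) = p) (k : Fin 5) :
    selbergI (N + 1) p q t (Function.update β (Fin.last 5) (q * β (Fin.last 5))) =
      selbergI (N + 1) p q t (Function.update β k.castSucc (q * β k.castSucc)) *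
        ∏ i : Fin (N + 1), ∏ m ∈ Finset.univ.erase k,
          theta (β m.castSucc * β (Fin.last 5) * t ^ (i : ℕ)) p /
            theta (β m.castSucc * β k.castSucc * t ^ (i : ℕ)) p := by
  have h := torusAvg_relation hp hp0 hq hq0 ht0 ht hβ0 hβ hpt hbal
    (Fin.castSucc_lt_last k).ne
  rw [torusAvg_Psi_update hp hq hq0 (hβ0 _) (hβ _), torusAvg_Psi_update hp hq hq0 (hβ0 _) (hβ _)]
    at h
  simp only [prod_erase_castSucc_erase_last, Finset.prod_range] at h
  have hden : ∏ i : Fin (N + 1), ∏ m ∈ Finset.univ.erase k,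
      theta (β m.castSucc * β k.castSucc * t ^ (i : ℕ)) p ≠ 0 :=
    Finset.prod_ne_zero_iff.mpr fun i _ => Finset.prod_ne_zero_iff.mpr fun m hm =>
      theta_mul_mul_pow_ne_zero hp hp0 ht0 ht hβ0 hβ hbal
        ((Fin.castSucc_injective 5).ne (Finset.ne_of_mem_erase hm)) (by omega)
  simp only [Finset.prod_div_distrib]
  rw [selbergI_eq, selbergI_eq, ← mul_div_assoc, eq_div_iff hden]
  linear_combination (-((2 * π * Complex.I) ^ (N + 1))⁻¹ * Complex.I ^ (N + 1)) * h

end EllipticSelberg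

end

/-! ### The transformation formula in the original parameters. -/

theorem mainTheorem3 (n : ℕ) (hn : 1 ≤ n) (p q t : ℂ)
    (hp : ‖p‖ < 1) (hq : ‖q‖ < 1) (ht0 : t ≠ 0) (ht : ‖t‖ < 1)
    (hpt : ‖p‖ < ‖t‖ ^ (2 * n - 2))
    (a : Fin 6 → ℂ) (ha0 : ∀ m, a m ≠ 0)
    (hbal : (∏ m, a m) * t ^ (2 * n - 2) = p * q)
    (ha : ∀ m : Fin 5, ‖a m.castSucc‖ < 1) (ha6 : ‖a (Fin.last 5)‖ < ‖q‖) :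
    TorusIntegrable (n := n) (EllipticSelberg.integrand p q t a) (fun _ => 0) (fun _ => 1) ∧
    ∀ k : Fin 5,
      TorusIntegrable (n := n) (EllipticSelberg.integrand p q t (EllipticSelberg.shift q k a))
        (fun _ => 0) (fun _ => 1) ∧
      (∀ i : Fin n, ∀ m : Fin 5, m ≠ k →
        EllipticSelberg.theta (a m.castSucc * a k.castSucc * t ^ (i : ℕ)) p ≠ 0) ∧
      EllipticSelberg.selbergI n p q t a =
        EllipticSelberg.selbergI n p q t (EllipticSelberg.shift q k a) *
          ∏ i : Fin n, ∏ m ∈ Finset.univ.erase k,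
            EllipticSelberg.theta (q⁻¹ * a m.castSucc * a (Fin.last 5) * t ^ (i : ℕ)) p /
              EllipticSelberg.theta (a m.castSucc * a k.castSucc * t ^ (i : ℕ)) p := by
  obtain ⟨N, rfl⟩ : ∃ N, n = N + 1 := ⟨n - 1, by omega⟩
  rw [show 2 * (N + 1) - 2 = 2 * N by omega] at hpt hbal
  -- p ≠ 0 and q ≠ 0 are not assumed: the balancing condition forces them.
  have hpq : p * q ≠ 0 := by
    rw [← hbal]
    exact mul_ne_zero (Finset.prod_ne_zero_iff.mpr fun m _ => ha0 m) (pow_ne_zero _ ht0)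
  obtain ⟨hp0, hq0⟩ := mul_ne_zero_iff.mp hpq
  -- Division of a_6 by q turns the balancing value pq into p and the bound |a_6| < |q| into |β_6| <
  -- 1. Both parameter sets of the theorem then arise from β by multiplying one entry by q.
  set β : Fin 6 → ℂ := Function.update a (Fin.last 5) (q⁻¹ * a (Fin.last 5)) with hβdef
  have hlast : β (Fin.last 5) = q⁻¹ * a (Fin.last 5) := Function.update_self ..
  have hcast : ∀ m : Fin 5, β m.castSucc = a m.castSucc := fun m =>
    Function.update_of_ne (Fin.castSucc_lt_last m).ne ..
  have hβ0 : ∀ m, β m ≠ 0 := fun m => by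
    induction m using Fin.lastCases with
    | last => rw [hlast]; exact mul_ne_zero (inv_ne_zero hq0) (ha0 _)
    | cast m => rw [hcast]; exact ha0 _
  have hβ : ∀ m, ‖β m‖ < 1 := fun m => by
    induction m using Fin.lastCases with
    | last =>
      rw [hlast, norm_mul, norm_inv, inv_mul_lt_iff₀ (norm_pos_iff.mpr hq0), mul_one]
      exact ha6
    | cast m => rw [hcast]; exact ha m
  have ha1 : ∀ m, ‖a m‖ < 1 := fun m => by
    induction m using Fin.lastCases with
    | last => exact ha6.trans hq
    | cast m => exact ha m
  have hbalβ : (∏ m, β m) * t ^ (2 * N) = p := by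
    rw [Fin.prod_univ_castSucc] at hbal ⊢
    simp only [hcast, hlast]
    refine mul_right_cancel₀ hq0 ?_
    rw [← hbal]
    field_simp
  have haβ : a = Function.update β (Fin.last 5) (q * β (Fin.last 5)) := by
    rw [hlast, mul_inv_cancel_left₀ hq0, hβdef, Function.update_idem, Function.update_eq_self]
  have hshift : ∀ k : Fin 5, EllipticSelberg.shift q k a =
      Function.update β k.castSucc (q * β k.castSucc) := fun k => by
    rw [hcast, hβdef, Function.update_comm (Fin.castSucc_lt_last k).ne']
    rfl
  refine ⟨EllipticSelberg.torusIntegrable_integrand hp hq ht0 ht ha0 ha1 _, fun k => ⟨?_, ?_, ?_⟩⟩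
  · rw [hshift]
    refine EllipticSelberg.torusIntegrable_integrand hp hq ht0 ht (fun m => ?_) (fun m => ?_) _ <;>
      rcases eq_or_ne m k.castSucc with rfl | hm
    · rw [Function.update_self]
      exact mul_ne_zero hq0 (hβ0 _)
    · rw [Function.update_of_ne hm]
      exact hβ0 m
    · rw [Function.update_self, norm_mul]
      exact mul_lt_one_of_nonneg_of_lt_one_left (norm_nonneg _) hq (hβ _).le
    · rw [Function.update_of_ne hm]
      exact hβ m
  · intro i m hm
    rw [← hcast, ← hcast]
    exact EllipticSelberg.theta_mul_mul_pow_ne_zero hp hp0 ht0 ht hβ0 hβ hbalβ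
      ((Fin.castSucc_injective 5).ne hm) (by omega)
  · have h := EllipticSelberg.selbergI_update hp hp0 hq hq0 ht0 ht hβ0 hβ hpt hbalβ k
    rw [← haβ, ← hshift] at h
    rw [h]
    congr 1
    refine Finset.prod_congr rfl fun i _ => Finset.prod_congr rfl fun m _ => ?_
    rw [hcast, hcast, hlast]
    congr 2
    ring
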